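/- Proposition (Ammann–Beenker rhomb–triangle tiling). Let $\mathcal T$ be an Ammann–Beenker rhomb–triangle tiling of the plane, defined as follows. The prototiles are the triangle with sides $1,1,\sqrt2$ and the rhombus with sides $1$ and acute angle $\pi/4$. A triangle is labelled $abc$ with right angle at $b$, and its edge $ac$ carries an arrow from $a$ to $c$. Put $\lambda=1+\sqrt2$ and, for points of the plane, $\hat z=\lambda z$. For an edge $xy$ of length $1$ let $m_{xy}=\hat x+\sqrt2(y-x)$ (it divides the inflated edge into parts of length $\sqrt2$, at $\hat x$, and $1$, at $\hat y$). The substitution replaces a triangle $abc$, with $h=\hat a+\frac{c-a}{\sqrt2}$, $h'=\hat c+\frac{a-c}{\sqrt2}$, $x=\hat b+\frac{(a-b)+(c-b)}{\sqrt2}$, by the 3 triangles and 2 rhombi $$m_{ab}\,h\,\hat a,\quad h'\,x\,h,\quad m_{bc}\,x\,\hat b,\quad h\,m_{ab}\,\hat b\,x,\quad x\,m_{bc}\,\hat c\,h',$$ and a rhombus $pqrs$ (acute angles at $p,r$), with $y=\hat p+(q-p)+(s-p)$, $z=\hat r+(q-r)+(s-r)$, by the 4 triangles and 3 rhombi $$m_{qp}\,y\,\hat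 q,\quad m_{sp}\,y\,\hat s,\quad m_{qr}\,z\,\hat q,\quad m_{sr}\,z\,\hat s,\quad \hat p\,m_{qp}\,y\,m_{sp},\quad \hat q\,y\,\hat s\,z,\quad \hat r\,m_{qr}\,z\,m_{sr}.$$ $\mathcal T$ is a tiling of the plane by (unlabelled) tiles such that every finite set of its tiles is contained in the $n$-fold substitution of some prototile, in some position (up to isometry), for some $n$. The supertiles are the *diamond* (a square of side $1+\sqrt2$: the substitutions of a triangle $abc$ and of its mirror image $adc$, $d=a+c-b$, in the line $ac$; 6 triangles and 4 rhombi) and the *rhombus* (the substitution of a rhombus; 4 triangles and 3 rhombi). Each has four corners, one *mid-side* vertex on each side between the corners, and internal vertices ($h,h'$ and the points $x$ of the two triangles in a diamond; $y,z$ in a rhombus). A *grouping* of $\mathcal T$ is a partition of its tiles into diamonds and rhombi such that no edge of length $\sqrt2$ receives opposite arrows from its two sides. The graph $G_{\mathcal T}$ has as vertices the vertices of the tiles; two distinct vertices are adjacent if the segment between them lies in the union of the tile boundaries and contains no intermediate vertex. The sum of a vertex is the total weight of its incident edges. Then: 1. Every edge of $G_{\mathcal T}$ has length $1$ or $\sqrt2$,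 and $G_{\mathcal T}$ is locally finite. Giving weight $1$ to every edge of length $1$ and weight $2$ to every edge of length $\sqrt2$ solves the 1-2-3 problem: the weights lie in $\{1,2,3\}$ and adjacent vertices have different sums. 2. $\mathcal T$ has a grouping into diamond and rhombus supertiles. 3. For every such grouping: every supertile corner is a vertex of degree $8$ (hence its sum is at least $8$); every mid-side vertex has degree $4$ and sum $5$; in a diamond the internal vertices $h$, $h'$ have sums $7$, $5$ and the other two have sum $4$, and in a rhombus both internal vertices have sum $4$; there are no other vertices. The external vertices are 2-coloured by type: no vertex is both a corner and a mid-side vertex, and every edge between two external vertices (corners or mid-side vertices) joins a corner to a mid-side vertex. -/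

import Mathlib

open scoped EuclideanGeometry

noncomputable section

/-! ### Tilings of the plane, their graphs, and the 1-2-3 problem -/

/-- A tiling of the plane: a countable collection of nonempty, closed, regular sets that cover the
plane and have pairwise disjoint interiors. -/
structure IsTiling (T : Set (Set ℂ)) : Prop where
  countable : T.Countable
  nonempty : ∀ S ∈ T, S.Nonempty
  isClosed : ∀ S ∈ T, IsClosed S
  regular : ∀ S ∈ T, closure (interior S) = S
  covers : ⋃₀ T = Set.univ
  disjoint : ∀ S ∈ T, ∀ S' ∈ T, S ≠ S' → interior S ∩ interior S' = ∅

/-- The vertices of a tiling by convex polygons: all vertices (extreme points) of its tiles. -/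
def tilingVertices (T : Set (Set ℂ)) : Set ℂ :=
  ⋃ S ∈ T, S.extremePoints ℝ

/-- The graph of a tiling by convex polygons. Two distinct vertices are joined by an edge if the
segment between them lies in the union of the boundaries of the tiles and contains no
intermediate vertex. -/
def tilingGraph (T : Set (Set ℂ)) : SimpleGraph (tilingVertices T) where
  Adj x y := x ≠ y ∧ segment ℝ (x : ℂ) y ⊆ (⋃ S ∈ T, frontier S) ∧
    openSegment ℝ (x : ℂ) y ∩ tilingVertices T = ∅
  symm := ⟨fun x y h => ⟨h.1.symm, by rw [segment_symm]; exact h.2.1,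
    by rw [openSegment_symm]; exact h.2.2⟩⟩
  loopless := ⟨fun _ h => h.1 rfl⟩

/-- The weighted degree `∑_{uv ∈ E} l(uv)` of `u`. Only the values of `l` on edges of `G` matter.
(A `finsum`, meaningful when `u` has finitely many neighbours.) -/
def weightedDegree {V : Type*} (G : SimpleGraph V) (l : Sym2 V → ℕ) (u : V) : ℕ :=
  ∑ᶠ v ∈ G.neighborSet u, l s(u, v)

/-- `G` is locally finite, and `l` is a solution to the 1-2-3 problem on `G`: a labelling of the
edges by `1, 2, 3` such that adjacent vertices have distinct weighted degrees. -/
structure IsSolution123 {V : Type*} (G : SimpleGraph V) (l : Sym2 V → ℕ) : Prop where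
  locallyFinite : ∀ v, (G.neighborSet v).Finite
  label_mem : ∀ e ∈ G.edgeSet, 1 ≤ l e ∧ l e ≤ 3
  colouring : ∀ u v, G.Adj u v → weightedDegree G l u ≠ weightedDegree G l v

open Classical in
/-- The weighting that gives weight `2` to edges of length `√2` and weight `1` to all others (i.e.
those of length `1`, when the tiling has only edges of length `1` and `√2`). -/
def lengthWeight (T : Set (Set ℂ)) : Sym2 (tilingVertices T) → ℕ :=
  Sym2.lift ⟨fun x y => if dist (x : ℂ) y = √2 then 2 else 1,
    fun x y => by beta_reduce; rw [dist_comm]⟩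

namespace AmmannBeenker

/-! ### The prototiles and the substitution -/

/-- Labelled tiles, given by their vertices. In `tri a b c` the right angle is at `b`, and the edge
`ac` of length `√2` carries an arrow pointing from `a` to `c`. In `rhomb p q r s` the vertices
are listed in cyclic order, with acute angles at `p` and `r`. -/
inductive Tile
  | tri (a b c : ℂ)
  | rhomb (p q r s : ℂ)

/-- The two prototiles, in any position (rotations, translations and reflections allowed): the
triangle with sides `1`, `1`, `√2`, and the rhombus with sides `1` and acute angle `π / 4`. -/
def Tile.Valid : Tile → Prop
  | .tri a b c => dist a b = 1 ∧ dist b c = 1 ∧ dist a c = √2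
  | .rhomb p q r s => dist p q = 1 ∧ dist p s = 1 ∧ r = q + s - p ∧ ∠ q p s = Real.pi / 4

/-- The subset of the plane occupied by a labelled tile. -/
def Tile.support : Tile → Set ℂ
  | .tri a b c => convexHull ℝ {a, b, c}
  | .rhomb p q r s => convexHull ℝ {p, q, r, s}

/-- The inflation by the factor `1 + √2`. -/
def infl (z : ℂ) : ℂ := (1 + √2 : ℝ) • z

/-- For an edge `xy` of length `1`: the point on the inflated edge (which has length `1 + √2`)
at distance `√2` from `infl x` and `1` from `infl y`. -/
def sideVertex (x y : ℂ) : ℂ := infl x + √2 • (y - x)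

/-- For an edge `xy` of length `√2`: the point on the inflated edge (which has length `2 + √2`)
at distance `1` from `infl x` and `1 + √2` from `infl y`. -/
def hypVertex (x y : ℂ) : ℂ := infl x + (√2)⁻¹ • (y - x)

/-- The interior vertex of an inflated triangle `abc`, at distance `1` from the right angle
`infl b`, on the bisector of that angle. -/
def apexVertex (a b c : ℂ) : ℂ := infl b + (√2)⁻¹ • ((a - b) + (c - b))

/-- An interior vertex of an inflated rhombus with acute angle at `p` between the edges `pq` and
`ps`: the far vertex of the small rhombus sitting in the corner `infl p`. -/
def acuteVertex (p q s : ℂ) : ℂ := infl p + (q - p) + (s - p)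

/-- The Ammann–Beenker rhomb–triangle substitution: a tile is inflated by `1 + √2` and dissected,
a triangle into 3 triangles and 2 rhombi, a rhombus into 4 triangles and 3 rhombi. -/
def Tile.subst : Tile → Set Tile
  | .tri a b c =>
    { .tri (sideVertex a b) (hypVertex a c) (infl a),
      .tri (hypVertex c a) (apexVertex a b c) (hypVertex a c),
      .tri (sideVertex b c) (apexVertex a b c) (infl b),
      .rhomb (hypVertex a c) (sideVertex a b) (infl b) (apexVertex a b c),
      .rhomb (apexVertex a b c) (sideVertex b c) (infl c) (hypVertex c a) }
  | .rhomb p q r s =>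
    { .tri (sideVertex q p) (acuteVertex p q s) (infl q),
      .tri (sideVertex s p) (acuteVertex p q s) (infl s),
      .tri (sideVertex q r) (acuteVertex r q s) (infl q),
      .tri (sideVertex s r) (acuteVertex r q s) (infl s),
      .rhomb (infl p) (sideVertex q p) (acuteVertex p q s) (sideVertex s p),
      .rhomb (infl q) (acuteVertex p q s) (infl s) (acuteVertex r q s),
      .rhomb (infl r) (sideVertex q r) (acuteVertex r q s) (sideVertex s r) }

/-- The `n`-fold substitution of a tile (its level-`n` supertile). -/
def Tile.iterSubst : ℕ → Tile → Set Tile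
  | 0, t => {t}
  | n + 1, t => ⋃ t' ∈ iterSubst n t, t'.subst

/-- `T` is an Ammann–Beenker rhomb–triangle tiling: a tiling of the plane in which every finite
set of tiles is part of some level-`n` supertile (of a prototile in any position). -/
structure IsRhombTriangleTiling (T : Set (Set ℂ)) : Prop where
  isTiling : IsTiling T
  legal : ∀ F : Set (Set ℂ), F.Finite → F ⊆ T →
    ∃ (n : ℕ) (t : Tile), t.Valid ∧ F ⊆ Tile.support '' t.iterSubst n

/-! ### The diamond and rhombus supertiles -/

/-- The two supertiles of which the tiling is composed. `diamond a b c` is the union of the level-1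
supertiles of the triangle `abc` and of its mirror image in the line `ac`; it is a square of side
`1 + √2`. `rhombus p q r s` is the level-1 supertile of the rhombus `pqrs`. -/
inductive Supertile
  | diamond (a b c : ℂ)
  | rhombus (p q r s : ℂ)

namespace Supertile

def Valid : Supertile → Prop
  | diamond a b c => (Tile.tri a b c).Valid
  | rhombus p q r s => (Tile.rhomb p q r s).Valid

/-- The tiles of a supertile: 6 triangles and 4 rhombi in a diamond, 4 triangles and 3 rhombi in a
rhombus. -/
def tiles : Supertile → Set Tile
  | diamond a b c => (Tile.tri a b c).subst ∪ (Tile.tri a (a + c - b) c).subst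
  | rhombus p q r s => (Tile.rhomb p q r s).subst

/-- The tiles of a supertile as subsets of the plane. -/
def cluster (s : Supertile) : Set (Set ℂ) := Tile.support '' s.tiles

/-- The four corners of a supertile. -/
def corners : Supertile → Set ℂ
  | diamond a b c => {infl a, infl b, infl c, infl (a + c - b)}
  | rhombus p q r s => {infl p, infl q, infl r, infl s}

/-- The mid-side vertices of a supertile: on each of its four sides, the vertex between the two
corners. -/
def midSides : Supertile → Set ℂ
  | diamond a b c => {sideVertex a b, sideVertex b c,
      sideVertex a (a + c - b), sideVertex (a + c - b) c}
  | rhombus p q r s => {sideVertex q p, sideVertex s p, sideVertex q r, sideVertex s r}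

/-- The internal vertices of a supertile, each with the sum that the edge weights produce there:
`7, 5, 4, 4` in a diamond and `4, 4` in a rhombus. -/
def internalSums : Supertile → Set (ℂ × ℕ)
  | diamond a b c => {(hypVertex a c, 7), (hypVertex c a, 5),
      (apexVertex a b c, 4), (apexVertex a (a + c - b) c, 4)}
  | rhombus p q r s => {(acuteVertex p q s, 4), (acuteVertex r q s, 4)}

end Supertile

/-- `𝒮` groups the tiles of `T` into diamond and rhombus supertiles: every tile of `T` belongs to
exactly one supertile, and the arrows on the edges of length `√2` match, i.e. no edge carries
opposite arrows. -/
structure IsGrouping (T : Set (Set ℂ)) (𝒮 : Set Supertile) : Prop where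
  valid : ∀ s ∈ 𝒮, s.Valid
  covers : ⋃ s ∈ 𝒮, s.cluster = T
  disjoint : 𝒮.PairwiseDisjoint Supertile.cluster
  arrows : ∀ s ∈ 𝒮, ∀ s' ∈ 𝒮, ∀ a b b' c,
    Tile.tri a b c ∈ s.tiles → Tile.tri c b' a ∉ s'.tiles

/-- The corners of the supertiles of a grouping. -/
def cornerSet (𝒮 : Set Supertile) : Set ℂ := ⋃ s ∈ 𝒮, s.corners

/-- The mid-side vertices of the supertiles of a grouping. -/
def midSideSet (𝒮 : Set Supertile) : Set ℂ := ⋃ s ∈ 𝒮, s.midSides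

/-- The internal vertices of the supertiles of a grouping, with their predicted sums. -/
def internalSumSet (𝒮 : Set Supertile) : Set (ℂ × ℕ) := ⋃ s ∈ 𝒮, s.internalSums

end AmmannBeenker

end

/-! The substitution respects oriented edges. Give every edge a direction (a hypotenuse along its
arrow, the legs from `a` to `b` and from `b` to `c`, the sides of a rhombus from the obtuse to the
acute vertices) and a normal pointing into the tile. How an inflated edge is cut, and how its pieces
are directed, depends on the directed edge alone. So two tiles that match along an edge (same
directed edge, opposite normals) have substitutions that match along all its pieces. By induction
every iterated substitution is a `Patch`: its tiles are pairwise separated by lines, and an edge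
without a mate bounds a half-plane containing all tiles (`Patch.subst`).

A grouping exists by compactness. A tile of `T` has finitely many possible parents
(`finite_parents`), so an ultrafilter limit of the patches one level down desubstitutes all of `T`
(`exists_composition`). The limit is closed under reflecting triangles in their hypotenuses; such
pairs of triangles are the diamonds (`Composition.exists_grouping`).

An arbitrary grouping need not arise in this way, but its supertiles still match side to side
(`IsGrouping.complete`). Each side of length `1 + √2` contains the hypotenuse of a triangle. The
mirror image of this triangle is a tile of `T`, and the arrow condition leaves no place for it but
the corresponding side of a neighbouring supertile.

Matching determines the tiles around every vertex. A point dividing an inflated edge sees two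
mirror-image halves: four edges, one of them long, at a mid-side vertex (sum `5`) and at `h'` (sum
`5`), and six edges, one of them long, at `h` (sum `7`). Interior points have four short edges (sum
`4`). At a corner, an angle `j π / 4` of a base tile is cut into `j` angles `π / 4`, so eight edges
leave it (sum at least `8`), none of them towards another corner. Only mid-side vertices and points
`h'` share a sum across classes; no edge joins two vertices of these two classes, nor are two
vertices of sum `4` or two of sum `7` adjacent (`sum_ne`).

All finite geometry is exact. Every valid tile is one of two models with coordinates in `ℤ[√2]` with
respect to `u` and `ω u`, where `ω` is a primitive eighth root of unity with positive real part.
Facts about the models are decided by evaluation and carried to the plane by `ev`. -/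

noncomputable section
namespace AmmannBeenker
open Filter Topology

/-! ### Oriented edges and corners of tiles -/

/-- An oriented edge from `x` to `y`, either of length `√2` (`hyp`) or of length `1`, with a normal
vector `n` of length `√2` pointing to the side of the tile. -/
@[ext] structure OEdge (α : Type) where
  hyp : Bool
  x : α
  y : α
  n : α
deriving DecidableEq

/-- The same edge, seen from the other side. -/
def OEdge.flip {α : Type} [Neg α] (e : OEdge α) : OEdge α := ⟨e.hyp, e.x, e.y, -e.n⟩

/-- The oriented edges of a triangle; `s` is the multiplication by `√2`. -/
def triEdges {α : Type} [AddGroup α] (s : α → α) (a b c : α) : List (OEdge α) :=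
  [⟨true, a, c, (b - a) + (b - c)⟩, ⟨false, a, b, s (c - b)⟩, ⟨false, b, c, s (a - b)⟩]

/-- The oriented edges of a rhombus; `s` is the multiplication by `√2`. -/
def rhombEdges {α : Type} [AddGroup α] (s : α → α) (p q r v : α) : List (OEdge α) :=
  [⟨false, q, p, (v - p) + (v - p) - s (q - p)⟩, ⟨false, v, p, (q - p) + (q - p) - s (v - p)⟩,
    ⟨false, q, r, -((q - p) + (q - p) - s (v - p))⟩,
    ⟨false, v, r, -((v - p) + (v - p) - s (q - p))⟩]

/-- The corners of a triangle, each given by its apex and its two edge vectors, in both orders. -/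
def triCorners {α : Type} [AddGroup α] (a b c : α) : List (α × α × α) :=
  [(a, b - a, c - a), (b, c - b, a - b), (c, a - c, b - c),
    (a, c - a, b - a), (b, a - b, c - b), (c, b - c, a - c)]

/-- The corners of a quadrangle, each given by its apex and its two edge vectors, in both orders. -/
def rhombCorners {α : Type} [AddGroup α] (p q r v : α) : List (α × α × α) :=
  [(p, q - p, v - p), (q, r - q, p - q), (r, v - r, q - r), (v, p - v, r - v),
    (p, v - p, q - p), (q, p - q, r - q), (r, q - r, v - r), (v, r - v, p - v)]

/-- The oriented edges of a tile. -/
def Tile.edges : Tile → List (OEdge ℂ)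
  | .tri a b c => triEdges (fun z => √2 • z) a b c
  | .rhomb p q r s => rhombEdges (fun z => √2 • z) p q r s

/-- The corners of a tile, each given by its apex and its two edge vectors, in both orders. -/
def Tile.corners : Tile → List (ℂ × ℂ × ℂ)
  | .tri a b c => triCorners a b c
  | .rhomb p q r s => rhombCorners p q r s

/-- The vertices of a tile. -/
def Tile.verts : Tile → List ℂ
  | .tri a b c => [a, b, c]
  | .rhomb p q r s => [p, q, r, s]

/-- The vertices of the substituted tile at the corners of the inflated tile. -/
def Tile.cornerPts (t : Tile) : List ℂ := t.verts.map infl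

/-- The vertices of the substituted tile on the inflated sides of length `1 + √2`. -/
def Tile.midPts : Tile → List ℂ
  | .tri a b c => [sideVertex a b, sideVertex b c]
  | .rhomb p q r s => [sideVertex q p, sideVertex s p, sideVertex q r, sideVertex s r]

/-- The vertex of sum `7` of a substituted triangle. -/
def Tile.sevenPts : Tile → List ℂ
  | .tri a _ c => [hypVertex a c]
  | .rhomb _ _ _ _ => []

/-- The vertex of sum `5` on the inflated hypotenuse of a triangle. -/
def Tile.fivePts : Tile → List ℂ
  | .tri a _ c => [hypVertex c a]
  | .rhomb _ _ _ _ => []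

/-- The interior vertices of a substituted tile, which have sum `4`. -/
def Tile.fourPts : Tile → List ℂ
  | .tri a b c => [apexVertex a b c]
  | .rhomb p q r s => [acuteVertex p q s, acuteVertex r q s]

/-! ### Frames: coordinates with respect to a primitive eighth root of unity -/

/-- `ω` is one of the two primitive eighth roots of unity with positive real part. -/
def Eighth (ω : ℂ) : Prop := ω ^ 2 = (√2 : ℝ) * ω - 1

/-- Points with coordinates in `ℤ[√2]` with respect to `1` and `ω`. -/
abbrev Pt := ℤ√2 × ℤ√2

/-- Multiplication by `√2`. -/
def Pt.s2 (z : Pt) : Pt := (⟨0, 1⟩ * z.1, ⟨0, 1⟩ * z.2)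

/-- Multiplication by `1 + √2`. -/
def Pt.lam (z : Pt) : Pt := z + z.s2

/-- Multiplication by `ω` (if `b` is `true`) or by its inverse. -/
def Pt.rot (b : Bool) (z : Pt) : Pt :=
  bif b then (-z.2, z.1 + ⟨0, 1⟩ * z.2) else (⟨0, 1⟩ * z.1 + z.2, -z.1)

/-- Multiplication by `ω ^ k` or its inverse. -/
def Pt.rotN (b : Bool) : ℕ → Pt → Pt
  | 0, z => z
  | k + 1, z => (Pt.rotN b k z).rot b

/-- The determinant of two vectors, up to the determinant of the basis `1`, `ω`. -/
def Pt.cr (z w : Pt) : ℤ√2 := z.1 * w.2 - w.1 * z.2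

/-- The square of the norm. -/
def Pt.nsq (z : Pt) : ℤ√2 := z.1 * z.1 + ⟨0, 1⟩ * z.1 * z.2 + z.2 * z.2

/-- A decidable criterion for nonnegativity in `ℤ[√2]`. -/
def Nn (x : ℤ√2) : Prop :=
  (0 ≤ x.re ∧ 0 ≤ x.im) ∨ (0 ≤ x.re ∧ 2 * x.im * x.im ≤ x.re * x.re) ∨
    (0 ≤ x.im ∧ x.re * x.re ≤ 2 * x.im * x.im)

instance : DecidablePred Nn := fun x => by unfold Nn; infer_instance

/-- Tiles with vertices in a frame. -/
inductive MTile
  | tri (a b c : Pt)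
  | rhomb (p q r s : Pt)
deriving DecidableEq

namespace MTile

def edges : MTile → List (OEdge Pt)
  | .tri a b c => triEdges Pt.s2 a b c
  | .rhomb p q r s => rhombEdges Pt.s2 p q r s

def corners : MTile → List (Pt × Pt × Pt)
  | .tri a b c => triCorners a b c
  | .rhomb p q r s => rhombCorners p q r s

def verts : MTile → List Pt
  | .tri a b c => [a, b, c]
  | .rhomb p q r s => [p, q, r, s]

/-- Metric criterion for the validity of a tile. -/
def Valid : MTile → Prop
  | .tri a b c => (a - b).nsq = 1 ∧ (b - c).nsq = 1 ∧ (a - c).nsq = 2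
  | .rhomb p q r s => (p - q).nsq = 1 ∧ (p - s).nsq = 1 ∧ r = q + s - p ∧ (q - s).nsq = ⟨2, -1⟩

instance : DecidablePred Valid := fun t => by cases t <;> unfold Valid <;> infer_instance

/-- The line through `x` and `y` separates the two tiles. -/
def SepBy (t t' : MTile) (x y : Pt) : Prop :=
  (∀ z ∈ t.verts, Nn ((y - x).cr (z - x))) ∧ ∀ z ∈ t'.verts, Nn ((x - y).cr (z - x))

instance (t t' : MTile) (x y : Pt) : Decidable (SepBy t t' x y) := by
  unfold SepBy; infer_instance

/-- Some line along an edge of one of the two tiles separates them. -/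
def Sep (t t' : MTile) : Prop :=
  ∃ e ∈ t.edges ++ t'.edges, e.x ≠ e.y ∧ (SepBy t t' e.x e.y ∨ SepBy t t' e.y e.x)

instance (t t' : MTile) : Decidable (Sep t t') := by
  unfold Sep; infer_instance

end MTile

/-! ### Coordinate models of the substituted prototiles, and finite checks on them -/

/-- The eight directions. -/
def units : List Pt := (List.range 8).map fun k => Pt.rotN true k (1, 0)

/-- A prototile in a frame and its substitution, in the frame at the inflated base point. -/
structure Model where
  tile : MTile
  subst : List MTile
  cornerPts : List Pt
  midPts : List Pt
  sevenPts : List Pt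
  fivePts : List Pt
  fourPts : List Pt

namespace Model

/-- A pair `(x, y)` stands for `x + y ω` and `⟨m, n⟩` for `m + n √2`, so that `a = 0`, `b = 1`, `c =
√2 ω`. Exchanging `ω` with its inverse produces the mirror image, hence one model serves both
orientations. -/
def triangle : Model where
  tile := .tri (0, 0) (1, 0) (0, ⟨0, 1⟩)
  subst :=
    [.tri (⟨0, 1⟩, 0) (0, 1) (0, 0),
      .tri (0, ⟨1, 1⟩) (1, 1) (0, 1),
      .tri (1, 2) (1, 1) (⟨1, 1⟩, 0),
      .rhomb (0, 1) (⟨0, 1⟩, 0) (⟨1, 1⟩, 0) (1, 1),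
      .rhomb (1, 1) (1, 2) (0, ⟨2, 1⟩) (0, ⟨1, 1⟩)]
  cornerPts := [(0, 0), (⟨1, 1⟩, 0), (0, ⟨2, 1⟩)]
  midPts := [(⟨0, 1⟩, 0), (1, 2)]
  sevenPts := [(0, 1)]
  fivePts := [(0, ⟨1, 1⟩)]
  fourPts := [(1, 1)]

def rhombus : Model where
  tile := .rhomb (0, 0) (1, 0) (1, 1) (0, 1)
  subst :=
    [.tri (1, 0) (1, 1) (⟨1, 1⟩, 0),
      .tri (0, 1) (1, 1) (0, ⟨1, 1⟩),
      .tri (⟨1, 1⟩, ⟨0, 1⟩) (⟨0, 1⟩, ⟨0, 1⟩) (⟨1, 1⟩, 0),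
      .tri (⟨0, 1⟩, ⟨1, 1⟩) (⟨0, 1⟩, ⟨0, 1⟩) (0, ⟨1, 1⟩),
      .rhomb (0, 0) (1, 0) (1, 1) (0, 1),
      .rhomb (⟨1, 1⟩, 0) (1, 1) (0, ⟨1, 1⟩) (⟨0, 1⟩, ⟨0, 1⟩),
      .rhomb (⟨1, 1⟩, ⟨1, 1⟩) (⟨1, 1⟩, ⟨0, 1⟩) (⟨0, 1⟩, ⟨0, 1⟩) (⟨0, 1⟩, ⟨1, 1⟩)]
  cornerPts := [(0, 0), (⟨1, 1⟩, 0), (⟨1, 1⟩, ⟨1, 1⟩), (0, ⟨1, 1⟩)]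
  midPts := [(1, 0), (0, 1), (⟨1, 1⟩, ⟨0, 1⟩), (⟨0, 1⟩, ⟨1, 1⟩)]
  sevenPts := []
  fivePts := []
  fourPts := [(1, 1), (⟨0, 1⟩, ⟨0, 1⟩)]

end Model

def models : List Model := [.triangle, .rhombus]

/-- All tiles of the substituted prototiles are valid. -/
theorem models_valid : ∀ K ∈ models, ∀ t ∈ K.subst, t.Valid := by decide +kernel

/-- Convex polygons with disjoint interiors are separated by a line along a side of one of them, so
only edge lines are tried. A separating line, unlike mere disjointness, is easily carried through
inflation. -/
theorem models_sep : ∀ K ∈ models, ∀ t ∈ K.subst, ∀ t' ∈ K.subst, t ≠ t' → t.Sep t' := by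
  decide +kernel

/-- The unit vector `d` is the direction of the edge `e`, from its endpoint `v`. -/
def OEdge.MRay (e : OEdge Pt) (v d : Pt) : Prop :=
  (v = e.x ∧ (bif e.hyp then d.s2 else d) = e.y - e.x) ∨
    (v = e.y ∧ (bif e.hyp then d.s2 else d) = e.x - e.y)

instance (e : OEdge Pt) (v d : Pt) : Decidable (e.MRay v d) := by
  unfold OEdge.MRay; infer_instance

/-- The edges into which an inflated edge is divided. -/
def OEdge.MPiece (e' e : OEdge Pt) : Prop :=
  e'.n = e.n ∧
  ((e'.hyp = false ∧
    ((e.hyp = true ∧ e.x = e'.x.lam + (e'.y - e'.x).s2 ∧ e.y = e'.x.lam) ∨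
     (e.hyp = false ∧ e.x = e'.x.lam + (e'.y - e'.x).s2 ∧ e.y = e'.y.lam))) ∨
  (e'.hyp = true ∧ ∃ d ∈ units, d.s2 = e'.y - e'.x ∧
    ((e.hyp = false ∧ e.x = e'.x.lam + d ∧ e.y = e'.x.lam) ∨
     (e.hyp = true ∧ e.x = e'.y.lam - d ∧ e.y = e'.x.lam + d) ∨
     (e.hyp = false ∧ e.x = e'.y.lam - d ∧ e.y = e'.y.lam))))

instance (e e' : OEdge Pt) : Decidable (e.MPiece e') := by
  unfold OEdge.MPiece; infer_instance

/-- Edges inside a substituted tile are matched already; those on its rim are pieces of inflated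
edges with the same normal. Together with `models_edge_leg` and `models_edge_hyp` this lets matching
pass from tiles to their substitutions. -/
theorem models_edge_or : ∀ K ∈ models, ∀ t ∈ K.subst, ∀ e ∈ t.edges,
    (∃ t' ∈ K.subst, e.flip ∈ t'.edges) ∨ ∃ e' ∈ K.tile.edges, e'.MPiece e := by
  decide +kernel

/-- The pieces are given by the data of the directed edge alone, so the tiles on its two sides cut
it at the same point and direct the parts alike. -/
theorem models_edge_leg : ∀ K ∈ models, ∀ e ∈ K.tile.edges, e.hyp = false →
    (∃ t ∈ K.subst, ⟨true, e.x.lam + (e.y - e.x).s2, e.x.lam, e.n⟩ ∈ t.edges) ∧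
    (∃ t ∈ K.subst, ⟨false, e.x.lam + (e.y - e.x).s2, e.y.lam, e.n⟩ ∈ t.edges) := by
  decide +kernel

theorem models_edge_hyp : ∀ K ∈ models, ∀ e ∈ K.tile.edges, e.hyp = true →
    ∃ d ∈ units, d.s2 = e.y - e.x ∧
    (∃ t ∈ K.subst, ⟨false, e.x.lam + d, e.x.lam, e.n⟩ ∈ t.edges) ∧
    (∃ t ∈ K.subst, ⟨true, e.y.lam - d, e.x.lam + d, e.n⟩ ∈ t.edges) ∧
    (∃ t ∈ K.subst, ⟨false, e.y.lam - d, e.y.lam, e.n⟩ ∈ t.edges) := by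
  decide +kernel

set_option synthInstance.maxHeartbeats 400000 in
set_option synthInstance.maxSize 4000 in
/-- The tiles at the vertex that divides an inflated edge of length `1 + √2`. -/
theorem models_leg_star : ∀ K ∈ models, ∀ e ∈ K.tile.edges, e.hyp = false →
    e.x.lam + (e.y - e.x).s2 ∈ K.midPts ∧ e.x.lam ∈ K.cornerPts ∧ e.y.lam ∈ K.cornerPts ∧
    ∃ b : Bool, e.n = (Pt.rotN b 2 (e.x - e.y)).s2 ∧
      (e.x.lam + (e.y - e.x).s2) + (e.x - e.y).rot b ∈ K.sevenPts ++ K.fourPts ∧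
      MTile.tri (e.x.lam + (e.y - e.x).s2) ((e.x.lam + (e.y - e.x).s2) + (e.x - e.y).rot b)
        e.x.lam ∈ K.subst ∧
      (∃ t ∈ K.subst, (e.x.lam + (e.y - e.x).s2, (e.x - e.y).s2, (e.x - e.y).rot b) ∈ t.corners) ∧
      (∃ t ∈ K.subst, (e.x.lam + (e.y - e.x).s2, (e.x - e.y).rot b, Pt.rotN b 4 (e.x - e.y))
        ∈ t.corners) := by
  decide +kernel

set_option synthInstance.maxHeartbeats 400000 in
set_option synthInstance.maxSize 4000 in
/-- The tiles at the vertices that divide an inflated edge of length `2 + √2`. -/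
theorem models_hyp_star : ∀ K ∈ models, ∀ e ∈ K.tile.edges, e.hyp = true →
    e.x.lam ∈ K.cornerPts ∧ e.y.lam ∈ K.cornerPts ∧
    ∃ d ∈ units, d.s2 = e.x - e.y ∧ e.x.lam - d ∈ K.sevenPts ∧ e.y.lam + d ∈ K.fivePts ∧
    ∃ b : Bool, e.n = (Pt.rotN b 2 d).s2 ∧
      e.x.lam - d + Pt.rotN b 2 d ∈ K.midPts ∧
      e.x.lam - d + Pt.rotN b 3 d ∈ K.fourPts ∧
      e.y.lam + d + Pt.rotN (!b) 3 (-d) ∈ K.fourPts ∧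
      (∃ t ∈ K.subst, (e.x.lam - d, d, Pt.rotN b 2 d) ∈ t.corners) ∧
      (∃ t ∈ K.subst, (e.x.lam - d, Pt.rotN b 2 d, Pt.rotN b 3 d) ∈ t.corners) ∧
      (∃ t ∈ K.subst, (e.x.lam - d, Pt.rotN b 3 d, (Pt.rotN b 4 d).s2) ∈ t.corners) ∧
      (∃ t ∈ K.subst, (e.y.lam + d, -d, Pt.rotN (!b) 3 (-d)) ∈ t.corners) ∧
      (∃ t ∈ K.subst, (e.y.lam + d, Pt.rotN (!b) 3 (-d), (Pt.rotN (!b) 4 (-d)).s2)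
        ∈ t.corners) := by
  decide +kernel

set_option synthInstance.maxHeartbeats 400000 in
set_option synthInstance.maxSize 4000 in
/-- The tiles at the interior vertices of a substituted tile. -/
theorem models_four_star : ∀ K ∈ models, ∀ v ∈ K.fourPts,
    ∃ l ∈ [(1, 2, 4, 7), (2, 4, 5, 7), (0, 1, 3, 6)],
      (∀ k ∈ [l.1, l.2.1, l.2.2.1, l.2.2.2], v + Pt.rotN true k (1, 0) ∈
        K.cornerPts ++ K.midPts ++ K.sevenPts ++ K.fivePts) ∧
      (∀ k ∈ [(l.1, l.2.1), (l.2.1, l.2.2.1), (l.2.2.1, l.2.2.2), (l.2.2.2, l.1 + 8)],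
        ∃ t ∈ K.subst,
          (v, Pt.rotN true k.1 (1, 0), Pt.rotN true k.2 (1, 0)) ∈ t.corners) := by
  decide +kernel

set_option synthInstance.maxHeartbeats 400000 in
set_option synthInstance.maxSize 4000 in
/-- The tiles at the corners of a substituted tile. -/
theorem models_corner_star : ∀ K ∈ models, ∀ e ∈ K.tile.edges, ∀ v ∈ [e.x, e.y],
    ∃ d ∈ units, e.MRay v d ∧ ∃ b : Bool, e.n = (Pt.rotN b 2 d).s2 ∧
    ∃ j ∈ [1, 2, 3], (∃ e' ∈ K.tile.edges, e'.MRay v (Pt.rotN b j d) ∧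
        e'.n = -(Pt.rotN b (j + 2) d).s2) ∧
      ∀ i ∈ List.range j, ∃ t ∈ K.subst, ∃ c ∈ [id, Pt.s2], ∃ c' ∈ [id, Pt.s2],
        (v.lam, c (Pt.rotN b i d), c' (Pt.rotN b (i + 1) d)) ∈ t.corners ∧
        v.lam + c (Pt.rotN b i d) ∈ K.midPts ++ K.sevenPts ++ K.fivePts ++ K.fourPts ∧
        v.lam + c' (Pt.rotN b (i + 1) d) ∈
          K.midPts ++ K.sevenPts ++ K.fivePts ++ K.fourPts := by
  decide +kernel


/-! ### Cones and corners -/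

/-- The determinant of two plane vectors. -/
def det (v w : ℂ) : ℝ := v.re * w.im - v.im * w.re

/-- The cone spanned by two vectors. -/
def cone (v w : ℂ) : Set ℂ := {z | ∃ x y : ℝ, 0 ≤ x ∧ 0 ≤ y ∧ z = x • v + y • w}

theorem cone_comm (v w : ℂ) : cone v w = cone w v := by
  ext z
  constructor <;> rintro ⟨x, y, hx, hy, rfl⟩ <;> exact ⟨y, x, hy, hx, add_comm _ _⟩

theorem det_comm (v w : ℂ) : det w v = -det v w := by unfold det; ring

/-- The coordinates of a vector with respect to two independent vectors. -/
theorem eq_coords {v w : ℂ} (h : det v w ≠ 0) (z : ℂ) :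
    z = (det z w / det v w) • v + (det v z / det v w) • w := by
  apply Complex.ext <;> simp <;> field_simp <;> unfold det <;> ring

theorem det_combo_right (v w : ℂ) (x y : ℝ) : det (x • v + y • w) w = x * det v w := by
  simp [det]; ring

theorem det_combo_left (v w : ℂ) (x y : ℝ) : det v (x • v + y • w) = y * det v w := by
  simp [det]; ring

theorem continuous_det_left (w : ℂ) : Continuous fun z => det z w := by
  unfold det; fun_prop

theorem continuous_det_right (v : ℂ) : Continuous fun z => det v z := by
  unfold det; fun_prop

theorem combo_inj {v w : ℂ} (h : det v w ≠ 0) {x y x' y' : ℝ}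
    (e : x • v + y • w = x' • v + y' • w) : x = x' ∧ y = y' := by
  have h1 := det_combo_right v w x y
  have h2 := det_combo_left v w x y
  rw [e, det_combo_right] at h1
  rw [e, det_combo_left] at h2
  exact ⟨(mul_right_cancel₀ h h1).symm, (mul_right_cancel₀ h h2).symm⟩

theorem cone_iff {v w : ℂ} (h : det v w ≠ 0) (z : ℂ) :
    z ∈ cone v w ↔ 0 ≤ det z w / det v w ∧ 0 ≤ det v z / det v w := by
  constructor
  · rintro ⟨x, y, hx, hy, rfl⟩
    rw [det_combo_left, det_combo_right]
    simpa [h] using ⟨hx, hy⟩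
  · rintro ⟨h1, h2⟩
    exact ⟨_, _, h1, h2, eq_coords h z⟩

theorem convex_cone (p v w : ℂ) : Convex ℝ {z | z - p ∈ cone v w} := by
  rintro z ⟨x, y, hx, hy, hz⟩ z' ⟨x', y', hx', hy', hz'⟩ a b ha hb hab
  refine ⟨a * x + b * x', a * y + b * y', by positivity, by positivity, ?_⟩
  have : a • z + b • z' - p = a • (z - p) + b • (z' - p) := by
    have : p = (a + b) • p := by rw [hab, one_smul]
    nth_rw 1 [this]
    module
  rw [this, hz, hz']
  module

theorem cone_subset {v w v' w' : ℂ} (hv : v' ∈ cone v w) (hw : w' ∈ cone v w) :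
    cone v' w' ⊆ cone v w := by
  obtain ⟨a, b, ha, hb, rfl⟩ := hv
  obtain ⟨c, d, hc, hd, rfl⟩ := hw
  rintro z ⟨x, y, hx, hy, rfl⟩
  exact ⟨x * a + y * c, x * b + y * d, by positivity, by positivity, by module⟩

theorem hull_sub_cone {A : Set ℂ} {p v w : ℂ} (h : ∀ a ∈ A, a - p ∈ cone v w) :
    ∀ z ∈ convexHull ℝ A, z - p ∈ cone v w :=
  convexHull_min (s := A) (t := {z | z - p ∈ cone v w}) h (convex_cone p v w)

/-- The apex of a pointed cone is an extreme point. -/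
theorem extreme_of_cone {S : Set ℂ} {p v w : ℂ} (hp : p ∈ S) (h : ∀ z ∈ S, z - p ∈ cone v w)
    (hd : det v w ≠ 0) : p ∈ S.extremePoints ℝ := by
  refine mem_extremePoints.2 ⟨hp, ?_⟩
  rintro z hz z' hz' ⟨a, b, ha, hb, hab, e⟩
  obtain ⟨x, y, hx, hy, hzx⟩ := h z hz
  obtain ⟨x', y', hx', hy', hzx'⟩ := h z' hz'
  have e0 : a • (z - p) + b • (z' - p) = (0 : ℝ) • v + (0 : ℝ) • w := by
    have : a • (z - p) + b • (z' - p) = a • z + b • z' - (a + b) • p := by module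
    rw [this, hab, e]
    module
  rw [hzx, hzx'] at e0
  have e1 : (a * x + b * x') • v + (a * y + b * y') • w = (0 : ℝ) • v + (0 : ℝ) • w := by
    rw [← e0]; module
  obtain ⟨h1, h2⟩ := combo_inj hd e1
  have hx0 : x = 0 := by nlinarith [mul_nonneg ha.le hx, mul_nonneg hb.le hx']
  have hx0' : x' = 0 := by nlinarith [mul_nonneg ha.le hx, mul_nonneg hb.le hx']
  have hy0 : y = 0 := by nlinarith [mul_nonneg ha.le hy, mul_nonneg hb.le hy']
  have hy0' : y' = 0 := by nlinarith [mul_nonneg ha.le hy, mul_nonneg hb.le hy']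
  subst hx0 hx0' hy0 hy0'
  constructor
  · simpa [sub_eq_zero] using hzx
  · simpa [sub_eq_zero] using hzx'

/-- `S` is a convex set with a corner at `p`, whose adjacent vertices are `p + v` and `p + w`. -/
structure IsCorner (S : Set ℂ) (p v w : ℂ) : Prop where
  convex : Convex ℝ S
  mem : p ∈ S
  left : p + v ∈ S.extremePoints ℝ
  right : p + w ∈ S.extremePoints ℝ
  sub : ∀ z ∈ S, z - p ∈ cone v w
  det_ne : det v w ≠ 0

namespace IsCorner

variable {S : Set ℂ} {p v w : ℂ}

theorem symm (h : IsCorner S p v w) : IsCorner S p w v :=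
  ⟨h.convex, h.mem, h.right, h.left, fun z hz => cone_comm v w ▸ h.sub z hz,
    by rw [det_comm]; exact neg_ne_zero.2 h.det_ne⟩

theorem extreme (h : IsCorner S p v w) : p ∈ S.extremePoints ℝ :=
  extreme_of_cone h.mem h.sub h.det_ne

theorem left_ne (h : IsCorner S p v w) : v ≠ 0 := by
  rintro rfl
  exact h.det_ne (by simp [det])

theorem combo_mem (h : IsCorner S p v w) {x y : ℝ} (hx : 0 ≤ x) (hy : 0 ≤ y) (hxy : x + y ≤ 1) :
    p + (x • v + y • w) ∈ S := by
  have h1 := h.convex.sum_mem (t := Finset.univ) (w := ![1 - x - y, x, y])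
    (z := ![p, p + v, p + w]) (by intro i _; fin_cases i <;> simp <;> linarith)
    (by simp [Fin.sum_univ_three]; ring) (by
      intro i _
      fin_cases i
      exacts [h.mem, h.left.1, h.right.1])
  have e : p + (x • v + y • w) = (1 - x - y) • p + x • (p + v) + y • (p + w) := by module
  rw [e]
  simpa only [Fin.sum_univ_three, Matrix.cons_val] using h1

theorem eventually_small (_h : IsCorner S p v w) :
    ∀ᶠ z in 𝓝 p, det (z - p) w / det v w + det v (z - p) / det v w < 1 := by
  have hc : Continuous fun z => det (z - p) w / det v w + det v (z - p) / det v w := by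
    have h1 := (continuous_det_left w).comp (continuous_id.sub (continuous_const (y := p)))
    have h2 := (continuous_det_right v).comp (continuous_id.sub (continuous_const (y := p)))
    exact (h1.div_const _).add (h2.div_const _)
  have := hc.tendsto p
  refine this.eventually_lt_const ?_
  simp [det]

/-- Near its apex, a corner fills its cone. -/
theorem eventually_mem (h : IsCorner S p v w) : ∀ᶠ z in 𝓝 p, z - p ∈ cone v w → z ∈ S := by
  filter_upwards [h.eventually_small] with z hz hc
  rw [cone_iff h.det_ne] at hc
  have := h.combo_mem hc.1 hc.2 hz.le
  rwa [← eq_coords h.det_ne, add_sub_cancel] at this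

/-- Near its apex, a corner contains the interior of its cone in its interior. -/
theorem eventually_interior (h : IsCorner S p v w) : ∀ᶠ z in 𝓝 p,
    0 < det (z - p) w / det v w → 0 < det v (z - p) / det v w → z ∈ interior S := by
  filter_upwards [h.eventually_small] with z hz h1 h2
  have c1 : Continuous fun z => det (z - p) w / det v w :=
    ((continuous_det_left w).comp (continuous_id.sub (continuous_const (y := p)))).div_const _
  have c2 : Continuous fun z => det v (z - p) / det v w :=
    ((continuous_det_right v).comp (continuous_id.sub (continuous_const (y := p)))).div_const _
  refine mem_interior.2 ⟨{z | 0 < det (z - p) w / det v w} ∩ {z | 0 < det v (z - p) / det v w} ∩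
    {z | det (z - p) w / det v w + det v (z - p) / det v w < 1}, ?_, ?_, ⟨h1, h2⟩, hz⟩
  · rintro z' ⟨⟨h1', h2'⟩, h3'⟩
    have := h.combo_mem (le_of_lt h1') (le_of_lt h2') (le_of_lt h3')
    rwa [← eq_coords h.det_ne, add_sub_cancel] at this
  · exact ((isOpen_lt continuous_const c1).inter (isOpen_lt continuous_const c2)).inter
      (isOpen_lt (c1.add c2) continuous_const)

theorem interior_nonempty (h : IsCorner S p v w) : (interior S).Nonempty := by
  have ht : Tendsto (fun t : ℝ => p + t • (v + w)) (𝓝[>] 0) (𝓝 p) := by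
    have : Continuous fun t : ℝ => p + t • (v + w) := by fun_prop
    have := this.tendsto 0
    simp only [zero_smul, add_zero] at this
    exact this.mono_left nhdsWithin_le_nhds
  obtain ⟨t, h1, h2⟩ := ((ht.eventually h.eventually_interior).and self_mem_nhdsWithin).exists
  have h2 : 0 < t := h2
  refine ⟨_, h1 ?_ ?_⟩
  · have : p + t • (v + w) - p = t • v + t • w := by module
    rw [this, det_combo_right, mul_div_cancel_right₀ _ h.det_ne]
    exact h2
  · have : p + t • (v + w) - p = t • v + t • w := by module
    rw [this, det_combo_left, mul_div_cancel_right₀ _ h.det_ne]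
    exact h2

end IsCorner

/-- A set on one side of a line has its interior strictly on that side. -/
theorem det_pos_of_mem_interior {S : Set ℂ} {a d : ℂ} (hd : d ≠ 0) (h : ∀ z ∈ S, 0 ≤ det d (z - a))
    {z : ℂ} (hz : z ∈ interior S) : 0 < det d (z - a) := by
  have hn : 0 < d.re * d.re + d.im * d.im := by
    have := Complex.normSq_pos.2 hd
    rwa [Complex.normSq_apply] at this
  -- `I * d` is a normal on the positive side of the line. Moving against it lowers the determinant
  -- by `t ‖d‖ ^ 2`, and for small `t` the point is still in `S`.
  have hc : Continuous fun t : ℝ => z - t • (Complex.I * d) := by fun_prop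
  have ht : Tendsto (fun t : ℝ => z - t • (Complex.I * d)) (𝓝[>] 0) (𝓝 z) := by
    have := hc.tendsto 0
    simp only [zero_smul, sub_zero] at this
    exact this.mono_left nhdsWithin_le_nhds
  obtain ⟨t, h1, h2⟩ :=
    ((ht.eventually (isOpen_interior.mem_nhds hz)).and self_mem_nhdsWithin).exists
  have h2 : 0 < t := h2
  have := h _ (interior_subset h1)
  simp [det] at this ⊢
  nlinarith [mul_pos h2 hn]

/-- The edges at a corner belong to the frontier. -/
theorem IsCorner.segment_subset_frontier {S : Set ℂ} {p v w : ℂ} (h : IsCorner S p v w) :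
    segment ℝ p (p + v) ⊆ frontier S := by
  intro z hz
  refine ⟨subset_closure (h.convex.segment_subset h.mem h.left.1 hz), fun hi => ?_⟩
  obtain ⟨t, ht, rfl⟩ := (segment_eq_image' ℝ p (p + v) ▸ hz)
  have key : ∀ z ∈ S, 0 ≤ det v (z - p) / det v w := fun z hz =>
    ((cone_iff h.det_ne _).1 (h.sub z hz)).2
  -- The edge lies on the line where the determinant vanishes, whereas an interior point would
  -- satisfy a strict inequality. The sign of `det v w` decides whether `v` or `-v` directs the
  -- line.
  have e : det v (p + t • (p + v - p) - p) = 0 := by simp [det]; ring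
  rcases lt_or_gt_of_ne h.det_ne with hd | hd
  · have := det_pos_of_mem_interior (a := p) (d := -v) (neg_ne_zero.2 h.left_ne) (fun z hz => by
      have h1 := key z hz
      have h2 : det (-v) (z - p) = -det v (z - p) := by simp [det]; ring
      rw [h2]
      by_contra hlt
      exact absurd h1 (not_le.2 (div_neg_of_pos_of_neg (by linarith) hd))) hi
    have h2 : ∀ z, det (-v) z = -det v z := fun z => by simp [det]; ring
    rw [h2, e] at this
    simp at this
  · have := det_pos_of_mem_interior (a := p) (d := v) h.left_ne (fun z hz => by
      have h1 := key z hz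
      by_contra hlt
      exact absurd h1 (not_le.2 (div_neg_of_neg_of_pos (by linarith) hd))) hi
    rw [e] at this
    exact lt_irrefl _ this

/-! ### Vertex stars -/

/-- Some tile has a corner at `p` with edge vectors `v` and `w`. -/
def Wedge (T : Set (Set ℂ)) (p v w : ℂ) : Prop := ∃ S ∈ T, IsCorner S p v w

theorem Wedge.symm {T : Set (Set ℂ)} {p v w : ℂ} (h : Wedge T p v w) : Wedge T p w v :=
  let ⟨S, hS, hc⟩ := h; ⟨S, hS, hc.symm⟩

/-- Corners of tiles at `p` whose cones cover the plane. -/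
structure Star (T : Set (Set ℂ)) (p : ℂ) (S : ℕ → Set ℂ) (v w : ℕ → ℂ) : Prop where
  mem : ∀ k < 8, S k ∈ T
  corner : ∀ k < 8, IsCorner (S k) p (v k) (w k)
  cover : ∀ z, ∃ k < 8, z ∈ cone (v k) (w k)

/-- The star leaves no room near `p`: a tile is the closure of its interior, so a tile that comes
close to `p` has interior points there. These lie in a cone of the star, hence in one of its tiles,
and the two interiors meet. -/
theorem Star.exists_nhds {T : Set (Set ℂ)} (hT : IsTiling T) {p : ℂ} {S : ℕ → Set ℂ}
    {v w : ℕ → ℂ} (h : Star T p S v w) :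
    ∃ U ∈ 𝓝 p, ∀ S' ∈ T, (S' ∩ U).Nonempty → ∃ k < 8, S' = S k := by
  have h1 : ∀ᶠ z in 𝓝 p, ∀ k ∈ Finset.range 8, z - p ∈ cone (v k) (w k) → z ∈ S k :=
    (eventually_all_finset _).2 fun k hk => (h.corner k (Finset.mem_range.1 hk)).eventually_mem
  obtain ⟨U, hU, hUo, hpU⟩ := mem_nhds_iff.1 h1
  refine ⟨U, hUo.mem_nhds hpU, fun S' hS' ⟨z, hz, hzU⟩ => ?_⟩
  rw [← hT.regular S' hS'] at hz
  obtain ⟨z1, hz1U, hz1⟩ := mem_closure_iff.1 hz U hUo hzU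
  obtain ⟨k, hk, hzk⟩ := h.cover (z1 - p)
  have hz1S := hU hz1U k (Finset.mem_range.2 hk) hzk
  rw [← hT.regular (S k) (h.mem k hk)] at hz1S
  obtain ⟨z2, hz2, hz2'⟩ := mem_closure_iff.1 hz1S _ isOpen_interior hz1
  refine ⟨k, hk, ?_⟩
  by_contra hne
  have := hT.disjoint S' hS' (S k) (h.mem k hk) hne
  exact (this ▸ (⟨hz2, hz2'⟩ : z2 ∈ interior S' ∩ interior (S k)) : z2 ∈ (∅ : Set ℂ))

theorem Star.eq_of_mem {T : Set (Set ℂ)} (hT : IsTiling T) {p : ℂ} {S : ℕ → Set ℂ}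
    {v w : ℕ → ℂ} (h : Star T p S v w) {S' : Set ℂ} (hS' : S' ∈ T) (hp : p ∈ S') :
    ∃ k < 8, S' = S k := by
  obtain ⟨U, hU, h1⟩ := h.exists_nhds hT
  exact h1 S' hS' ⟨p, hp, mem_of_mem_nhds hU⟩

/-- Every vertex of the tiling has a star. -/
def AllStars (T : Set (Set ℂ)) : Prop :=
  ∀ p ∈ tilingVertices T, ∃ S v w, Star T p S v w

theorem mem_tilingVertices {T : Set (Set ℂ)} {p : ℂ} :
    p ∈ tilingVertices T ↔ ∃ S ∈ T, p ∈ S.extremePoints ℝ := by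
  simp [tilingVertices]

/-- The tiling is edge-to-edge: a vertex never lies in the middle of a side of a tile, since every
tile containing it is one of the corners of its star. -/
theorem AllStars.extreme {T : Set (Set ℂ)} (hT : IsTiling T) (hs : AllStars T) {p : ℂ}
    (hp : p ∈ tilingVertices T) {S : Set ℂ} (hS : S ∈ T) (hpS : p ∈ S) :
    p ∈ S.extremePoints ℝ := by
  obtain ⟨S', v, w, h⟩ := hs p hp
  obtain ⟨k, hk, rfl⟩ := h.eq_of_mem hT hS hpS
  exact (h.corner k hk).extreme

theorem Wedge.mem_vertices {T : Set (Set ℂ)} {p v w : ℂ} (h : Wedge T p v w) :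
    p ∈ tilingVertices T :=
  let ⟨S, hS, hc⟩ := h; mem_tilingVertices.2 ⟨S, hS, hc.extreme⟩

theorem Wedge.left_mem_vertices {T : Set (Set ℂ)} {p v w : ℂ} (h : Wedge T p v w) :
    p + v ∈ tilingVertices T :=
  let ⟨S, hS, hc⟩ := h; mem_tilingVertices.2 ⟨S, hS, hc.left⟩

/-- The edges of the tiles are edges of the graph. -/
theorem Wedge.adj {T : Set (Set ℂ)} (hT : IsTiling T) (hs : AllStars T) {p v w : ℂ}
    (h : Wedge T p v w) :
    (tilingGraph T).Adj ⟨p, h.mem_vertices⟩ ⟨p + v, h.left_mem_vertices⟩ := by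
  obtain ⟨S, hS, hc⟩ := h
  refine ⟨fun e => hc.left_ne ?_, ?_, ?_⟩
  · simpa using congrArg Subtype.val e
  · exact hc.segment_subset_frontier.trans (Set.subset_biUnion_of_mem (u := fun S => frontier S) hS)
  · refine Set.eq_empty_of_forall_notMem fun z ⟨hz, hzv⟩ => ?_
    have hzS := hc.convex.openSegment_subset hc.mem hc.left.1 hz
    have := (mem_extremePoints.1 (hs.extreme hT hzv hS hzS)).2 p hc.mem _ hc.left.1 hz
    apply hc.left_ne
    simpa using this.2.trans this.1.symm

theorem mem_openSegment_of_lt {p q : ℂ} {r : ℝ} (h0 : 0 < r) (h1 : r < 1) :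
    p + r • (q - p) ∈ openSegment ℝ p q :=
  ⟨1 - r, r, by linarith, h0, by ring, by module⟩

/-- Two neighbours of a vertex in the same direction are equal. -/
theorem adj_unique {T : Set (Set ℂ)} {p q q' : tilingVertices T} (h : (tilingGraph T).Adj p q)
    (h' : (tilingGraph T).Adj p q') {r : ℝ} (hr : 0 < r)
    (e : (q' : ℂ) - p = r • ((q : ℂ) - p)) : q' = q := by
  rcases lt_trichotomy r 1 with h1 | h1 | h1
  · exfalso
    have : (q' : ℂ) ∈ openSegment ℝ (p : ℂ) q := by
      have := mem_openSegment_of_lt (p := (p : ℂ)) (q := q) hr h1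
      rwa [← e, add_sub_cancel] at this
    exact (h.2.2 ▸ (⟨this, q'.2⟩ : (q' : ℂ) ∈ openSegment ℝ (p : ℂ) q ∩ tilingVertices T) :
      (q' : ℂ) ∈ (∅ : Set ℂ))
  · subst h1
    ext
    simpa using e
  · exfalso
    have e' : (q : ℂ) - p = r⁻¹ • ((q' : ℂ) - p) := by
      rw [e, smul_smul, inv_mul_cancel₀ hr.ne', one_smul]
    have : (q : ℂ) ∈ openSegment ℝ (p : ℂ) q' := by
      have := mem_openSegment_of_lt (p := (p : ℂ)) (q := q') (inv_pos.2 hr) (inv_lt_one_of_one_lt₀ h1)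
      rwa [← e', add_sub_cancel] at this
    exact (h'.2.2 ▸ (⟨this, q.2⟩ : (q : ℂ) ∈ openSegment ℝ (p : ℂ) q' ∩ tilingVertices T) :
      (q : ℂ) ∈ (∅ : Set ℂ))

/-- All neighbours of a vertex are the endpoints of the edges in its star. -/
theorem Star.neighbor {T : Set (Set ℂ)} (hT : IsTiling T) (hs : AllStars T) {p q : tilingVertices T}
    {S : ℕ → Set ℂ} {v w : ℕ → ℂ} (h : Star T p S v w) (hq : (tilingGraph T).Adj p q) :
    ∃ k < 8, (q : ℂ) = p + v k ∨ (q : ℂ) = p + w k := by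
  obtain ⟨U, hU, hUS⟩ := h.exists_nhds hT
  have h1 : ∀ᶠ z in 𝓝 (p : ℂ), ∀ k ∈ Finset.range 8,
      0 < det (z - p) (w k) / det (v k) (w k) → 0 < det (v k) (z - p) / det (v k) (w k) →
        z ∈ interior (S k) :=
    (eventually_all_finset _).2 fun k hk => (h.corner k (Finset.mem_range.1 hk)).eventually_interior
  have ht : Tendsto (fun t : ℝ => (p : ℂ) + t • ((q : ℂ) - p)) (𝓝[>] 0) (𝓝 (p : ℂ)) := by
    have : Continuous fun t : ℝ => (p : ℂ) + t • ((q : ℂ) - p) := by fun_prop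
    have := this.tendsto 0
    simp only [zero_smul, add_zero] at this
    exact this.mono_left nhdsWithin_le_nhds
  obtain ⟨t, ⟨⟨ht1, htU⟩, ht0⟩, htlt⟩ := (((ht.eventually h1).and (ht.eventually hU)).and
    self_mem_nhdsWithin |>.and (mem_nhdsWithin_of_mem_nhds (Iio_mem_nhds one_pos))).exists
  have ht0 : 0 < t := ht0
  have htlt : t < 1 := htlt
  -- A point of the edge close to `p` is on the frontier of some tile, which belongs to the star. It
  -- lies in the cone of that tile but not in the interior, so one of its two coordinates vanishes.
  have hfr := hq.2.1 (openSegment_subset_segment ℝ _ _ (mem_openSegment_of_lt ht0 htlt))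
  simp only [Set.mem_iUnion] at hfr
  obtain ⟨S', hS', hfr⟩ := hfr
  have hmem : (p : ℂ) + t • ((q : ℂ) - p) ∈ S' := (hT.isClosed S' hS').frontier_subset hfr
  obtain ⟨k, hk, rfl⟩ := hUS S' hS' ⟨_, hmem, htU⟩
  refine ⟨k, hk, ?_⟩
  have hc := h.corner k hk
  have hcone := (cone_iff hc.det_ne _).1 (hc.sub _ hmem)
  have hnot : ¬ (0 < det ((p : ℂ) + t • ((q : ℂ) - p) - p) (w k) / det (v k) (w k) ∧
      0 < det (v k) ((p : ℂ) + t • ((q : ℂ) - p) - p) / det (v k) (w k)) := fun hh =>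
    hfr.2 (ht1 k (Finset.mem_range.2 hk) hh.1 hh.2)
  have hcoord := eq_coords hc.det_ne ((p : ℂ) + t • ((q : ℂ) - p) - p)
  have hW : Wedge T p (v k) (w k) := ⟨_, hS', hc⟩
  set X := det ((p : ℂ) + t • ((q : ℂ) - p) - p) (w k) / det (v k) (w k)
  set Y := det (v k) ((p : ℂ) + t • ((q : ℂ) - p) - p) / det (v k) (w k)
  rw [add_sub_cancel_left] at hcoord
  have hqp : (q : ℂ) - p ≠ 0 := sub_ne_zero.2 fun e => hq.1 (Subtype.ext e.symm)
  -- The side of the tile in this direction is itself an edge of the graph, and `adj_unique`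
  -- identifies the two endpoints.
  have main : ∀ (x : ℝ) (v' w' : ℂ), 0 ≤ x → Wedge T p v' w' → t • ((q : ℂ) - p) = x • v' →
      (q : ℂ) = p + v' := by
    intro x v' w' hx hW' e
    have hx0 : x ≠ 0 := by
      rintro rfl
      rw [zero_smul, smul_eq_zero] at e
      exact e.elim ht0.ne' hqp
    have hxp : 0 < x := lt_of_le_of_ne hx hx0.symm
    have e' : (q : ℂ) - p = (x / t) • (p + v' - p) := by
      rw [add_sub_cancel_left, div_eq_inv_mul, mul_smul, ← e, smul_smul,
        inv_mul_cancel₀ ht0.ne', one_smul]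
    have := adj_unique (hW'.adj hT hs) hq (div_pos hxp ht0) e'
    exact congrArg Subtype.val this
  rcases hcone.1.eq_or_lt with hX | hX
  · right
    refine main Y _ _ hcone.2 hW.symm ?_
    rw [hcoord, ← hX, zero_smul, zero_add]
  · left
    have hY : Y = 0 := le_antisymm (not_lt.1 fun hY => hnot ⟨hX, hY⟩) hcone.2
    refine main X _ _ hcone.1 hW ?_
    rw [hcoord, hY, zero_smul, add_zero]

/-! ### Eight directions -/

theorem sqrt_two_sq : (((√2 : ℝ) : ℂ)) ^ 2 = 2 := by
  rw [← Complex.ofReal_pow, Real.sq_sqrt (by norm_num)]; norm_num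

theorem Eighth.re_im {ω : ℂ} (h : Eighth ω) : ω.re = √2 / 2 ∧ ω.im ^ 2 = 1 / 2 := by
  have hs : √2 * √2 = 2 := Real.mul_self_sqrt (by norm_num)
  have h1 := congrArg Complex.re h
  have h2 := congrArg Complex.im h
  simp [pow_two] at h1 h2
  -- A real `ω` would be a root of `x ^ 2 - √2 x + 1`, whose discriminant is negative.
  have him : ω.im ≠ 0 := by
    intro h0
    rw [h0] at h1
    nlinarith [sq_nonneg (ω.re - √2 / 2)]
  have hre : ω.re = √2 / 2 := by
    have : ω.im * (2 * ω.re - √2) = 0 := by linarith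
    rcases mul_eq_zero.1 this with h3 | h3
    · exact absurd h3 him
    · linarith
  exact ⟨hre, by rw [hre] at h1; nlinarith⟩

theorem Eighth.norm {ω : ℂ} (h : Eighth ω) : ‖ω‖ = 1 := by
  have hs : √2 * √2 = 2 := Real.mul_self_sqrt (by norm_num)
  obtain ⟨h1, h2⟩ := h.re_im
  have : ‖ω‖ ^ 2 = 1 := by
    rw [← Complex.normSq_eq_norm_sq, Complex.normSq_apply, h1]
    nlinarith
  nlinarith [norm_nonneg ω]

theorem Eighth.ne_zero {ω : ℂ} (h : Eighth ω) : ω ≠ 0 := by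
  rintro rfl
  simpa using h.norm

theorem Eighth.pow_three {ω : ℂ} (h : Eighth ω) : ω ^ 3 = ω - (√2 : ℝ) := by
  have h : ω ^ 2 = (√2 : ℝ) * ω - 1 := h
  linear_combination (ω + (√2 : ℝ)) * h + ω * sqrt_two_sq

theorem Eighth.pow_four {ω : ℂ} (h : Eighth ω) : ω ^ 4 = -1 := by
  have h' : ω ^ 2 = (√2 : ℝ) * ω - 1 := h
  linear_combination ω * h.pow_three + h'

theorem Eighth.pow_eight {ω : ℂ} (h : Eighth ω) : ω ^ 8 = 1 := by
  linear_combination (ω ^ 4 - 1) * h.pow_four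

theorem Eighth.primitive {ω : ℂ} (h : Eighth ω) : IsPrimitiveRoot ω 8 := by
  have := orderOf_eq_prime_pow (x := ω) (p := 2) (n := 2)
    (by norm_num [h.pow_four]) (by norm_num [h.pow_eight])
  exact (by norm_num at this; exact this : orderOf ω = 8) ▸ IsPrimitiveRoot.orderOf ω

/-- The inverse of a primitive eighth root of unity. -/
theorem Eighth.conj {ω : ℂ} (h : Eighth ω) : Eighth ((√2 : ℝ) - ω) := by
  have h' : ω ^ 2 = (√2 : ℝ) * ω - 1 := h
  unfold Eighth
  linear_combination h' 

theorem Eighth.pow_mod {ω : ℂ} (h : Eighth ω) (k : ℕ) : ω ^ (k % 8) = ω ^ k := by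
  nth_rw 2 [← Nat.div_add_mod k 8]
  rw [pow_add, pow_mul, h.pow_eight, one_pow, one_mul]

theorem cone_mul {v w z : ℂ} (a : ℂ) (h : z ∈ cone v w) : a * z ∈ cone (a * v) (a * w) := by
  obtain ⟨x, y, hx, hy, rfl⟩ := h
  exact ⟨x, y, hx, hy, by simp only [Complex.real_smul]; ring⟩

theorem left_mem_cone (v w : ℂ) {c : ℝ} (hc : 0 ≤ c) : c • v ∈ cone v w :=
  ⟨c, 0, hc, le_rfl, by simp⟩

theorem right_mem_cone (v w : ℂ) {c : ℝ} (hc : 0 ≤ c) : c • w ∈ cone v w :=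
  ⟨0, c, le_rfl, hc, by simp⟩

/-- The bound `m ≤ 3` keeps the angle below `π`. The nontrivial cases are `√2 ω = 1 + ω ^ 2`, `ω =
√2 + ω ^ 3` and `ω ^ 2 = 1 + √2 ω ^ 3`. -/
theorem Eighth.pow_mem_cone {ω : ℂ} (h : Eighth ω) {m l : ℕ} (hm : m ≤ 3) (hl : l ≤ m)
    (h0 : 0 < m) : ω ^ l ∈ cone 1 (ω ^ m) := by
  have h2 : ω ^ 2 = (√2 : ℝ) * ω - 1 := h
  have h3 := h.pow_three
  have hs := sqrt_two_sq
  rcases hl.eq_or_lt with rfl | hl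
  · simpa using right_mem_cone 1 (ω ^ l) zero_le_one
  rcases Nat.eq_zero_or_pos l with rfl | hl0
  · simpa using left_mem_cone 1 (ω ^ m) zero_le_one
  obtain ⟨rfl, rfl⟩ | ⟨rfl, rfl⟩ | ⟨rfl, rfl⟩ :
    (m = 2 ∧ l = 1) ∨ (m = 3 ∧ l = 1) ∨ (m = 3 ∧ l = 2) := by omega
  · refine ⟨√2 / 2, √2 / 2, by positivity, by positivity, ?_⟩
    simp only [Complex.real_smul]
    push_cast
    linear_combination -(√2 : ℝ) / 2 * h2 - ω / 2 * hs
  · refine ⟨√2, 1, by positivity, by positivity, ?_⟩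
    simp only [Complex.real_smul]
    push_cast
    linear_combination - h3
  · refine ⟨1, √2, by positivity, by positivity, ?_⟩
    simp only [Complex.real_smul]
    push_cast
    linear_combination h2 - (√2 : ℝ) * h3 + hs

theorem Eighth.dir_mem_cone {ω : ℂ} (h : Eighth ω) (u : ℂ) {i j k : ℕ} (hik : i ≤ k) (hkj : k ≤ j)
    (hij : i < j) (hj : j ≤ i + 3) {c c' : ℝ} (hc : 0 < c) (hc' : 0 < c') :
    ω ^ k * u ∈ cone (c • (ω ^ i * u)) (c' • (ω ^ j * u)) := by
  have h1 := cone_mul (ω ^ i * u)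
    (h.pow_mem_cone (m := j - i) (l := k - i) (by omega) (by omega) (by omega))
  have e : ∀ n, i ≤ n → ω ^ i * u * ω ^ (n - i) = ω ^ n * u := fun n hn => by
    rw [mul_right_comm, ← pow_add, Nat.add_sub_cancel' hn]
  rw [mul_one, e _ hik, e _ (by omega)] at h1
  refine cone_subset ?_ ?_ h1
  · have := left_mem_cone (c • (ω ^ i * u)) (c' • (ω ^ j * u)) (inv_nonneg.2 hc.le)
    rwa [smul_smul, inv_mul_cancel₀ hc.ne', one_smul] at this
  · have := right_mem_cone (c • (ω ^ i * u)) (c' • (ω ^ j * u)) (inv_nonneg.2 hc'.le)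
    rwa [smul_smul, inv_mul_cancel₀ hc'.ne', one_smul] at this

/-- The eight sectors cover the plane. -/
theorem Eighth.exists_sector {ω : ℂ} (h : Eighth ω) {u : ℂ} (hu : u ≠ 0) (z : ℂ) :
    ∃ k < 8, z ∈ cone (ω ^ k * u) (ω ^ (k + 1) * u) := by
  have h2 : ω ^ 2 = (√2 : ℝ) * ω - 1 := h
  have h3 := h.pow_three
  have h4 := h.pow_four
  have hs := sqrt_two_sq
  -- The coordinates of `X + Y ω` in the successive sectors are `(X, Y)`, `(Y + √2 X, -X)`, `(√2 Y +
  -- X, -Y - √2 X)` and `(Y, -X - √2 Y)`; their signs select the sector. The half with `Y ≤ 0`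
  -- follows because `ω ^ 4 = -1`.
  have upper : ∀ (X Y : ℝ), 0 ≤ Y → ∃ k < 4, (X + Y * ω : ℂ) ∈ cone (ω ^ k) (ω ^ (k + 1)) := by
    intro X Y hY
    by_cases hX : 0 ≤ X
    · exact ⟨0, by norm_num, X, Y, hX, hY, by simp⟩
    by_cases h1 : 0 ≤ Y + √2 * X
    · refine ⟨1, by norm_num, Y + √2 * X, -X, h1, by linarith, ?_⟩
      simp only [Complex.real_smul]
      push_cast
      linear_combination (X : ℂ) * h2
    by_cases h1' : 0 ≤ √2 * Y + X
    · refine ⟨2, by norm_num, √2 * Y + X, -Y - √2 * X, h1', by linarith, ?_⟩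
      simp only [Complex.real_smul]
      push_cast
      linear_combination -((√2 : ℝ) * Y + X : ℂ) * h2 + (Y + (√2 : ℝ) * X : ℂ) * h3 +
        (- ω * Y - X) * hs
    · refine ⟨3, by norm_num, Y, -X - √2 * Y, hY, by linarith, ?_⟩
      simp only [Complex.real_smul]
      push_cast
      linear_combination - (Y : ℂ) * h3 + ((√2 : ℝ) * Y + X : ℂ) * h4
  have him : ω.im ≠ 0 := by
    intro h0
    have := h.re_im.2
    rw [h0] at this
    norm_num at this
  obtain ⟨X, Y, hXY⟩ : ∃ X Y : ℝ, z = u * (X + Y * ω) := by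
    refine ⟨(z / u).re - (z / u).im / ω.im * ω.re, (z / u).im / ω.im, ?_⟩
    have e : z / u = ((z / u).re - (z / u).im / ω.im * ω.re : ℝ) + ((z / u).im / ω.im : ℝ) * ω := by
      apply Complex.ext
      · simp
      · simp; field_simp
    rw [← e, mul_div_cancel₀ _ hu]
  have fin : ∀ k, (X + Y * ω : ℂ) ∈ cone (ω ^ k) (ω ^ (k + 1)) →
      z ∈ cone (ω ^ k * u) (ω ^ (k + 1) * u) := fun k hk => by
    rw [hXY, mul_comm _ u, mul_comm _ u]
    exact cone_mul u hk
  rcases le_total 0 Y with hY | hY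
  · obtain ⟨k, hk, h5⟩ := upper X Y hY
    exact ⟨k, by omega, fin k h5⟩
  · obtain ⟨k, hk, h5⟩ := upper (-X) (-Y) (by linarith)
    refine ⟨k + 4, by omega, fin (k + 4) ?_⟩
    have := cone_mul (-1) h5
    have e1 : ω ^ (k + 4) = -1 * ω ^ k := by rw [pow_add, h4]; ring
    have e2 : ω ^ (k + 4 + 1) = -1 * ω ^ (k + 1) := by rw [add_right_comm, pow_add, h4]; ring
    rw [e1, e2]
    convert this using 1
    push_cast
    ring

/-- Corners that cover the eight sectors form a star. -/
theorem Eighth.exists_star {ω : ℂ} (hω : Eighth ω) {u : ℂ} (hu : u ≠ 0) {T : Set (Set ℂ)} {p : ℂ}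
    {N : Set ℂ} (h : ∀ k < 8, ∃ v ∈ N, ∃ w ∈ N, Wedge T p v w ∧ ω ^ k * u ∈ cone v w ∧
      ω ^ (k + 1) * u ∈ cone v w) :
    ∃ S v w, Star T p S v w ∧ ∀ k < 8, v k ∈ N ∧ w k ∈ N := by
  have h' : ∀ k, ∃ S v w, k < 8 → v ∈ N ∧ w ∈ N ∧ S ∈ T ∧ IsCorner S p v w ∧
      ω ^ k * u ∈ cone v w ∧ ω ^ (k + 1) * u ∈ cone v w := by
    intro k
    by_cases hk : k < 8
    · obtain ⟨v, hv, w, hw, ⟨S, hS, hc⟩, h1, h2⟩ := h k hk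
      exact ⟨S, v, w, fun _ => ⟨hv, hw, hS, hc, h1, h2⟩⟩
    · exact ⟨∅, 0, 0, fun h => absurd h hk⟩
  choose S v w H using h'
  refine ⟨S, v, w, ⟨fun k hk => (H k hk).2.2.1, fun k hk => (H k hk).2.2.2.1, fun z => ?_⟩,
    fun k hk => ⟨(H k hk).1, (H k hk).2.1⟩⟩
  obtain ⟨k, hk, hz⟩ := hω.exists_sector hu z
  exact ⟨k, hk, cone_subset (H k hk).2.2.2.2.1 (H k hk).2.2.2.2.2 hz⟩

/-- A cyclic list of sectors, each given by the exponents of its two sides, covers the plane. -/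
def Cyclic (P : List (ℕ × ℕ)) : Prop :=
  (∀ a ∈ P, a.1 < a.2 ∧ a.2 ≤ a.1 + 3 ∧ ∃ b ∈ P, b.1 = a.2 % 8) ∧
    ∀ k ∈ List.range 8, ∃ a ∈ P, (a.1 ≤ k ∧ k < a.2) ∨ (a.1 ≤ k + 8 ∧ k + 8 < a.2)

instance : DecidablePred Cyclic := fun P => by unfold Cyclic; infer_instance

/-- The corners at `p` have edge vectors as prescribed by a cyclic list of sectors and by the lengths
`c`, with respect to the directions `ω ^ k * u`. -/
structure ListStar (T : Set (Set ℂ)) (p u ω : ℂ) (P : List (ℕ × ℕ)) (c : ℕ → ℝ) : Prop where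
  eighth : Eighth ω
  norm_u : ‖u‖ = 1
  cyclic : Cyclic P
  length : ∀ k, c k = 1 ∨ c k = √2
  wedge : ∀ a ∈ P, Wedge T p (c (a.1 % 8) • (ω ^ a.1 * u)) (c (a.2 % 8) • (ω ^ a.2 * u))

theorem Eighth.unit_ne_zero {u : ℂ} (h : ‖u‖ = 1) : u ≠ 0 := by
  rintro rfl
  simp at h

namespace ListStar

variable {T : Set (Set ℂ)} {p u ω : ℂ} {P : List (ℕ × ℕ)} {c : ℕ → ℝ}

theorem length_pos (h : ListStar T p u ω P c) (k : ℕ) : 0 < c k := by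
  rcases h.length k with e | e <;> rw [e] <;> positivity

theorem exists_star (h : ListStar T p u ω P c) :
    ∃ S v w, Star T p S v w ∧ ∀ k < 8,
      v k ∈ {v | ∃ a ∈ P, v = c (a.1 % 8) • (ω ^ a.1 * u)} ∧
      w k ∈ {v | ∃ a ∈ P, v = c (a.1 % 8) • (ω ^ a.1 * u)} := by
  refine h.eighth.exists_star (Eighth.unit_ne_zero h.norm_u) fun k hk => ?_
  obtain ⟨a, ha, hak⟩ := h.cyclic.2 k (List.mem_range.2 hk)
  obtain ⟨h1, h2, b, hb, hab⟩ := h.cyclic.1 a ha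
  refine ⟨_, ⟨a, ha, rfl⟩, _, ⟨b, hb, ?_⟩, h.wedge a ha, ?_⟩
  · rw [hab, Nat.mod_mod, h.eighth.pow_mod]
  · rcases hak with hak | hak
    · exact ⟨h.eighth.dir_mem_cone u hak.1 hak.2.le h1 h2 (h.length_pos _) (h.length_pos _),
        h.eighth.dir_mem_cone u (by omega) (by omega) h1 h2 (h.length_pos _) (h.length_pos _)⟩
    · rw [show ω ^ k = ω ^ (k + 8) by rw [pow_add, h.eighth.pow_eight, mul_one],
        show ω ^ (k + 1) = ω ^ (k + 8 + 1) by
          rw [add_right_comm, pow_add _ _ 8, h.eighth.pow_eight, mul_one]]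
      exact ⟨h.eighth.dir_mem_cone u hak.1 hak.2.le h1 h2 (h.length_pos _) (h.length_pos _),
        h.eighth.dir_mem_cone u (by omega) (by omega) h1 h2 (h.length_pos _) (h.length_pos _)⟩

theorem adj_iff (h : ListStar T p u ω P c) (hT : IsTiling T) (hs : AllStars T)
    (hp : p ∈ tilingVertices T) (q : tilingVertices T) :
    (tilingGraph T).Adj ⟨p, hp⟩ q ↔ ∃ a ∈ P, (q : ℂ) = p + c (a.1 % 8) • (ω ^ (a.1 % 8) * u) := by
  constructor
  · intro hq
    obtain ⟨S, v, w, hS, hN⟩ := h.exists_star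
    obtain ⟨k, hk, hqk⟩ := hS.neighbor hT hs hq
    obtain ⟨⟨a, ha, hva⟩, b, hb, hwb⟩ := hN k hk
    rcases hqk with e | e
    · exact ⟨a, ha, by rw [e, hva, h.eighth.pow_mod]⟩
    · exact ⟨b, hb, by rw [e, hwb, h.eighth.pow_mod]⟩
  · rintro ⟨a, ha, e⟩
    rw [h.eighth.pow_mod] at e
    have := (h.wedge a ha).adj hT hs
    convert this

end ListStar

theorem dist_dir {p u ω : ℂ} (hω : Eighth ω) (hu : ‖u‖ = 1) {c : ℝ} (hc : 0 < c) (k : ℕ) :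
    dist p (p + c • (ω ^ k * u)) = c := by
  rw [dist_eq_norm, sub_add_cancel_left, norm_neg, norm_smul, norm_mul, norm_pow, hω.norm, hu]
  simp [abs_of_pos hc]

/-- The distance from `p` recovers the length; after cancelling it, distinct powers of a primitive
eighth root remain distinct. -/
theorem dir_injOn {p u ω : ℂ} (hω : Eighth ω) (hu : ‖u‖ = 1) {c : ℕ → ℝ} (hc : ∀ k, 0 < c k)
    {i j : ℕ} (hi : i < 8) (hj : j < 8)
    (e : p + c i • (ω ^ i * u) = p + c j • (ω ^ j * u)) : i = j := by
  have h1 := dist_dir (p := p) hω hu (hc i) i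
  rw [e, dist_dir hω hu (hc j) j] at h1
  rw [h1] at e
  have e2 := smul_right_injective ℂ (hc i).ne' (add_left_cancel e)
  exact hω.primitive.pow_inj hi hj (mul_right_cancel₀ (Eighth.unit_ne_zero hu) e2)

/-- Degree and sum of a vertex whose neighbours are given by directions and lengths. -/
theorem degree_and_sum {T : Set (Set ℂ)} {p u ω : ℂ} (hω : Eighth ω) (hu : ‖u‖ = 1)
    {c : ℕ → ℝ} (hc : ∀ k, c k = 1 ∨ c k = √2) {K : Finset ℕ} (hK : ∀ k ∈ K, k < 8)
    (hp : p ∈ tilingVertices T) (hex : ∀ k ∈ K, p + c k • (ω ^ k * u) ∈ tilingVertices T)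
    (h : ∀ q, (tilingGraph T).Adj ⟨p, hp⟩ q ↔ ∃ k ∈ K, (q : ℂ) = p + c k • (ω ^ k * u)) :
    ((tilingGraph T).neighborSet ⟨p, hp⟩).Finite ∧
    ((tilingGraph T).neighborSet ⟨p, hp⟩).ncard = K.card ∧
    weightedDegree (tilingGraph T) (lengthWeight T) ⟨p, hp⟩ =
      ∑ k ∈ K, open Classical in if c k = √2 then 2 else 1 := by
  classical
  have hc0 : ∀ k, 0 < c k := fun k => by rcases hc k with e | e <;> rw [e] <;> positivity
  let g : ℕ → tilingVertices T := fun k =>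
    if hk : p + c k • (ω ^ k * u) ∈ tilingVertices T then ⟨_, hk⟩ else ⟨p, hp⟩
  have hg : ∀ k ∈ K, (g k : ℂ) = p + c k • (ω ^ k * u) := fun k hk => by
    simp only [g, dif_pos (hex k hk)]
  have hinj : Set.InjOn g K := fun i hi j hj e => by
    have e := congrArg Subtype.val e
    rw [hg i hi, hg j hj] at e
    exact dir_injOn hω hu hc0 (hK i hi) (hK j hj) e
  have hN : (tilingGraph T).neighborSet ⟨p, hp⟩ = g '' K := by
    ext q
    rw [SimpleGraph.mem_neighborSet, h]
    constructor
    · rintro ⟨k, hk, e⟩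
      exact ⟨k, hk, Subtype.ext ((hg k hk).trans e.symm)⟩
    · rintro ⟨k, hk, rfl⟩
      exact ⟨k, hk, hg k hk⟩
  refine ⟨hN ▸ K.finite_toSet.image g, ?_, ?_⟩
  · rw [hN, hinj.ncard_image, Set.ncard_coe_finset]
  · rw [weightedDegree, hN, finsum_mem_image hinj, finsum_mem_coe_finset]
    refine Finset.sum_congr rfl fun k hk => ?_
    simp only [lengthWeight, Sym2.lift_mk]
    rw [hg k hk, dist_dir hω hu (hc0 k) k]

/-! ### Evaluation of coordinates -/

/-- The value of an element of `ℤ[√2]`. -/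
def val (x : ℤ√2) : ℝ := x.re + x.im * √2

theorem val_add (x y : ℤ√2) : val (x + y) = val x + val y := by simp [val]; ring
theorem val_sub (x y : ℤ√2) : val (x - y) = val x - val y := by simp [val]; ring
theorem val_neg (x : ℤ√2) : val (-x) = -val x := by simp [val]; ring

theorem val_mul (x y : ℤ√2) : val (x * y) = val x * val y := by
  have hs : √2 * √2 = 2 := Real.mul_self_sqrt (by norm_num)
  simp [val]
  linear_combination - (x.im * y.im : ℝ) * hs

theorem val_sqrt : val ⟨0, 1⟩ = √2 := by simp [val]
theorem val_zero : val 0 = 0 := by simp [val]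
theorem val_one : val 1 = 1 := by simp [val]

theorem Nn.val_nonneg {x : ℤ√2} (h : Nn x) : 0 ≤ val x := by
  have hs : √2 * √2 = 2 := Real.mul_self_sqrt (by norm_num)
  have hs0 : 0 ≤ √2 := by positivity
  unfold val
  rcases h with ⟨h1, h2⟩ | ⟨h1, h2⟩ | ⟨h1, h2⟩
  · have h1 : (0 : ℝ) ≤ x.re := by exact_mod_cast h1
    have h2 : (0 : ℝ) ≤ x.im := by exact_mod_cast h2
    positivity
  · have h1 : (0 : ℝ) ≤ x.re := by exact_mod_cast h1
    have h2 : (2 : ℝ) * x.im * x.im ≤ x.re * x.re := by exact_mod_cast h2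
    have := abs_le_of_sq_le_sq (a := (x.im : ℝ) * √2) (b := x.re) (by nlinarith) h1
    linarith [neg_le_of_abs_le this]
  · have h1 : (0 : ℝ) ≤ x.im := by exact_mod_cast h1
    have h2 : (x.re : ℝ) * x.re ≤ 2 * x.im * x.im := by exact_mod_cast h2
    have := abs_le_of_sq_le_sq (a := (x.re : ℝ)) (b := x.im * √2) (by nlinarith) (by positivity)
    linarith [neg_le_of_abs_le this]

/-- The vector with given coordinates in the frame `u`, `ω * u`. -/
def ev (ω u : ℂ) (z : Pt) : ℂ := (val z.1 + val z.2 * ω) * u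

section ev

variable (ω u : ℂ)

theorem ev_add (z w : Pt) : ev ω u (z + w) = ev ω u z + ev ω u w := by
  simp [ev, val_add]; ring

theorem ev_sub (z w : Pt) : ev ω u (z - w) = ev ω u z - ev ω u w := by
  simp [ev, val_sub]; ring

theorem ev_neg (z : Pt) : ev ω u (-z) = -ev ω u z := by
  simp [ev, val_neg]; ring

theorem ev_s2 (z : Pt) : ev ω u z.s2 = √2 • ev ω u z := by
  simp [ev, Pt.s2, val_mul, val_sqrt]; ring

theorem ev_one : ev ω u (1, 0) = u := by simp [ev, val_zero, val_one]

theorem infl_ev (p : ℂ) (z : Pt) : infl (p + ev ω u z) = infl p + ev ω u z.lam := by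
  rw [Pt.lam, ev_add, ev_s2, infl, infl]; module

/-- `ω` or its inverse. -/
def omB (ω : ℂ) (b : Bool) : ℂ := bif b then ω else (√2 : ℝ) - ω

variable {ω}

theorem Eighth.omB (h : Eighth ω) (b : Bool) : Eighth (omB ω b) := by
  cases b
  · exact h.conj
  · exact h

theorem Eighth.ev_rot (h : Eighth ω) (b : Bool) (z : Pt) :
    ev ω u (z.rot b) = AmmannBeenker.omB ω b * ev ω u z := by
  have h2 : ω ^ 2 = (√2 : ℝ) * ω - 1 := h
  cases b
  · simp [ev, Pt.rot, AmmannBeenker.omB, val_add, val_neg, val_mul, val_sqrt]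
    linear_combination (val z.2 : ℂ) * u * h2
  · simp [ev, Pt.rot, AmmannBeenker.omB, val_add, val_neg, val_mul, val_sqrt]
    linear_combination -(val z.2 : ℂ) * u * h2

theorem Eighth.ev_rotN (h : Eighth ω) (b : Bool) (k : ℕ) (z : Pt) :
    ev ω u (z.rotN b k) = AmmannBeenker.omB ω b ^ k * ev ω u z := by
  induction k with
  | zero => simp [Pt.rotN]
  | succ k ih => rw [Pt.rotN, h.ev_rot, ih]; ring

variable {u}

theorem Eighth.norm_ev_sq (h : Eighth ω) (hu : ‖u‖ = 1) (z : Pt) :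
    ‖ev ω u z‖ ^ 2 = val z.nsq := by
  obtain ⟨h1, h2⟩ := h.re_im
  have hs : √2 * √2 = 2 := Real.mul_self_sqrt (by norm_num)
  rw [ev, norm_mul, hu, mul_one, ← Complex.normSq_eq_norm_sq, Complex.normSq_apply]
  simp [Pt.nsq, val_add, val_mul, val_sqrt, h1]
  linear_combination (val z.2 ^ 2 : ℝ) * h2 + (val z.2 ^ 2 : ℝ) / 4 * hs

theorem Eighth.dist_ev (h : Eighth ω) (hu : ‖u‖ = 1) (p : ℂ) (z w : Pt) :
    dist (p + ev ω u z) (p + ev ω u w) ^ 2 = val (z - w).nsq := by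
  rw [dist_eq_norm, add_sub_add_left_eq_sub, ← ev_sub, h.norm_ev_sq hu]

/-- The sign of `ω.im` is the orientation of the frame. Statements about sides of a line absorb it
either by scaling a direction with `ω.im` or by multiplying two determinants. -/
theorem det_ev (hu : ‖u‖ = 1) (z w : Pt) :
    det (ev ω u z) (ev ω u w) = val (z.cr w) * ω.im := by
  have hu' : u.re * u.re + u.im * u.im = 1 := by
    rw [← Complex.normSq_apply, Complex.normSq_eq_norm_sq, hu, one_pow]
  simp [ev, det, Pt.cr, val_sub, val_mul]
  linear_combination (val z.1 * val w.2 * ω.im - val w.1 * val z.2 * ω.im) * hu'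

end ev

theorem Eighth.im_ne {ω : ℂ} (h : Eighth ω) : ω.im ≠ 0 := by
  intro h0
  have := h.re_im.2
  rw [h0] at this
  norm_num at this

/-! ### Tiles in a frame -/

/-- The image of an edge. -/
def OEdge.toC (p ω u : ℂ) (e : OEdge Pt) : OEdge ℂ :=
  ⟨e.hyp, p + ev ω u e.x, p + ev ω u e.y, ev ω u e.n⟩

theorem OEdge.toC_flip (p ω u : ℂ) (e : OEdge Pt) : e.flip.toC p ω u = (e.toC p ω u).flip := by
  simp [OEdge.flip, OEdge.toC, ev_neg]

namespace MTile

/-- The tile described by coordinates. -/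
def toTile (p ω u : ℂ) : MTile → Tile
  | .tri a b c => .tri (p + ev ω u a) (p + ev ω u b) (p + ev ω u c)
  | .rhomb a b c d => .rhomb (p + ev ω u a) (p + ev ω u b) (p + ev ω u c) (p + ev ω u d)

variable (p ω u : ℂ) (t : MTile)

theorem edges_toTile : (t.toTile p ω u).edges = t.edges.map (OEdge.toC p ω u) := by
  cases t <;> simp [toTile, edges, Tile.edges, triEdges, rhombEdges, OEdge.toC, ev_sub, ev_add,
    ev_s2]

theorem corners_toTile : (t.toTile p ω u).corners =
    t.corners.map fun c => (p + ev ω u c.1, ev ω u c.2.1, ev ω u c.2.2) := by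
  cases t <;> simp [toTile, corners, Tile.corners, triCorners, rhombCorners, ev_sub]

theorem verts_toTile : (t.toTile p ω u).verts = t.verts.map fun z => p + ev ω u z := by
  cases t <;> simp [toTile, verts, Tile.verts]

end MTile

theorem Tile.support_eq (t : Tile) : t.support = convexHull ℝ {z | z ∈ t.verts} := by
  cases t <;> simp only [Tile.support, Tile.verts] <;> congr 1 <;> ext <;> simp

theorem cos_angle_eq {q p s : ℂ} (h1 : dist p q = 1) (h2 : dist p s = 1) :
    Real.cos (∠ q p s) = 1 - dist q s ^ 2 / 2 := by
  have := EuclideanGeometry.law_cos q p s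
  rw [dist_comm q p, dist_comm s p, h1, h2] at this
  linarith

/-- The law of cosines encodes the acute angle in the short diagonal, which turns validity into a
condition on squared distances that can be tested in `ℤ[√2]`. -/
theorem angle_iff {q p s : ℂ} (h1 : dist p q = 1) (h2 : dist p s = 1) :
    ∠ q p s = Real.pi / 4 ↔ dist q s ^ 2 = 2 - √2 := by
  have h := cos_angle_eq h1 h2
  constructor
  · intro e
    rw [e, Real.cos_pi_div_four] at h
    linarith
  · intro e
    refine Real.injOn_cos ⟨EuclideanGeometry.angle_nonneg _ _ _, EuclideanGeometry.angle_le_pi _ _ _⟩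
      ⟨by positivity, by linarith [Real.pi_pos]⟩ ?_
    rw [h, e, Real.cos_pi_div_four]
    ring

theorem eq_one_of_sq {x : ℝ} (h : x ^ 2 = 1) (h0 : 0 ≤ x) : x = 1 := by nlinarith

theorem MTile.valid_toTile {p ω u : ℂ} (hω : Eighth ω) (hu : ‖u‖ = 1) {t : MTile} (h : t.Valid) :
    (t.toTile p ω u).Valid := by
  have one : ∀ z w : Pt, (z - w).nsq = 1 → dist (p + ev ω u z) (p + ev ω u w) = 1 :=
    fun z w e => eq_one_of_sq (by rw [hω.dist_ev hu, e, val_one]) dist_nonneg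
  cases t with
  | tri a b c =>
    refine ⟨one _ _ h.1, one _ _ h.2.1, ?_⟩
    rw [← Real.sqrt_sq (dist_nonneg (x := p + ev ω u a)), hω.dist_ev hu, h.2.2]
    congr 1
    simp [val]
  | rhomb a b c d =>
    refine ⟨one _ _ h.1, one _ _ h.2.1, ?_, ?_⟩
    · rw [h.2.2.1, ev_sub, ev_add]; ring
    · rw [angle_iff (one _ _ h.1) (one _ _ h.2.1), hω.dist_ev hu, h.2.2.2]
      simp [val]; ring

/-- The tile `t` and its substitution are described by the model `K`. -/
structure Framed (t : Tile) (K : Model) (p ω u : ℂ) : Prop where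
  mem : K ∈ models
  eighth : Eighth ω
  norm_u : ‖u‖ = 1
  tile : t = K.tile.toTile p ω u
  subst : ∀ t', t' ∈ t.subst ↔ ∃ m ∈ K.subst, t' = m.toTile (infl p) ω u
  cornerPts : t.cornerPts = K.cornerPts.map fun z => infl p + ev ω u z
  midPts : t.midPts = K.midPts.map fun z => infl p + ev ω u z
  sevenPts : t.sevenPts = K.sevenPts.map fun z => infl p + ev ω u z
  fivePts : t.fivePts = K.fivePts.map fun z => infl p + ev ω u z
  fourPts : t.fourPts = K.fourPts.map fun z => infl p + ev ω u z

section vertices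

variable (p ω u : ℂ)

theorem infl_toC {z r : Pt} (h : z.lam = r) : infl (p + ev ω u z) = infl p + ev ω u r := by
  rw [infl_ev, h]

theorem side_toC {z w r : Pt} (h : z.lam + (w - z).s2 = r) :
    sideVertex (p + ev ω u z) (p + ev ω u w) = infl p + ev ω u r := by
  rw [← h, sideVertex, infl_ev, ev_add, ev_s2, ev_sub, add_sub_add_left_eq_sub, add_assoc]

theorem sqrt_inv_smul {x y : ℂ} (h : √2 • x = y) : (√2)⁻¹ • y = x := by
  rw [← h, smul_smul, inv_mul_cancel₀ (by positivity), one_smul]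

/-- `ℤ[√2]` is not closed under division by `√2`, so the quotient `d` of `w - z` is supplied as a
witness. -/
theorem hyp_toC {z w r : Pt} (d : Pt) (hd : d.s2 = w - z) (h : z.lam + d = r) :
    hypVertex (p + ev ω u z) (p + ev ω u w) = infl p + ev ω u r := by
  rw [← h, hypVertex, infl_ev, ev_add, add_sub_add_left_eq_sub, ← ev_sub,
    sqrt_inv_smul (ev_s2 ω u d ▸ congrArg (ev ω u) hd), add_assoc]

theorem apex_toC {a b c r : Pt} (d : Pt) (hd : d.s2 = (a - b) + (c - b)) (h : b.lam + d = r) :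
    apexVertex (p + ev ω u a) (p + ev ω u b) (p + ev ω u c) = infl p + ev ω u r := by
  rw [← h, apexVertex, infl_ev, ev_add, add_sub_add_left_eq_sub, add_sub_add_left_eq_sub, ← ev_sub,
    ← ev_sub, ← ev_add, sqrt_inv_smul (ev_s2 ω u d ▸ congrArg (ev ω u) hd), add_assoc]

theorem acute_toC {a b c r : Pt} (h : a.lam + (b - a) + (c - a) = r) :
    acuteVertex (p + ev ω u a) (p + ev ω u b) (p + ev ω u c) = infl p + ev ω u r := by
  rw [← h, acuteVertex, infl_ev, ev_add, ev_add, add_sub_add_left_eq_sub, add_sub_add_left_eq_sub,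
    ← ev_sub, ← ev_sub]
  ring

end vertices

theorem framed_triangle {p ω u : ℂ} (hω : Eighth ω) (hu : ‖u‖ = 1) :
    Framed (Model.triangle.tile.toTile p ω u) .triangle p ω u := by
  have i1 := infl_toC p ω u (z := (0, 0)) (r := (0, 0)) (by decide)
  have i2 := infl_toC p ω u (z := (1, 0)) (r := (⟨1, 1⟩, 0)) (by decide)
  have i3 := infl_toC p ω u (z := (0, ⟨0, 1⟩)) (r := (0, ⟨2, 1⟩)) (by decide)
  have s1 := side_toC p ω u (z := (0, 0)) (w := (1, 0)) (r := (⟨0, 1⟩, 0)) (by decide)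
  have s2 := side_toC p ω u (z := (1, 0)) (w := (0, ⟨0, 1⟩)) (r := (1, 2)) (by decide)
  have h1 := hyp_toC p ω u (z := (0, 0)) (w := (0, ⟨0, 1⟩)) (r := (0, 1)) (0, 1)
    (by decide) (by decide)
  have h2 := hyp_toC p ω u (z := (0, ⟨0, 1⟩)) (w := (0, 0)) (r := (0, ⟨1, 1⟩)) (0, -1)
    (by decide) (by decide)
  have x := apex_toC p ω u (a := (0, 0)) (b := (1, 0)) (c := (0, ⟨0, 1⟩)) (r := (1, 1))
    (⟨0, -1⟩, 1) (by decide) (by decide)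
  refine ⟨by simp [models], hω, hu, rfl, fun t' => ?_, ?_, ?_, ?_, ?_, ?_⟩
  · simp only [Model.triangle, MTile.toTile, Tile.subst, i1, i2, i3, s1, s2, h1, h2, x,
      List.mem_cons, List.not_mem_nil, or_false, exists_eq_or_imp, exists_eq_left,
      Set.mem_insert_iff, Set.mem_singleton_iff]
  all_goals simp only [Model.triangle, MTile.toTile, Tile.cornerPts, Tile.midPts, Tile.sevenPts,
    Tile.fivePts, Tile.fourPts, Tile.verts, List.map, i1, i2, i3, s1, s2, h1, h2, x]

theorem framed_rhombus {p ω u : ℂ} (hω : Eighth ω) (hu : ‖u‖ = 1) :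
    Framed (Model.rhombus.tile.toTile p ω u) .rhombus p ω u := by
  have i1 := infl_toC p ω u (z := (0, 0)) (r := (0, 0)) (by decide)
  have i2 := infl_toC p ω u (z := (1, 0)) (r := (⟨1, 1⟩, 0)) (by decide)
  have i3 := infl_toC p ω u (z := (1, 1)) (r := (⟨1, 1⟩, ⟨1, 1⟩)) (by decide)
  have i4 := infl_toC p ω u (z := (0, 1)) (r := (0, ⟨1, 1⟩)) (by decide)
  have s1 := side_toC p ω u (z := (1, 0)) (w := (0, 0)) (r := (1, 0)) (by decide)
  have s2 := side_toC p ω u (z := (0, 1)) (w := (0, 0)) (r := (0, 1)) (by decide)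
  have s3 := side_toC p ω u (z := (1, 0)) (w := (1, 1)) (r := (⟨1, 1⟩, ⟨0, 1⟩)) (by decide)
  have s4 := side_toC p ω u (z := (0, 1)) (w := (1, 1)) (r := (⟨0, 1⟩, ⟨1, 1⟩)) (by decide)
  have y := acute_toC p ω u (a := (0, 0)) (b := (1, 0)) (c := (0, 1)) (r := (1, 1)) (by decide)
  have z := acute_toC p ω u (a := (1, 1)) (b := (1, 0)) (c := (0, 1)) (r := (⟨0, 1⟩, ⟨0, 1⟩))
    (by decide)
  refine ⟨by simp [models], hω, hu, rfl, fun t' => ?_, ?_, ?_, ?_, ?_, ?_⟩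
  · simp only [Model.rhombus, MTile.toTile, Tile.subst, i1, i2, i3, i4, s1, s2, s3, s4, y, z,
      List.mem_cons, List.not_mem_nil, or_false, exists_eq_or_imp, exists_eq_left,
      Set.mem_insert_iff, Set.mem_singleton_iff]
  all_goals simp only [Model.rhombus, MTile.toTile, Tile.cornerPts, Tile.midPts, Tile.sevenPts,
    Tile.fivePts, Tile.fourPts, Tile.verts, List.map, i1, i2, i3, i4, s1, s2, s3, s4, y, z]

theorem eighth_of_norm {ω : ℂ} (h1 : ‖ω‖ = 1) (h2 : ‖1 - ω‖ ^ 2 = 2 - √2) : Eighth ω := by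
  have e1 : ω.re * ω.re + ω.im * ω.im = 1 := by
    rw [← Complex.normSq_apply, Complex.normSq_eq_norm_sq, h1, one_pow]
  have e2 : ω.re = √2 / 2 := by
    rw [← Complex.normSq_eq_norm_sq, Complex.normSq_apply] at h2
    simp at h2
    nlinarith
  have hs : √2 * √2 = 2 := Real.mul_self_sqrt (by norm_num)
  unfold Eighth
  apply Complex.ext
  · simp [pow_two, e2] at e1 ⊢
    nlinarith
  · simp [pow_two, e2]
    ring

/-- Every valid tile is described by one of the two models. -/
theorem Tile.Valid.exists_framed {t : Tile} (h : t.Valid) : ∃ K p ω u, Framed t K p ω u := by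
  cases t with
  | tri a b c =>
    obtain ⟨h1, h2, h3⟩ := h
    have hu : ‖b - a‖ = 1 := by rw [← dist_eq_norm, dist_comm, h1]
    have hu0 := Eighth.unit_ne_zero hu
    have hs : √2 * √2 = 2 := Real.mul_self_sqrt (by norm_num)
    have hs' := sqrt_two_sq
    have hs0 : ((√2 : ℝ) : ℂ) ≠ 0 := fun e => by rw [e] at hs'; norm_num at hs'
    have hω : Eighth ((c - a) / ((√2 : ℝ) * (b - a))) := by
      have n1 : ‖(c - b) / (b - a)‖ = 1 := by
        rw [norm_div, hu, div_one, ← dist_eq_norm, dist_comm, h2]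
      have n2 : ‖1 + (c - b) / (b - a)‖ ^ 2 = 2 := by
        rw [one_add_div hu0, norm_div, hu, div_one, show b - a + (c - b) = c - a by ring,
          ← dist_eq_norm, dist_comm, h3, pow_two, hs]
      -- `‖j‖ = 1` and `‖1 + j‖ ^ 2 = 2` force `j` to be purely imaginary, so `j ^ 2 = -1` and `(1 +
      -- j) / √2` is the desired root of unity.
      set j := (c - b) / (b - a) with hj
      rw [← Complex.normSq_eq_norm_sq, Complex.normSq_apply] at n2
      have n1' : j.re * j.re + j.im * j.im = 1 := by
        rw [← Complex.normSq_apply, Complex.normSq_eq_norm_sq, n1, one_pow]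
      simp at n2
      have hre : j.re = 0 := by nlinarith
      have hjj : j ^ 2 = -1 := by
        apply Complex.ext
        · simp [pow_two, hre] at n1' ⊢
          linarith
        · simp [pow_two, hre]
      have hc : (c - a) / ((√2 : ℝ) * (b - a)) = (1 + j) / (√2 : ℝ) := by
        rw [hj]; field_simp; ring
      rw [hc]
      unfold Eighth
      field_simp
      linear_combination hjj - j * hs'
    refine ⟨.triangle, a, (c - a) / ((√2 : ℝ) * (b - a)), b - a, ?_⟩
    have := framed_triangle (p := a) hω hu
    convert this using 1
    simp only [Model.triangle, MTile.toTile, ev, val_zero, val_one, val_sqrt]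
    congr 1
    · simp
    · simp
    · field_simp
      simp
  | rhomb p q r s =>
    obtain ⟨h1, h2, h3, h4⟩ := h
    have hu : ‖q - p‖ = 1 := by rw [← dist_eq_norm, dist_comm, h1]
    have hu0 := Eighth.unit_ne_zero hu
    have hω : Eighth ((s - p) / (q - p)) := by
      refine eighth_of_norm ?_ ?_
      · rw [norm_div, hu, div_one, ← dist_eq_norm, dist_comm, h2]
      · rw [one_sub_div hu0, norm_div, hu, div_one, sub_sub_sub_cancel_right, ← dist_eq_norm]
        exact (angle_iff h1 h2).1 h4
    refine ⟨.rhombus, p, (s - p) / (q - p), q - p, ?_⟩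
    have := framed_rhombus (p := p) hω hu
    convert this using 1
    simp only [Model.rhombus, MTile.toTile, ev, val_zero, val_one]
    congr 1
    · simp
    · simp
    · field_simp
      simp [h3]; ring
    · field_simp
      simp

/-! ### Corners and vertices of valid tiles -/

/-- From any corner, every vertex of the tile is reached by `0`, by one of the two edge vectors or
by their sum, so the whole tile lies in the cone of that corner; the nonzero determinant keeps the
cone pointed. -/
theorem models_tile_corners : ∀ K ∈ models, ∀ c ∈ K.tile.corners,
    c.2.1.cr c.2.2 ∈ [1, -1, ⟨0, 1⟩, ⟨0, -1⟩] ∧ c.1 ∈ K.tile.verts ∧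
    c.1 + c.2.1 ∈ K.tile.verts ∧ c.1 + c.2.2 ∈ K.tile.verts ∧
    ∀ z ∈ K.tile.verts, z - c.1 ∈ [(0, 0), c.2.1, c.2.2, c.2.1 + c.2.2] := by
  decide +kernel

theorem models_tile_verts : ∀ K ∈ models, ∀ z ∈ K.tile.verts, ∃ c ∈ K.tile.corners, c.1 = z := by
  decide +kernel

/-- The factor `(e.y - e.x).cr e.n` makes the sign independent of the direction of the edge and of
the orientation of the frame. -/
theorem models_edge_half : ∀ K ∈ models, ∀ e ∈ K.tile.edges,
    (e.y - e.x).cr e.n ∈ [2, -2, ⟨0, 2⟩, ⟨0, -2⟩] ∧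
    ∀ z ∈ K.tile.verts, Nn ((e.y - e.x).cr (z - e.x) * (e.y - e.x).cr e.n) := by
  decide +kernel

theorem models_subst_verts : ∀ K ∈ models, ∀ t ∈ K.subst, ∀ z ∈ t.verts,
    z ∈ K.cornerPts ++ K.midPts ++ K.sevenPts ++ K.fivePts ++ K.fourPts := by
  decide +kernel

theorem ev_zero (ω u : ℂ) : ev ω u (0, 0) = 0 := by simp [ev, val_zero]

theorem Framed.corner {t : Tile} {K : Model} {p ω u : ℂ} (h : Framed t K p ω u)
    {c : ℂ × ℂ × ℂ} (hc : c ∈ t.corners) :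
    det c.2.1 c.2.2 ≠ 0 ∧ c.1 ∈ t.verts ∧ c.1 + c.2.1 ∈ t.verts ∧ c.1 + c.2.2 ∈ t.verts ∧
      ∀ z ∈ t.verts, z - c.1 ∈ cone c.2.1 c.2.2 := by
  rw [h.tile, MTile.corners_toTile, List.mem_map] at hc
  obtain ⟨c, hc, rfl⟩ := hc
  obtain ⟨h1, h2, h3, h4, h5⟩ := models_tile_corners K h.mem c hc
  rw [h.tile, MTile.verts_toTile]
  refine ⟨?_, List.mem_map_of_mem h2, ?_, ?_, ?_⟩
  · rw [det_ev h.norm_u]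
    refine mul_ne_zero ?_ h.eighth.im_ne
    simp only [List.mem_cons, List.not_mem_nil, or_false] at h1
    rcases h1 with e | e | e | e <;> rw [e] <;> simp [val]
  · exact List.mem_map.2 ⟨_, h3, by rw [ev_add, add_assoc]⟩
  · exact List.mem_map.2 ⟨_, h4, by rw [ev_add, add_assoc]⟩
  · intro z hz
    obtain ⟨z', hz', rfl⟩ := List.mem_map.1 hz
    have := h5 z' hz'
    simp only [List.mem_cons, List.not_mem_nil, or_false] at this
    simp only [add_sub_add_left_eq_sub, ← ev_sub]
    rcases this with e | e | e | e <;> rw [e]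
    · exact ⟨0, 0, le_rfl, le_rfl, by rw [ev_zero]; simp⟩
    · exact ⟨1, 0, zero_le_one, le_rfl, by simp⟩
    · exact ⟨0, 1, le_rfl, zero_le_one, by simp⟩
    · exact ⟨1, 1, zero_le_one, zero_le_one, by rw [ev_add]; simp⟩

theorem Tile.verts_subset_support (t : Tile) {z : ℂ} (hz : z ∈ t.verts) : z ∈ t.support := by
  rw [Tile.support_eq]
  exact subset_convexHull ℝ _ hz

theorem Tile.convex_support (t : Tile) : Convex ℝ t.support := by
  rw [Tile.support_eq]
  exact convex_convexHull ℝ _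

theorem Tile.Valid.vert_extreme {t : Tile} (h : t.Valid) {z : ℂ} (hz : z ∈ t.verts) :
    z ∈ t.support.extremePoints ℝ := by
  obtain ⟨K, p, ω, u, hf⟩ := h.exists_framed
  obtain ⟨c, hc, rfl⟩ : ∃ c ∈ t.corners, c.1 = z := by
    rw [hf.tile, MTile.verts_toTile, List.mem_map] at hz
    obtain ⟨z, hz, rfl⟩ := hz
    obtain ⟨c, hc, rfl⟩ := models_tile_verts K hf.mem z hz
    rw [hf.tile, MTile.corners_toTile]
    exact ⟨_, List.mem_map_of_mem hc, rfl⟩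
  obtain ⟨h1, h2, h3, h4, h5⟩ := hf.corner hc
  exact extreme_of_cone (t.verts_subset_support hz)
    (fun z hz => hull_sub_cone h5 z (t.support_eq ▸ hz)) h1

theorem Tile.Valid.isCorner {t : Tile} (h : t.Valid) {c : ℂ × ℂ × ℂ} (hc : c ∈ t.corners) :
    IsCorner t.support c.1 c.2.1 c.2.2 := by
  obtain ⟨K, p, ω, u, hf⟩ := h.exists_framed
  obtain ⟨h1, h2, h3, h4, h5⟩ := hf.corner hc
  exact ⟨t.convex_support, t.verts_subset_support h2, h.vert_extreme h3, h.vert_extreme h4,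
    fun z hz => hull_sub_cone h5 z (t.support_eq ▸ hz), h1⟩

theorem Tile.Valid.extremePoints {t : Tile} (h : t.Valid) :
    t.support.extremePoints ℝ = {z | z ∈ t.verts} := by
  refine Set.Subset.antisymm ?_ fun z hz => h.vert_extreme hz
  rw [t.support_eq]
  exact extremePoints_convexHull_subset

theorem Tile.Valid.interior_nonempty {t : Tile} (h : t.Valid) : (interior t.support).Nonempty := by
  cases t with
  | tri a b c => exact (h.isCorner (c := (a, b - a, c - a)) (by simp [corners, triCorners])).interior_nonempty
  | rhomb p q r s =>
    exact (h.isCorner (c := (p, q - p, s - p)) (by simp [corners, rhombCorners])).interior_nonempty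

/-! ### Substitution and inflation -/

theorem infl_combo (x v : ℂ) (c : ℝ) : infl (x + c • v) = infl x + ((1 + √2) * c) • v := by
  rw [infl, infl, smul_add, smul_smul]

/-- Since `√2 = (1 + √2) (2 - √2)`, the point is the inflation of a convex combination of `x` and
`y`. The analogous formulas for the other new vertices keep a substituted tile inside the inflated
one. -/
theorem sideVertex_eq (x y : ℂ) : sideVertex x y = infl (x + (2 - √2) • (y - x)) := by
  rw [infl_combo, sideVertex]
  congr 2
  nlinarith [Real.mul_self_sqrt (show (0 : ℝ) ≤ 2 by norm_num)]

theorem inv_sqrt_two : (√2)⁻¹ = (1 + √2) * (1 - √2 / 2) := by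
  have hs : √2 * √2 = 2 := Real.mul_self_sqrt (by norm_num)
  exact inv_eq_of_mul_eq_one_right (by linear_combination (1 / 2 - √2 / 2) * hs)

theorem hypVertex_eq (x y : ℂ) : hypVertex x y = infl (x + (1 - √2 / 2) • (y - x)) := by
  rw [infl_combo, hypVertex, inv_sqrt_two]

theorem apexVertex_eq (a b c : ℂ) :
    apexVertex a b c = infl (b + (1 - √2 / 2) • ((a - b) + (c - b))) := by
  rw [infl_combo, apexVertex, inv_sqrt_two]

theorem acuteVertex_eq (p q s : ℂ) :
    acuteVertex p q s = infl (p + (√2 - 1) • ((q - p) + (s - p))) := by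
  rw [infl_combo, acuteVertex, show (1 + √2) * (√2 - 1) = 1 by
    nlinarith [Real.mul_self_sqrt (show (0 : ℝ) ≤ 2 by norm_num)], one_smul, add_assoc]

theorem sqrt_two_bounds : 1 < √2 ∧ √2 < 3 / 2 := by
  constructor
  · rw [Real.lt_sqrt] <;> norm_num
  · rw [Real.sqrt_lt'] <;> norm_num

theorem combo_two_mem {S : Set ℂ} (hS : Convex ℝ S) {x y : ℂ} (hx : x ∈ S) (hy : y ∈ S) {c : ℝ}
    (h0 : 0 ≤ c) (h1 : c ≤ 1) : x + c • (y - x) ∈ S :=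
  hS.add_smul_sub_mem hx hy ⟨h0, h1⟩

theorem combo_three_mem {S : Set ℂ} (hS : Convex ℝ S) {x y z : ℂ} (hx : x ∈ S) (hy : y ∈ S)
    (hz : z ∈ S) {c : ℝ} (h0 : 0 ≤ c) (h1 : 2 * c ≤ 1) : x + c • ((y - x) + (z - x)) ∈ S := by
  have h2 := hS.add_smul_sub_mem hx (hS hy hz (show (0 : ℝ) ≤ 1 / 2 by norm_num)
    (show (0 : ℝ) ≤ 1 / 2 by norm_num) (by norm_num)) (t := 2 * c) ⟨by linarith, h1⟩
  convert h2 using 1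
  module

/-- All vertices of the substituted tile. -/
def Tile.allPts (t : Tile) : List ℂ :=
  t.cornerPts ++ t.midPts ++ t.sevenPts ++ t.fivePts ++ t.fourPts

theorem Tile.allPts_mem (t : Tile) {z : ℂ} (hz : z ∈ t.allPts) : z ∈ infl '' t.support := by
  obtain ⟨b1, b2⟩ := sqrt_two_bounds
  have hc := t.convex_support
  have hv : ∀ x ∈ t.verts, x ∈ t.support := fun x hx => t.verts_subset_support hx
  have side : ∀ x ∈ t.verts, ∀ y ∈ t.verts, sideVertex x y ∈ infl '' t.support :=
    fun x hx y hy => ⟨_, combo_two_mem hc (hv x hx) (hv y hy) (by linarith) (by linarith),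
      (sideVertex_eq x y).symm⟩
  have hyp : ∀ x ∈ t.verts, ∀ y ∈ t.verts, hypVertex x y ∈ infl '' t.support :=
    fun x hx y hy => ⟨_, combo_two_mem hc (hv x hx) (hv y hy) (by linarith) (by linarith),
      (hypVertex_eq x y).symm⟩
  have apex : ∀ x ∈ t.verts, ∀ y ∈ t.verts, ∀ z ∈ t.verts, apexVertex x y z ∈ infl '' t.support :=
    fun x hx y hy z hz => ⟨_, combo_three_mem hc (hv y hy) (hv x hx) (hv z hz) (by linarith)
      (by linarith), (apexVertex_eq x y z).symm⟩
  have acute : ∀ x ∈ t.verts, ∀ y ∈ t.verts, ∀ z ∈ t.verts, acuteVertex x y z ∈ infl '' t.support :=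
    fun x hx y hy z hz => ⟨_, combo_three_mem hc (hv x hx) (hv y hy) (hv z hz) (by linarith)
      (by nlinarith [Real.mul_self_sqrt (show (0 : ℝ) ≤ 2 by norm_num)]),
      (acuteVertex_eq x y z).symm⟩
  have corner : ∀ x ∈ t.verts, infl x ∈ infl '' t.support := fun x hx => ⟨x, hv x hx, rfl⟩
  cases t with
  | tri a b c =>
    simp only [allPts, cornerPts, midPts, sevenPts, fivePts, fourPts, verts, List.map,
      List.cons_append, List.nil_append, List.mem_cons, List.not_mem_nil, or_false] at hz side hyp apex corner
    rcases hz with rfl | rfl | rfl | rfl | rfl | rfl | rfl | rfl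
    · exact corner _ (by simp)
    · exact corner _ (by simp)
    · exact corner _ (by simp)
    · exact side _ (by simp) _ (by simp)
    · exact side _ (by simp) _ (by simp)
    · exact hyp _ (by simp) _ (by simp)
    · exact hyp _ (by simp) _ (by simp)
    · exact apex _ (by simp) _ (by simp) _ (by simp)
  | rhomb p q r s =>
    simp only [allPts, cornerPts, midPts, sevenPts, fivePts, fourPts, verts, List.map,
      List.cons_append, List.nil_append, List.mem_cons, List.not_mem_nil, or_false] at hz side acute corner
    rcases hz with rfl | rfl | rfl | rfl | rfl | rfl | rfl | rfl | rfl | rfl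
    · exact corner _ (by simp)
    · exact corner _ (by simp)
    · exact corner _ (by simp)
    · exact corner _ (by simp)
    · exact side _ (by simp) _ (by simp)
    · exact side _ (by simp) _ (by simp)
    · exact side _ (by simp) _ (by simp)
    · exact side _ (by simp) _ (by simp)
    · exact acute _ (by simp) _ (by simp) _ (by simp)
    · exact acute _ (by simp) _ (by simp) _ (by simp)

theorem Framed.allPts {t : Tile} {K : Model} {p ω u : ℂ} (h : Framed t K p ω u) :
    t.allPts = (K.cornerPts ++ K.midPts ++ K.sevenPts ++ K.fivePts ++ K.fourPts).map
      fun z => infl p + ev ω u z := by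
  rw [Tile.allPts, h.cornerPts, h.midPts, h.sevenPts, h.fivePts, h.fourPts]
  simp

theorem Tile.Valid.subst_verts {t t' : Tile} (h : t.Valid) (ht' : t' ∈ t.subst) {z : ℂ}
    (hz : z ∈ t'.verts) : z ∈ t.allPts := by
  obtain ⟨K, p, ω, u, hf⟩ := h.exists_framed
  obtain ⟨m, hm, rfl⟩ := (hf.subst t').1 ht'
  rw [MTile.verts_toTile, List.mem_map] at hz
  obtain ⟨z, hz, rfl⟩ := hz
  rw [hf.allPts]
  exact List.mem_map_of_mem (models_subst_verts K hf.mem m hm z hz)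

theorem Tile.Valid.subst_valid {t t' : Tile} (h : t.Valid) (ht' : t' ∈ t.subst) : t'.Valid := by
  obtain ⟨K, p, ω, u, hf⟩ := h.exists_framed
  obtain ⟨m, hm, rfl⟩ := (hf.subst t').1 ht'
  exact MTile.valid_toTile hf.eighth hf.norm_u (models_valid K hf.mem m hm)

theorem Tile.Valid.subst_support {t t' : Tile} (h : t.Valid) (ht' : t' ∈ t.subst) :
    t'.support ⊆ infl '' t.support := by
  rw [t'.support_eq]
  refine convexHull_min (fun z hz => t.allPts_mem (h.subst_verts ht' hz)) ?_
  exact t.convex_support.is_linear_image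
    (show IsLinearMap ℝ infl from ⟨fun x y => smul_add _ x y, fun c x => smul_comm _ c x⟩)

/-! ### Separation -/

theorem det_smul_right (d z : ℂ) (c : ℝ) : det d (c • z) = c * det d z := by simp [det]; ring

theorem det_neg_left (d z : ℂ) : det (-d) z = -det d z := by simp [det]; ring

theorem infl_sub (x y : ℂ) : infl x - infl y = (1 + √2) • (x - y) := by
  rw [infl, infl, smul_sub]

/-- Two sets lie on different sides of a line. -/
def Separated (S S' : Set ℂ) : Prop :=
  ∃ a d : ℂ, d ≠ 0 ∧ (∀ z ∈ S, 0 ≤ det d (z - a)) ∧ ∀ z ∈ S', det d (z - a) ≤ 0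

theorem Separated.notMem {S S' : Set ℂ} (h : Separated S S') {z : ℂ} (hz : z ∈ interior S) :
    z ∉ S' := fun hz' => by
  obtain ⟨a, d, hd, h1, h2⟩ := h
  exact absurd (det_pos_of_mem_interior hd h1 hz) (not_lt.2 (h2 z hz'))

theorem Separated.infl {S S' R R' : Set ℂ} (h : Separated S S') (hR : R ⊆ infl '' S)
    (hR' : R' ⊆ infl '' S') : Separated R R' := by
  obtain ⟨a, d, hd, h1, h2⟩ := h
  have hl : 0 < 1 + √2 := by positivity
  refine ⟨AmmannBeenker.infl a, d, hd, fun z hz => ?_, fun z hz => ?_⟩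
  · obtain ⟨w, hw, rfl⟩ := hR hz
    rw [infl_sub, det_smul_right]
    exact mul_nonneg hl.le (h1 w hw)
  · obtain ⟨w, hw, rfl⟩ := hR' hz
    rw [infl_sub, det_smul_right]
    exact mul_nonpos_of_nonneg_of_nonpos hl.le (h2 w hw)

theorem convex_det_nonneg (d a : ℂ) : Convex ℝ {z | 0 ≤ det d (z - a)} := by
  intro z hz w hw x y hx hy hxy
  have : det d (x • z + y • w - a) = x * det d (z - a) + y * det d (w - a) := by
    obtain rfl : y = 1 - x := by linarith
    simp [det]; ring
  change 0 ≤ det d (z - a) at hz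
  change 0 ≤ det d (w - a) at hw
  change 0 ≤ det d (x • z + y • w - a)
  rw [this]
  positivity

theorem Tile.support_det_nonneg {t : Tile} {d a : ℂ} (h : ∀ z ∈ t.verts, 0 ≤ det d (z - a)) :
    ∀ z ∈ t.support, 0 ≤ det d (z - a) := by
  rw [t.support_eq]
  exact fun z hz => convexHull_min (s := {z | z ∈ t.verts}) h (convex_det_nonneg d a) hz

/-- Irrationality of `√2` makes `val` injective, and `ω` is not real. -/
theorem ev_ne_zero {ω u : ℂ} (hω : Eighth ω) (hu : u ≠ 0) {z : Pt} (hz : z ≠ 0) :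
    ev ω u z ≠ 0 := by
  have vz : ∀ x : ℤ√2, val x = 0 → x = 0 := by
    intro x hx
    by_cases hi : x.im = 0
    · unfold val at hx
      rw [hi] at hx
      have : x.re = 0 := by simpa using hx
      exact Zsqrtd.ext this hi
    · exfalso
      have hi' : (x.im : ℝ) ≠ 0 := by exact_mod_cast hi
      refine irrational_sqrt_two ⟨-(x.re : ℚ) / x.im, ?_⟩
      push_cast
      rw [div_eq_iff hi']
      unfold val at hx
      linarith
  intro h
  rw [ev, mul_eq_zero, or_iff_left hu] at h
  have him := congrArg Complex.im h
  simp [hω.im_ne] at him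
  rw [him] at h
  simp at h
  exact hz (Prod.ext (vz _ h) (vz _ him))

theorem Tile.Valid.subst_sep {t t1 t2 : Tile} (h : t.Valid) (h1 : t1 ∈ t.subst) (h2 : t2 ∈ t.subst)
    (hne : t1 ≠ t2) : Separated t1.support t2.support := by
  obtain ⟨K, p, ω, u, hf⟩ := h.exists_framed
  obtain ⟨m1, hm1, rfl⟩ := (hf.subst t1).1 h1
  obtain ⟨m2, hm2, rfl⟩ := (hf.subst t2).1 h2
  obtain ⟨e, -, hxy, hs⟩ := models_sep K hf.mem m1 hm1 m2 hm2 (by rintro rfl; exact hne rfl)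
  have key : ∀ x y : Pt, x ≠ y → MTile.SepBy m1 m2 x y →
      Separated (m1.toTile (infl p) ω u).support (m2.toTile (infl p) ω u).support := by
    intro x y hne ⟨hs1, hs2⟩
    -- Scaling the direction by `ω.im` produces the factor `ω.im ^ 2`, which is nonnegative in a
    -- frame of either orientation.
    have side : ∀ (m : MTile) (d : Pt), (∀ z ∈ m.verts, Nn (d.cr (z - x))) →
        ∀ z ∈ (m.toTile (infl p) ω u).support,
          0 ≤ det (ω.im • ev ω u d) (z - (infl p + ev ω u x)) := by
      intro m d hm
      refine Tile.support_det_nonneg fun z hz => ?_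
      rw [MTile.verts_toTile, List.mem_map] at hz
      obtain ⟨z, hz, rfl⟩ := hz
      rw [add_sub_add_left_eq_sub, ← ev_sub]
      have e : det (ω.im • ev ω u d) (ev ω u (z - x)) =
          ω.im * det (ev ω u d) (ev ω u (z - x)) := by simp [det]; ring
      rw [e, det_ev hf.norm_u]
      have := (hm z hz).val_nonneg
      nlinarith [mul_nonneg this (mul_self_nonneg ω.im)]
    refine ⟨_, _, ?_, side m1 _ hs1, fun z hz => ?_⟩
    · exact smul_ne_zero hf.eighth.im_ne (ev_ne_zero hf.eighth (Eighth.unit_ne_zero hf.norm_u)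
        (sub_ne_zero.2 (Ne.symm hne)))
    · have h4 := side m2 _ hs2 z hz
      rw [← neg_sub y x, ev_neg, smul_neg, det_neg_left] at h4
      linarith
  rcases hs with hs | hs
  · exact key _ _ hxy hs
  · exact key _ _ (Ne.symm hxy) hs

/-! ### Half-planes bounded by edges -/

/-- The closed half-plane bounded by an edge on the side of its normal vector. -/
def OEdge.half (e : OEdge ℂ) : Set ℂ :=
  {z | 0 ≤ det (e.y - e.x) (z - e.x) * det (e.y - e.x) e.n}

theorem det_smul_left (d z : ℂ) (c : ℝ) : det (c • d) z = c * det d z := by simp [det]; ring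

theorem Framed.edges {t : Tile} {K : Model} {p ω u : ℂ} (h : Framed t K p ω u) {e : OEdge ℂ} :
    e ∈ t.edges ↔ ∃ e' ∈ K.tile.edges, e'.toC p ω u = e := by
  rw [h.tile, MTile.edges_toTile, List.mem_map]

theorem Tile.Valid.det_edge_ne {t : Tile} (h : t.Valid) {e : OEdge ℂ} (he : e ∈ t.edges) :
    det (e.y - e.x) e.n ≠ 0 := by
  obtain ⟨K, p, ω, u, hf⟩ := h.exists_framed
  obtain ⟨e', he', rfl⟩ := hf.edges.1 he
  have := (models_edge_half K hf.mem e' he').1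
  simp only [OEdge.toC, add_sub_add_left_eq_sub, ← ev_sub]
  rw [det_ev hf.norm_u]
  refine mul_ne_zero ?_ hf.eighth.im_ne
  simp only [List.mem_cons, List.not_mem_nil, or_false] at this
  rcases this with e | e | e | e <;> rw [e] <;> simp [val]

theorem Tile.Valid.support_subset_half {t : Tile} (h : t.Valid) {e : OEdge ℂ} (he : e ∈ t.edges) :
    t.support ⊆ e.half := by
  obtain ⟨K, p, ω, u, hf⟩ := h.exists_framed
  intro z hz
  have key : ∀ z ∈ t.support, 0 ≤ det (det (e.y - e.x) e.n • (e.y - e.x)) (z - e.x) := by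
    refine Tile.support_det_nonneg fun z hz => ?_
    obtain ⟨e', he', rfl⟩ := hf.edges.1 he
    rw [hf.tile, MTile.verts_toTile, List.mem_map] at hz
    obtain ⟨z, hz, rfl⟩ := hz
    have := ((models_edge_half K hf.mem e' he').2 z hz).val_nonneg
    rw [det_smul_left]
    simp only [OEdge.toC, add_sub_add_left_eq_sub, ← ev_sub]
    rw [det_ev hf.norm_u, det_ev hf.norm_u]
    rw [val_mul] at this
    nlinarith [mul_nonneg this (mul_self_nonneg ω.im)]
  have := key z hz
  rwa [det_smul_left, mul_comm] at this

theorem Tile.Valid.exists_notMem_half {t : Tile} (h : t.Valid) {e : OEdge ℂ} (he : e ∈ t.edges) :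
    ∃ z, z ∉ e.half := by
  -- A step against the normal leads across the edge.
  refine ⟨e.x - e.n, fun hz => ?_⟩
  have hz : 0 ≤ det (e.y - e.x) (e.x - e.n - e.x) * det (e.y - e.x) e.n := hz
  have : det (e.y - e.x) (e.x - e.n - e.x) = -det (e.y - e.x) e.n := by simp [det]; ring
  rw [this] at hz
  have := mul_self_pos.2 (h.det_edge_ne he)
  linarith

/-! ### Subdivision of inflated edges -/

/-- The edge `e` is a part of the inflation of the edge `e'`. -/
def OEdge.Piece (e' e : OEdge ℂ) : Prop :=
  e.n = e'.n ∧
  ((e'.hyp = false ∧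
    ((e.hyp = true ∧ e.x = sideVertex e'.x e'.y ∧ e.y = infl e'.x) ∨
     (e.hyp = false ∧ e.x = sideVertex e'.x e'.y ∧ e.y = infl e'.y))) ∨
  (e'.hyp = true ∧
    ((e.hyp = false ∧ e.x = hypVertex e'.x e'.y ∧ e.y = infl e'.x) ∨
     (e.hyp = true ∧ e.x = hypVertex e'.y e'.x ∧ e.y = hypVertex e'.x e'.y) ∨
     (e.hyp = false ∧ e.x = hypVertex e'.y e'.x ∧ e.y = infl e'.y))))

theorem OEdge.Piece.flip {e' e : OEdge ℂ} (h : e'.Piece e) : e'.flip.Piece e.flip :=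
  ⟨congrArg Neg.neg h.1, h.2⟩

/-- A piece lies on the line of the inflated edge, so the half-plane is merely scaled. The direction
of the piece enters through `(r' - r) ^ 2` only, hence a reversal is harmless. -/
theorem half_aux {e' e : OEdge ℂ} (hn : e.n = e'.n) (r r' : ℝ)
    (hx : e.x = infl e'.x + r • (e'.y - e'.x)) (hy : e.y = infl e'.x + r' • (e'.y - e'.x)) :
    infl '' e'.half ⊆ e.half := by
  rintro _ ⟨z, hz, rfl⟩
  have hz : 0 ≤ det (e'.y - e'.x) (z - e'.x) * det (e'.y - e'.x) e'.n := hz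
  change 0 ≤ det (e.y - e.x) (infl z - e.x) * det (e.y - e.x) e.n
  have e1 : e.y - e.x = (r' - r) • (e'.y - e'.x) := by rw [hx, hy]; module
  have e2 : infl z - e.x = (1 + √2) • (z - e'.x) - r • (e'.y - e'.x) := by
    rw [hx, ← infl_sub]; ring
  have e3 : det (e'.y - e'.x) ((1 + √2) • (z - e'.x) - r • (e'.y - e'.x)) =
      (1 + √2) * det (e'.y - e'.x) (z - e'.x) := by simp [det]; ring
  rw [e1, e2, det_smul_left, det_smul_left, e3, hn]
  have : (r' - r) * ((1 + √2) * det (e'.y - e'.x) (z - e'.x)) *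
      ((r' - r) * det (e'.y - e'.x) e'.n) = (r' - r) ^ 2 * (1 + √2) *
      (det (e'.y - e'.x) (z - e'.x) * det (e'.y - e'.x) e'.n) := by ring
  rw [this]
  positivity

theorem OEdge.Piece.half {e' e : OEdge ℂ} (h : e'.Piece e) : infl '' e'.half ⊆ e.half := by
  obtain ⟨hn, h⟩ := h
  have i1 : infl e'.x = infl e'.x + (0 : ℝ) • (e'.y - e'.x) := by module
  have i2 : infl e'.y = infl e'.x + (1 + √2) • (e'.y - e'.x) := by rw [infl, infl]; module
  have i3 : hypVertex e'.y e'.x = infl e'.x + (1 + √2 - (√2)⁻¹) • (e'.y - e'.x) := by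
    rw [hypVertex, i2]; module
  rcases h with ⟨-, ⟨-, hx, hy⟩ | ⟨-, hx, hy⟩⟩ | ⟨-, ⟨-, hx, hy⟩ | ⟨-, hx, hy⟩ | ⟨-, hx, hy⟩⟩
  · exact half_aux hn _ _ hx (hy.trans i1)
  · exact half_aux hn _ _ hx (hy.trans i2)
  · exact half_aux hn _ _ hx (hy.trans i1)
  · exact half_aux hn _ _ (hx.trans i3) hy
  · exact half_aux hn _ _ (hx.trans i3) (hy.trans i2)

theorem OEdge.MPiece.piece {e' e : OEdge Pt} (h : e'.MPiece e) (p ω u : ℂ) :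
    (e'.toC p ω u).Piece (e.toC (infl p) ω u) := by
  have side : sideVertex (p + ev ω u e'.x) (p + ev ω u e'.y) =
      infl p + ev ω u (e'.x.lam + (e'.y - e'.x).s2) := side_toC p ω u rfl
  refine ⟨congrArg (ev ω u) h.1.symm, ?_⟩
  rcases h.2 with ⟨h1, ⟨h2, hx, hy⟩ | ⟨h2, hx, hy⟩⟩ | ⟨h1, d, -, hd, h3⟩
  · exact Or.inl ⟨h1, Or.inl ⟨h2, by simp only [toC, side, hx], by simp only [toC, infl_ev, hy]⟩⟩
  · exact Or.inl ⟨h1, Or.inr ⟨h2, by simp only [toC, side, hx], by simp only [toC, infl_ev, hy]⟩⟩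
  · have g1 : hypVertex (p + ev ω u e'.x) (p + ev ω u e'.y) = infl p + ev ω u (e'.x.lam + d) :=
      hyp_toC p ω u d hd rfl
    have g2 : hypVertex (p + ev ω u e'.y) (p + ev ω u e'.x) = infl p + ev ω u (e'.y.lam - d) := by
      refine hyp_toC p ω u (-d) ?_ (by rw [sub_eq_add_neg])
      rw [← neg_sub e'.y, ← hd]
      simp [Pt.s2]
    refine Or.inr ⟨h1, ?_⟩
    simp only [toC, g1, g2, infl_ev]
    rcases h3 with ⟨h2, hx, hy⟩ | ⟨h2, hx, hy⟩ | ⟨h2, hx, hy⟩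
    · exact Or.inl ⟨h2, by rw [hx], by rw [hy]⟩
    · exact Or.inr (Or.inl ⟨h2, by rw [hx], by rw [hy]⟩)
    · exact Or.inr (Or.inr ⟨h2, by rw [hx], by rw [hy]⟩)

/-- Every edge of a substituted tile is shared with another of its tiles or lies on its boundary. -/
theorem Tile.Valid.edge_or {t t' : Tile} (h : t.Valid) (ht' : t' ∈ t.subst) {e : OEdge ℂ}
    (he : e ∈ t'.edges) :
    (∃ t'' ∈ t.subst, e.flip ∈ t''.edges) ∨ ∃ e' ∈ t.edges, e'.Piece e := by
  obtain ⟨K, p, ω, u, hf⟩ := h.exists_framed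
  obtain ⟨m, hm, rfl⟩ := (hf.subst t').1 ht'
  rw [MTile.edges_toTile, List.mem_map] at he
  obtain ⟨e, he, rfl⟩ := he
  rcases models_edge_or K hf.mem m hm e he with ⟨m', hm', he'⟩ | ⟨e', he', hp⟩
  · refine Or.inl ⟨_, (hf.subst _).2 ⟨m', hm', rfl⟩, ?_⟩
    rw [MTile.edges_toTile, ← OEdge.toC_flip]
    exact List.mem_map_of_mem he'
  · exact Or.inr ⟨_, hf.edges.2 ⟨e', he', rfl⟩, hp.piece p ω u⟩

/-- Every part of an inflated edge is an edge of a tile of the substituted tile. -/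
theorem Tile.Valid.exists_piece {t : Tile} (h : t.Valid) {e' e : OEdge ℂ} (he' : e' ∈ t.edges)
    (hp : e'.Piece e) : ∃ t' ∈ t.subst, e ∈ t'.edges := by
  obtain ⟨K, p, ω, u, hf⟩ := h.exists_framed
  obtain ⟨e₀, he₀, rfl⟩ := hf.edges.1 he'
  have fin : ∀ e'' : OEdge Pt, e''.toC (infl p) ω u = e → (∃ m ∈ K.subst, e'' ∈ m.edges) →
      ∃ t' ∈ t.subst, e ∈ t'.edges := by
    rintro e'' rfl ⟨m, hm, he⟩
    refine ⟨_, (hf.subst _).2 ⟨m, hm, rfl⟩, ?_⟩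
    rw [MTile.edges_toTile]
    exact List.mem_map_of_mem he
  have side : sideVertex (p + ev ω u e₀.x) (p + ev ω u e₀.y) =
      infl p + ev ω u (e₀.x.lam + (e₀.y - e₀.x).s2) := side_toC p ω u rfl
  obtain ⟨hn, hp⟩ := hp
  rcases hp with ⟨h1, hp⟩ | ⟨h1, hp⟩
  · obtain ⟨m1, m2⟩ := models_edge_leg K hf.mem e₀ he₀ h1
    rcases hp with ⟨h2, hx, hy⟩ | ⟨h2, hx, hy⟩
    · refine fin _ ?_ m1
      ext1
      · exact h2.symm
      · exact (hx.trans side).symm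
      · exact (hy.trans (infl_ev ω u p _)).symm
      · exact hn.symm
    · refine fin _ ?_ m2
      ext1
      · exact h2.symm
      · exact (hx.trans side).symm
      · exact (hy.trans (infl_ev ω u p _)).symm
      · exact hn.symm
  · obtain ⟨d, -, hd, m1, m2, m3⟩ := models_edge_hyp K hf.mem e₀ he₀ h1
    have g1 : hypVertex (p + ev ω u e₀.x) (p + ev ω u e₀.y) = infl p + ev ω u (e₀.x.lam + d) :=
      hyp_toC p ω u d hd rfl
    have g2 : hypVertex (p + ev ω u e₀.y) (p + ev ω u e₀.x) = infl p + ev ω u (e₀.y.lam - d) := by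
      refine hyp_toC p ω u (-d) ?_ (by rw [sub_eq_add_neg])
      rw [← neg_sub e₀.y, ← hd]
      simp [Pt.s2]
    rcases hp with ⟨h2, hx, hy⟩ | ⟨h2, hx, hy⟩ | ⟨h2, hx, hy⟩
    · refine fin _ ?_ m1
      ext1
      · exact h2.symm
      · exact (hx.trans g1).symm
      · exact (hy.trans (infl_ev ω u p _)).symm
      · exact hn.symm
    · refine fin _ ?_ m2
      ext1
      · exact h2.symm
      · exact (hx.trans g2).symm
      · exact (hy.trans g1).symm
      · exact hn.symm
    · refine fin _ ?_ m3
      ext1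
      · exact h2.symm
      · exact (hx.trans g2).symm
      · exact (hy.trans (infl_ev ω u p _)).symm
      · exact hn.symm

/-! ### Patches -/

/-- A set of valid tiles with disjoint interiors, in which every edge is shared by another tile or
lies on the boundary line of a half-plane that contains all tiles. -/
structure Patch (P : Set Tile) : Prop where
  valid : ∀ t ∈ P, t.Valid
  sep : ∀ t ∈ P, ∀ t' ∈ P, t ≠ t' → Separated t.support t'.support
  mate : ∀ t ∈ P, ∀ e ∈ t.edges, (∃ t' ∈ P, e.flip ∈ t'.edges) ∨ ∀ t' ∈ P, t'.support ⊆ e.half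

theorem Patch.singleton {t : Tile} (h : t.Valid) : Patch {t} where
  valid := by rintro _ rfl; exact h
  sep := by rintro _ rfl _ rfl hne; exact absurd rfl hne
  mate := by
    rintro _ rfl e he
    refine Or.inr ?_
    rintro _ rfl
    exact h.support_subset_half he

/-- A piece of an inflated edge inherits the alternative that holds for the edge: a mate across the
edge is cut in the same way and supplies the flipped piece, and a half-plane containing all tiles
inflates to one containing all new tiles. Edges inside a substituted tile are shared anyway. -/
theorem Patch.subst {P : Set Tile} (h : Patch P) : Patch (⋃ t ∈ P, t.subst) where
  valid := by
    intro t ht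
    simp only [Set.mem_iUnion] at ht
    obtain ⟨τ, hτ, ht⟩ := ht
    exact (h.valid τ hτ).subst_valid ht
  sep := by
    intro t ht t' ht' hne
    simp only [Set.mem_iUnion] at ht ht'
    obtain ⟨τ, hτ, ht⟩ := ht
    obtain ⟨τ', hτ', ht'⟩ := ht'
    by_cases e : τ = τ'
    · subst e
      exact (h.valid τ hτ).subst_sep ht ht' hne
    · exact (h.sep τ hτ τ' hτ' e).infl ((h.valid τ hτ).subst_support ht)
        ((h.valid τ' hτ').subst_support ht')
  mate := by
    intro t ht e he
    simp only [Set.mem_iUnion] at ht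
    obtain ⟨τ, hτ, ht⟩ := ht
    rcases (h.valid τ hτ).edge_or ht he with ⟨t', ht', he'⟩ | ⟨e', he', hp⟩
    · exact Or.inl ⟨t', Set.mem_biUnion hτ ht', he'⟩
    · rcases h.mate τ hτ e' he' with ⟨τ', hτ', he''⟩ | hh
      · obtain ⟨t', ht', h3⟩ := (h.valid τ' hτ').exists_piece he'' hp.flip
        exact Or.inl ⟨t', Set.mem_biUnion hτ' ht', h3⟩
      · refine Or.inr fun t' ht' => ?_
        simp only [Set.mem_iUnion] at ht'
        obtain ⟨τ', hτ', ht'⟩ := ht'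
        exact ((h.valid τ' hτ').subst_support ht').trans
          ((Set.image_mono (hh τ' hτ')).trans hp.half)

theorem Tile.Valid.patch {t : Tile} (h : t.Valid) (n : ℕ) : Patch (t.iterSubst n) := by
  induction n with
  | zero => exact Patch.singleton h
  | succ n ih => exact ih.subst

theorem Patch.eq_of_mem {P : Set Tile} (h : Patch P) {t t' : Tile} (ht : t ∈ P) (ht' : t' ∈ P)
    {z : ℂ} (hz : z ∈ interior t.support) (hz' : z ∈ t'.support) : t = t' := by
  by_contra hne
  exact (h.sep t ht t' ht' hne).notMem hz hz'

theorem Patch.eq_of_support_eq {P : Set Tile} (h : Patch P) {t t' : Tile} (ht : t ∈ P)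
    (ht' : t' ∈ P) (e : t.support = t'.support) : t = t' := by
  obtain ⟨z, hz⟩ := (h.valid t ht).interior_nonempty
  exact h.eq_of_mem ht ht' hz (e ▸ interior_subset hz)

/-- The hypotenuse of a triangle, as an oriented edge. -/
def hypEdge (a b c : ℂ) : OEdge ℂ := ⟨true, a, c, (b - a) + (b - c)⟩

theorem hypEdge_mem (a b c : ℂ) : hypEdge a b c ∈ (Tile.tri a b c).edges := by
  simp [Tile.edges, triEdges, hypEdge]

/-- The normal `2 b - a - c` of a hypotenuse determines the apex `b`; reversing it replaces `b` by
`a + c - b`. The direction of the arrow is unaffected. -/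
theorem eq_mirror_of_mem {t : Tile} {a b c : ℂ} (h : (hypEdge a b c).flip ∈ t.edges) :
    t = .tri a (a + c - b) c := by
  cases t with
  | tri a' b' c' =>
    simp [Tile.edges, triEdges, hypEdge, OEdge.flip] at h
    obtain ⟨rfl, rfl, h⟩ := h
    congr 1
    linear_combination -h / 2
  | rhomb => simp [Tile.edges, rhombEdges, hypEdge, OEdge.flip] at h

theorem tri_support_symm (a b c : ℂ) : (Tile.tri a b c).support = (Tile.tri c b a).support := by
  simp only [Tile.support]
  congr 1
  ext; simp; tauto

theorem tri_frame {a b c : ℂ} (h : (Tile.tri a b c).Valid) :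
    ∃ ω u, Eighth ω ∧ ‖u‖ = 1 ∧ b = a + u ∧ c = a + (√2 : ℝ) * ω * u := by
  obtain ⟨K, p, ω, u, hf⟩ := h.exists_framed
  have ht := hf.tile
  have hK := hf.mem
  simp only [models, List.mem_cons, List.not_mem_nil, or_false] at hK
  rcases hK with rfl | rfl
  · simp [Model.triangle, MTile.toTile, ev, val_zero, val_one, val_sqrt] at ht
    obtain ⟨rfl, rfl, rfl⟩ := ht
    exact ⟨ω, u, hf.eighth, hf.norm_u, rfl, rfl⟩
  · simp [Model.rhombus, MTile.toTile] at ht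

/-- Both numbers are roots of one quadratic polynomial, and its roots add up to `√2`. -/
theorem Eighth.eq_or {ω ω' : ℂ} (h : Eighth ω) (h' : Eighth ω') :
    ω' = ω ∨ ω' = (√2 : ℝ) - ω := by
  have h1 : ω ^ 2 = (√2 : ℝ) * ω - 1 := h
  have h2 : ω' ^ 2 = (√2 : ℝ) * ω' - 1 := h'
  have : (ω' - ω) * (ω' - ((√2 : ℝ) - ω)) = 0 := by linear_combination h2 - h1
  rcases mul_eq_zero.1 this with h3 | h3
  · exact Or.inl (sub_eq_zero.1 h3)
  · exact Or.inr (sub_eq_zero.1 h3)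

/-- Two triangles with the same hypotenuse are equal or mirror images of each other. -/
theorem eq_or_mirror {a b c b' : ℂ} (h : (Tile.tri a b c).Valid) (h' : (Tile.tri c b' a).Valid) :
    b' = b ∨ b' = a + c - b := by
  obtain ⟨ω, u, hω, hu, rfl, rfl⟩ := tri_frame h
  obtain ⟨ω', u', hω', hu', rfl, h3⟩ := tri_frame h'
  have hs := sqrt_two_sq
  have hs0 : ((√2 : ℝ) : ℂ) ≠ 0 := fun e => by rw [e] at hs; norm_num at hs
  have e : ω' * u' = -(ω * u) := by
    apply mul_left_cancel₀ hs0
    linear_combination - h3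
  have h2 : ω ^ 2 = (√2 : ℝ) * ω - 1 := hω
  rcases hω.eq_or hω' with rfl | rfl
  · right
    have : u' = -u := mul_left_cancel₀ hω.ne_zero (by linear_combination e)
    rw [this]; ring
  · left
    have : u' = -(ω ^ 2 * u) := mul_left_cancel₀ hω'.ne_zero (by
      linear_combination e - u * ω * h2)
    rw [this]
    linear_combination -u * h2

theorem tri_det_ne {a b c : ℂ} (h : (Tile.tri a b c).Valid) : det (b - a) (c - a) ≠ 0 :=
  (h.isCorner (c := (a, b - a, c - a)) (by simp [Tile.corners, triCorners])).det_ne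

/-- In a patch, no edge carries opposite arrows. -/
theorem Patch.arrows {P : Set Tile} (h : Patch P) {a b c b' : ℂ} (h1 : Tile.tri a b c ∈ P)
    (h2 : Tile.tri c b' a ∈ P) : False := by
  have hd := tri_det_ne (h.valid _ h1)
  have hac : a ≠ c := by
    rintro rfl
    simp [det] at hd
  rcases eq_or_mirror (h.valid _ h1) (h.valid _ h2) with rfl | rfl
  · have := h.eq_of_support_eq h1 h2 (tri_support_symm _ _ _)
    simp [hac] at this
  · rcases h.mate _ h1 _ (hypEdge_mem a b c) with ⟨t, ht, he⟩ | hh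
    · rw [eq_mirror_of_mem he] at ht
      have := h.eq_of_support_eq ht h2 (tri_support_symm _ _ _)
      simp [hac] at this
    -- An unmatched hypotenuse would bound the patch, but the mirrored apex `a + c - b` lies on the
    -- wrong side of it.
    · have := hh _ h2 ((Tile.tri c (a + c - b) a).verts_subset_support
        (show a + c - b ∈ _ by simp [Tile.verts]))
      have this : 0 ≤ det (c - a) (a + c - b - a) * det (c - a) ((b - a) + (b - c)) := this
      have e1 : det (c - a) (a + c - b - a) = det (b - a) (c - a) := by simp [det]; ring
      have e2 : det (c - a) ((b - a) + (b - c)) = -2 * det (b - a) (c - a) := by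
        simp [det]; ring
      rw [e1, e2] at this
      nlinarith [mul_self_pos.2 hd]

/-! ### Tiles and their possible parents recovered from supports -/

/-- A triangle is determined by its support, up to the orientation of its hypotenuse. -/
theorem tri_unique {t : Tile} {a b c : ℂ} (ht : t.Valid) (h : (Tile.tri a b c).Valid)
    (e : t.support = (Tile.tri a b c).support) : t = .tri a b c ∨ t = .tri c b a := by
  have hv : ∀ z, z ∈ t.verts → z = a ∨ z = b ∨ z = c := by
    intro z hz
    have : z ∈ t.support.extremePoints ℝ := ht.extremePoints ▸ hz
    rw [e, h.extremePoints] at this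
    simpa [Tile.verts] using this
  obtain ⟨b1, b2⟩ := sqrt_two_bounds
  obtain ⟨h1, h2, h3⟩ := h
  have h1' := dist_comm a b ▸ h1
  have h2' := dist_comm b c ▸ h2
  have h3' := dist_comm a c ▸ h3
  cases t with
  | tri a' b' c' =>
    obtain ⟨k1, k2, k3⟩ := ht
    simp only [Tile.verts, List.mem_cons, List.not_mem_nil, or_false, forall_eq_or_imp,
      forall_eq] at hv
    obtain ⟨ha, hb, hc⟩ := hv
    have hb' : b' ≠ a' ∧ b' ≠ c' := by
      constructor <;> rintro rfl
      · rw [dist_self] at k1; norm_num at k1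
      · rw [dist_self] at k2; norm_num at k2
    rcases ha with rfl | rfl | rfl <;> rcases hc with rfl | rfl | rfl
    any_goals (exfalso; first | (rw [dist_self] at k3; linarith) | linarith)
    · rcases hb with rfl | rfl | rfl
      · exact absurd rfl hb'.1
      · exact Or.inl rfl
      · exact absurd rfl hb'.2
    · rcases hb with rfl | rfl | rfl
      · exact absurd rfl hb'.2
      · exact Or.inr rfl
      · exact absurd rfl hb'.1
  | rhomb p q r s =>
    exfalso
    obtain ⟨k1, k2, -, k4⟩ := ht
    rw [angle_iff k1 k2] at k4
    have hs : √2 * √2 = 2 := Real.mul_self_sqrt (by norm_num)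
    -- The square of the short diagonal of a rhombus is `2 - √2`, which is no squared distance
    -- between vertices of a triangle.
    have : dist q s = 0 ∨ dist q s = 1 ∨ dist q s = √2 := by
      rcases hv q (by simp [Tile.verts]) with rfl | rfl | rfl <;>
      rcases hv s (by simp [Tile.verts]) with rfl | rfl | rfl <;> simp [*]
    rcases this with e | e | e <;> rw [e] at k4 <;> nlinarith

theorem models_two_verts : ∀ K ∈ models, ∀ m ∈ K.subst, ∃ z ∈ m.verts, ∃ w ∈ m.verts, z ≠ w := by
  decide +kernel

theorem infl_injective : Function.Injective infl := by
  intro z w h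
  exact smul_right_injective ℂ (show (1 + √2 : ℝ) ≠ 0 by positivity) h

theorem finite_eighth : {ω | Eighth ω}.Finite := by
  by_cases h : ∃ ω, Eighth ω
  · obtain ⟨ω, hω⟩ := h
    refine Set.Finite.subset (Set.toFinite {ω, (√2 : ℝ) - ω}) fun ω' hω' => ?_
    exact hω.eq_or hω'
  · rw [not_exists] at h
    exact Set.finite_empty.subset fun ω hω => h ω hω

/-- A tile of the tiling belongs to finitely many substituted tiles. -/
theorem finite_parents (S : Set ℂ) :
    {τ : Tile | τ.Valid ∧ ∃ t ∈ τ.subst, t.support = S}.Finite := by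
  classical
  by_cases hS : ∃ t : Tile, t.Valid ∧ t.support = S
  swap
  · refine Set.finite_empty.subset ?_
    rintro τ ⟨hτ, t, ht, e⟩
    exact hS ⟨t, hτ.subst_valid ht, e⟩
  obtain ⟨t₀, h₀, rfl⟩ := hS
  have hE : {z | z ∈ t₀.verts}.Finite := List.finite_toSet t₀.verts
  have hK : {K | K ∈ models}.Finite := List.finite_toSet models
  have hZ : {z : Pt | ∃ K ∈ models, ∃ m ∈ K.subst, z ∈ m.verts}.Finite := by
    have : {z : Pt | ∃ K ∈ models, ∃ m ∈ K.subst, z ∈ m.verts} =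
        ⋃ K ∈ {K | K ∈ models}, ⋃ m ∈ {m | m ∈ K.subst}, {z | z ∈ m.verts} := by
      ext; simp
    rw [this]
    exact hK.biUnion fun K _ => (List.finite_toSet K.subst).biUnion fun m _ =>
      List.finite_toSet m.verts
  -- Given `ω`, two vertices of the child together with their coordinates determine `u` and then the
  -- base point of the parent. The model, `ω`, the vertices and the coordinates all range over
  -- finite sets.
  let Φ : Model × ℂ × (ℂ × ℂ) × (Pt × Pt) → Tile := fun x =>
    let u := (x.2.2.1.2 - x.2.2.1.1) / ev x.2.1 1 (x.2.2.2.2 - x.2.2.2.1)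
    x.1.tile.toTile ((x.2.2.1.1 - ev x.2.1 u x.2.2.2.1) / ((1 + √2 : ℝ) : ℂ)) x.2.1 u
  refine Set.Finite.subset ((hK.prod (finite_eighth.prod ((hE.prod hE).prod (hZ.prod hZ)))).image Φ)
    ?_
  rintro τ ⟨hτ, t, ht, e⟩
  obtain ⟨K, p, ω, u, hf⟩ := hτ.exists_framed
  have htv := hτ.subst_valid ht
  have hverts : ∀ z ∈ t.verts, z ∈ t₀.verts := by
    intro z hz
    have : z ∈ t.support.extremePoints ℝ := htv.extremePoints ▸ hz
    rwa [e, h₀.extremePoints] at this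
  obtain ⟨m, hm, rfl⟩ := (hf.subst t).1 ht
  obtain ⟨z, hz, w, hw, hzw⟩ := models_two_verts K hf.mem m hm
  refine ⟨(K, ω, (infl p + ev ω u z, infl p + ev ω u w), (z, w)), ⟨hf.mem, hf.eighth,
    ⟨hverts _ ?_, hverts _ ?_⟩, ⟨K, hf.mem, m, hm, hz⟩, ⟨K, hf.mem, m, hm, hw⟩⟩, ?_⟩
  · rw [MTile.verts_toTile]
    exact List.mem_map_of_mem hz
  · rw [MTile.verts_toTile]
    exact List.mem_map_of_mem hw
  · have hne : ev ω 1 (w - z) ≠ 0 := ev_ne_zero hf.eighth one_ne_zero (sub_ne_zero.2 hzw.symm)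
    have hu : (infl p + ev ω u w - (infl p + ev ω u z)) / ev ω 1 (w - z) = u := by
      rw [add_sub_add_left_eq_sub, ← ev_sub, div_eq_iff hne]
      simp [ev]
      ring
    have hl : ((1 + √2 : ℝ) : ℂ) ≠ 0 := by
      have : (1 + √2 : ℝ) ≠ 0 := by positivity
      exact_mod_cast this
    simp only [Φ]
    rw [hu, hf.tile, add_sub_cancel_right, infl, Complex.real_smul, mul_div_cancel_left₀ _ hl]

/-! ### Desubstitution of the whole tiling by compactness -/

/-- `Q` is a set of labelled tiles whose substitution has the tiles of `T` as its supports. -/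
structure Composition (T : Set (Set ℂ)) (Q : Set Tile) : Prop where
  patch : ∀ τ ∈ Q, ∀ τ' ∈ Q, ∃ P, Patch P ∧ τ ∈ P ∧ τ' ∈ P
  tiles : ∀ S, S ∈ T ↔ ∃ τ ∈ Q, ∃ t ∈ τ.subst, t.support = S
  mate : ∀ a b c, Tile.tri a b c ∈ Q → Tile.tri a (a + c - b) c ∈ Q

/-- The mirror image of every triangle of `T` in its hypotenuse belongs to `T`. -/
def Mirror (T : Set (Set ℂ)) : Prop :=
  ∀ a b c, (Tile.tri a b c).Valid → (Tile.tri a b c).support ∈ T →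
    (Tile.tri a (a + c - b) c).support ∈ T

theorem Tile.exists_edge (t : Tile) : ∃ e, e ∈ t.edges := by
  cases t <;> exact ⟨_, List.mem_cons_self⟩

/-- The supertiles containing the various finite subsets of `T` need not be nested, so the limit is
taken along an ultrafilter on the finite subsets. `Q` consists of the parents that are present for
almost all subsets; any two of them occur in a common patch and inherit its properties. -/
theorem IsRhombTriangleTiling.exists_composition {T : Set (Set ℂ)}
    (hT : IsRhombTriangleTiling T) : Mirror T ∧ ∃ Q, Composition T Q := by
  classical
  have hleg : ∀ F : Finset T, ∃ (n : ℕ) (t : Tile), t.Valid ∧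
      (Subtype.val '' (F : Set T)) ⊆ Tile.support '' t.iterSubst n := fun F =>
    hT.legal _ (F.finite_toSet.image _) (by rintro _ ⟨x, -, rfl⟩; exact x.2)
  choose n t ht hsub using hleg
  let 𝒰 : Ultrafilter (Finset T) := Ultrafilter.of atTop
  have h𝒰 : (𝒰 : Filter (Finset T)) ≤ atTop := Ultrafilter.of_le _
  -- The patch one level below. The truncated subtraction matters only for `n F = 0`, which `hn`
  -- excludes for almost all `F`.
  let Q : Finset T → Set Tile := fun F => (t F).iterSubst (n F - 1)
  let P : Finset T → Set Tile := fun F => ⋃ τ ∈ Q F, τ.subst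
  have hQ : ∀ F, Patch (Q F) := fun F => (ht F).patch _
  have hP : ∀ F, Patch (P F) := fun F => (hQ F).subst
  have hmem : ∀ S ∈ T, ∀ᶠ F in (𝒰 : Filter (Finset T)), S ∈ Tile.support '' (t F).iterSubst (n F) := by
    intro S hS
    filter_upwards [h𝒰 (eventually_ge_atTop {(⟨S, hS⟩ : T)})] with F hF
    exact hsub F ⟨⟨S, hS⟩, hF (Finset.mem_singleton_self _), rfl⟩
  have cov : ∀ z : ℂ, ∃ S ∈ T, z ∈ S := fun z => by
    have : z ∈ ⋃₀ T := hT.isTiling.covers ▸ Set.mem_univ z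
    exact this
  -- A level-`0` supertile is a single tile and stays in a half-plane, while `T` covers points
  -- beyond it.
  have hn : ∀ᶠ F in (𝒰 : Filter (Finset T)), 1 ≤ n F := by
    obtain ⟨S, hS, -⟩ := cov 0
    obtain ⟨n', t', ht', hS'⟩ := hT.legal {S} (Set.finite_singleton S) (by simpa using hS)
    obtain ⟨t₁, ht₁, rfl⟩ := hS' rfl
    have hv := (ht'.patch n').valid t₁ ht₁
    obtain ⟨e, he⟩ := t₁.exists_edge
    obtain ⟨z, hz⟩ := hv.exists_notMem_half he
    obtain ⟨S₂, hS₂, hz₂⟩ := cov z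
    filter_upwards [hmem _ hS, hmem _ hS₂] with F h1 h2
    by_contra h0
    obtain h0 : n F = 0 := by omega
    rw [h0] at h1 h2
    simp only [Tile.iterSubst, Set.image_singleton, Set.mem_singleton_iff] at h1 h2
    rw [h2, ← h1] at hz₂
    exact hz (hv.support_subset_half he hz₂)
  have hmem' : ∀ S ∈ T, ∀ᶠ F in (𝒰 : Filter (Finset T)), ∃ t ∈ P F, t.support = S := by
    intro S hS
    filter_upwards [hmem S hS, hn] with F h1 h2
    obtain ⟨k, hk⟩ : ∃ k, n F = k + 1 := ⟨n F - 1, by omega⟩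
    have e : (t F).iterSubst (n F) = P F := by simp only [P, Q, hk]; rfl
    rw [e] at h1
    exact h1
  let L : Set Tile := {τ | ∀ᶠ F in (𝒰 : Filter (Finset T)), τ ∈ Q F}
  have hL : ∀ τ ∈ L, τ.Valid := fun τ hτ =>
    let ⟨F, hF⟩ := Eventually.exists hτ; (hQ F).valid τ hF
  have hLP : ∀ τ ∈ L, ∀ t ∈ τ.subst, ∀ᶠ F in (𝒰 : Filter (Finset T)), t ∈ P F := fun τ hτ t ht =>
    Eventually.mono hτ fun F hF => Set.mem_biUnion hF ht
  -- the limit of the patches consists of tiles of the tiling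
  have hPT : ∀ t, (∀ᶠ F in (𝒰 : Filter (Finset T)), t ∈ P F) → t.support ∈ T := by
    intro t ht
    obtain ⟨F, hF⟩ := Eventually.exists ht
    obtain ⟨z, hz⟩ := ((hP F).valid t hF).interior_nonempty
    obtain ⟨S, hS, hzS⟩ := cov z
    obtain ⟨F', h1, t', h2, rfl⟩ := (ht.and (hmem' S hS)).exists
    rwa [(hP F').eq_of_mem h1 h2 hz hzS]
  have hTL : ∀ S ∈ T, ∃ τ ∈ L, ∃ t ∈ τ.subst, t.support = S := by
    intro S hS
    -- For almost all `F` one of finitely many candidates is the parent of `S`, so the ultrafilter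
    -- selects one of them.
    have h1 : (⋃ τ ∈ {τ : Tile | τ.Valid ∧ ∃ t ∈ τ.subst, t.support = S}, {F | τ ∈ Q F}) ∈ 𝒰 := by
      filter_upwards [hmem' S hS] with F hF
      obtain ⟨t, ht, e⟩ := hF
      simp only [P, Set.mem_iUnion] at ht
      obtain ⟨τ, hτ, ht⟩ := ht
      exact Set.mem_biUnion (show τ ∈ {τ : Tile | τ.Valid ∧ ∃ t ∈ τ.subst, t.support = S} from
        ⟨(hQ F).valid τ hτ, t, ht, e⟩) hτ
    rw [Ultrafilter.finite_biUnion_mem_iff (finite_parents S)] at h1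
    obtain ⟨τ, hτ, h2⟩ := h1
    exact ⟨τ, h2, hτ.2⟩
  -- The alternative to a mate is that almost all patches stay in one fixed half-plane, which fails
  -- because every point of the plane is eventually covered. The argument is used for the parents
  -- and for the tiles themselves.
  have mates : ∀ (R : Finset T → Set Tile), (∀ F, Patch (R F)) →
      (∀ e : OEdge ℂ, (∃ z, z ∉ e.half) →
        ¬ ∀ᶠ F in (𝒰 : Filter (Finset T)), ∀ t ∈ R F, t.support ⊆ e.half) →
      ∀ a b c, (∀ᶠ F in (𝒰 : Filter (Finset T)), Tile.tri a b c ∈ R F) →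
        ∀ᶠ F in (𝒰 : Filter (Finset T)), Tile.tri a (a + c - b) c ∈ R F := by
    intro R hR hbd a b c h
    have h1 : ∀ᶠ F in (𝒰 : Filter (Finset T)), (∃ t' ∈ R F, (hypEdge a b c).flip ∈ t'.edges) ∨
        ∀ t' ∈ R F, t'.support ⊆ (hypEdge a b c).half :=
      h.mono fun F hF => (hR F).mate _ hF _ (hypEdge_mem a b c)
    rcases Ultrafilter.eventually_or.1 h1 with h2 | h2
    · refine h2.mono fun F hF => ?_
      obtain ⟨t', ht', he⟩ := hF
      rwa [← eq_mirror_of_mem he]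
    · obtain ⟨F, hF⟩ := h.exists
      exact absurd h2 (hbd _ (((hR F).valid _ hF).exists_notMem_half (hypEdge_mem a b c)))
  have mateL := mates Q hQ fun e ⟨z, hz⟩ hF => by
    obtain ⟨S, hS, hzS⟩ := cov (infl z)
    obtain ⟨F, h1, t, ht, rfl⟩ := (hF.and (hmem' S hS)).exists
    simp only [P, Set.mem_iUnion] at ht
    obtain ⟨τ, hτ, ht⟩ := ht
    obtain ⟨w, hw, e⟩ := ((hQ F).valid τ hτ).subst_support ht hzS
    exact hz (infl_injective e ▸ h1 τ hτ hw)
  have mateP := mates P hP fun e ⟨z, hz⟩ hF => by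
    obtain ⟨S, hS, hzS⟩ := cov z
    obtain ⟨F, h1, t, ht, rfl⟩ := (hF.and (hmem' S hS)).exists
    exact hz (h1 t ht hzS)
  refine ⟨fun a b c hv hS => ?_, L, fun τ hτ τ' hτ' => ?_, fun S => ⟨hTL S, ?_⟩, mateL⟩
  · obtain ⟨τ, hτ, t, ht, e⟩ := hTL _ hS
    have hF := hLP τ hτ t ht
    -- The support fixes the labels up to reversal of the arrow, and the mirror image has the same
    -- support in both cases.
    rcases tri_unique ((hL τ hτ).subst_valid ht) hv e with rfl | rfl
    · exact hPT _ (mateP _ _ _ hF)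
    · rw [tri_support_symm, add_comm a c]
      exact hPT _ (mateP _ _ _ hF)
  · obtain ⟨F, h1, h2⟩ := (Eventually.and hτ hτ').exists
    exact ⟨Q F, hQ F, h1, h2⟩
  · rintro ⟨τ, hτ, t, ht, rfl⟩
    exact hPT t (hLP τ hτ t ht)

/-! ### Existence of a grouping -/

/-- Closure of `Q` under reflection in hypotenuses pairs its triangles into diamonds. Each diamond
is described by either of its halves; retaining only the positively oriented one prevents two
supertiles from having the same cluster. -/
theorem Composition.exists_grouping {T : Set (Set ℂ)} {Q : Set Tile} (h : Composition T Q) :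
    ∃ 𝒮, IsGrouping T 𝒮 := by
  -- the base tiles of the supertiles belong to `Q`; diamonds are given the positive orientation
  let 𝒮 : Set Supertile := {s | match s with
    | .diamond a b c => Tile.tri a b c ∈ Q ∧ 0 < det (b - a) (c - a)
    | .rhombus p q r s => Tile.rhomb p q r s ∈ Q}
  have hv : ∀ τ ∈ Q, τ.Valid := fun τ hτ =>
    let ⟨P, hP, h1, _⟩ := h.patch τ hτ τ hτ; hP.valid τ h1
  have tiles : ∀ s ∈ 𝒮, ∀ t ∈ s.tiles, ∃ τ ∈ Q, t ∈ τ.subst := by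
    rintro (⟨a, b, c⟩ | ⟨p, q, r, s⟩) hs t ht
    · rcases ht with ht | ht
      · exact ⟨_, hs.1, ht⟩
      · exact ⟨_, h.mate _ _ _ hs.1, ht⟩
    · exact ⟨_, hs, ht⟩
  have detm : ∀ a b c : ℂ, det (a + c - b - a) (c - a) = -det (b - a) (c - a) := by
    intro a b c; simp [det]; ring
  refine ⟨𝒮, ?_, ?_, ?_, ?_⟩
  · rintro (⟨a, b, c⟩ | ⟨p, q, r, s⟩) hs
    · exact hv _ hs.1
    · exact hv _ hs
  · ext S
    simp only [Set.mem_iUnion, h.tiles]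
    constructor
    · rintro ⟨s, hs, t, ht, rfl⟩
      obtain ⟨τ, hτ, ht⟩ := tiles s hs t ht
      exact ⟨τ, hτ, t, ht, rfl⟩
    · rintro ⟨τ, hτ, t, ht, rfl⟩
      cases τ with
      | tri a b c =>
        rcases lt_or_gt_of_ne (tri_det_ne (hv _ hτ)) with hd | hd
        · refine ⟨.diamond a (a + c - b) c, ⟨h.mate _ _ _ hτ, ?_⟩, t, Or.inr ?_, rfl⟩
          · rw [detm]; linarith
          · rwa [sub_sub_cancel]
        · exact ⟨.diamond a b c, ⟨hτ, hd⟩, t, Or.inl ht, rfl⟩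
      | rhomb p q r s => exact ⟨.rhombus p q r s, hτ, t, ht, rfl⟩
  · intro s hs s' hs' hne
    rw [Function.onFun, Set.disjoint_left]
    rintro S ⟨t, ht, rfl⟩ ⟨t', ht', e⟩
    apply hne
    -- Within one patch, equal supports mean equal labelled tiles, and distinct parents have
    -- separated substitutions; so the parent is unique.
    have key : ∀ τ ∈ Q, ∀ τ' ∈ Q, t ∈ τ.subst → t' ∈ τ'.subst → τ = τ' := by
      intro τ hτ τ' hτ' h1 h2
      obtain ⟨P, hP, m1, m2⟩ := h.patch τ hτ τ' hτ'
      have ett : t = t' := hP.subst.eq_of_support_eq (Set.mem_biUnion m1 h1) (Set.mem_biUnion m2 h2)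
        e.symm
      subst ett
      by_contra hne
      obtain ⟨z, hz⟩ := ((hv τ hτ).subst_valid h1).interior_nonempty
      exact ((hP.sep τ m1 τ' m2 hne).infl ((hv τ hτ).subst_support h1)
        ((hv τ' hτ').subst_support h2)).notMem hz (interior_subset hz)
    rcases s with ⟨a, b, c⟩ | ⟨p, q, r, v⟩ <;> rcases s' with ⟨a', b', c'⟩ | ⟨p', q', r', v'⟩
    · have m := h.mate _ _ _ hs.1
      have m' := h.mate _ _ _ hs'.1
      have d := hs.2
      have d' := hs'.2
      rcases ht with ht | ht <;> rcases ht' with ht' | ht'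
      · have := key _ hs.1 _ hs'.1 ht ht'
        simpa using this
      · have := key _ hs.1 _ m' ht ht'
        simp only [Tile.tri.injEq] at this
        obtain ⟨rfl, rfl, rfl⟩ := this
        rw [detm] at d
        linarith
      · have := key _ m _ hs'.1 ht ht'
        simp only [Tile.tri.injEq] at this
        obtain ⟨rfl, rfl, rfl⟩ := this
        rw [detm] at d'
        linarith
      · have := key _ m _ m' ht ht'
        simp only [Tile.tri.injEq] at this
        obtain ⟨rfl, e, rfl⟩ := this
        rw [sub_right_inj] at e
        rw [e]
    · rcases ht with ht | ht
      · exact absurd (key _ hs.1 _ hs' ht ht') (by simp)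
      · exact absurd (key _ (h.mate _ _ _ hs.1) _ hs' ht ht') (by simp)
    · rcases ht' with ht' | ht'
      · exact absurd (key _ hs _ hs'.1 ht ht') (by simp)
      · exact absurd (key _ hs _ (h.mate _ _ _ hs'.1) ht ht') (by simp)
    · have := key _ hs _ hs' ht ht'
      simpa using this
  · intro s hs s' hs' a b b' c h1 h2
    obtain ⟨τ, hτ, h1⟩ := tiles s hs _ h1
    obtain ⟨τ', hτ', h2⟩ := tiles s' hs' _ h2
    obtain ⟨P, hP, m1, m2⟩ := h.patch τ hτ τ' hτ'
    exact hP.subst.arrows (Set.mem_biUnion m1 h1) (Set.mem_biUnion m2 h2)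

/-! ### The tiles around a vertex -/

theorem Eighth.pow_seven {ω : ℂ} (h : Eighth ω) : ω ^ 7 = (√2 : ℝ) - ω := by
  linear_combination ω ^ 3 * h.pow_four - h.pow_three

theorem Eighth.pow_seven_eighth {ω : ℂ} (h : Eighth ω) : Eighth (ω ^ 7) := h.pow_seven ▸ h.conj

theorem omB_not {ω : ℂ} (h : Eighth ω) (b : Bool) : omB ω (!b) = omB ω b ^ 7 := by
  rw [(h.omB b).pow_seven]
  cases b <;> simp [omB]

theorem Framed.midPts_of {t : Tile} {K : Model} {p ω u : ℂ} (h : Framed t K p ω u) {z : Pt}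
    (hz : z ∈ K.midPts) : infl p + ev ω u z ∈ t.midPts := by
  rw [h.midPts]; exact List.mem_map_of_mem hz

theorem Framed.cornerPts_of {t : Tile} {K : Model} {p ω u : ℂ} (h : Framed t K p ω u) {z : Pt}
    (hz : z ∈ K.cornerPts) : infl p + ev ω u z ∈ t.cornerPts := by
  rw [h.cornerPts]; exact List.mem_map_of_mem hz

theorem Framed.sevenPts_of {t : Tile} {K : Model} {p ω u : ℂ} (h : Framed t K p ω u) {z : Pt}
    (hz : z ∈ K.sevenPts) : infl p + ev ω u z ∈ t.sevenPts := by
  rw [h.sevenPts]; exact List.mem_map_of_mem hz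

theorem Framed.fivePts_of {t : Tile} {K : Model} {p ω u : ℂ} (h : Framed t K p ω u) {z : Pt}
    (hz : z ∈ K.fivePts) : infl p + ev ω u z ∈ t.fivePts := by
  rw [h.fivePts]; exact List.mem_map_of_mem hz

theorem Framed.fourPts_of {t : Tile} {K : Model} {p ω u : ℂ} (h : Framed t K p ω u) {z : Pt}
    (hz : z ∈ K.fourPts) : infl p + ev ω u z ∈ t.fourPts := by
  rw [h.fourPts]; exact List.mem_map_of_mem hz

theorem Framed.corners_of {t : Tile} {K : Model} {p ω u : ℂ} (h : Framed t K p ω u)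
    {v d d' : Pt} {p' d₁ d₁' : ℂ} (hv : p' = infl p + ev ω u v) (hd : d₁ = ev ω u d)
    (hd' : d₁' = ev ω u d') (hz : ∃ m ∈ K.subst, (v, d, d') ∈ m.corners) :
    ∃ t' ∈ t.subst, (p', d₁, d₁') ∈ t'.corners := by
  obtain ⟨m, hm, hc⟩ := hz
  refine ⟨_, (h.subst _).2 ⟨m, hm, rfl⟩, ?_⟩
  rw [MTile.corners_toTile, hv, hd, hd']
  exact List.mem_map.2 ⟨(v, d, d'), hc, rfl⟩

theorem models_leg_norm : ∀ K ∈ models, ∀ e ∈ K.tile.edges, e.hyp = false →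
    (e.x - e.y).nsq = 1 := by decide +kernel

theorem models_units_norm : ∀ d ∈ units, d.nsq = 1 := by decide +kernel

theorem Eighth.norm_ev {ω u : ℂ} (hω : Eighth ω) (hu : ‖u‖ = 1) {z : Pt} (hz : z.nsq = 1) :
    ‖ev ω u z‖ = 1 :=
  eq_one_of_sq (by rw [hω.norm_ev_sq hu, hz, val_one]) (norm_nonneg _)

/-- One half of the star of a vertex that divides an inflated edge of length `1 + √2`. -/
theorem Tile.Valid.leg_star {t : Tile} (h : t.Valid) {e : OEdge ℂ} (he : e ∈ t.edges)
    (hl : e.hyp = false) : ‖e.x - e.y‖ = 1 ∧ sideVertex e.x e.y ∈ t.midPts ∧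
    infl e.x ∈ t.cornerPts ∧ infl e.y ∈ t.cornerPts ∧
    ∃ ω, Eighth ω ∧ e.n = √2 • (ω ^ 2 * (e.x - e.y)) ∧
      (sideVertex e.x e.y + ω * (e.x - e.y) ∈ t.sevenPts ∨
        sideVertex e.x e.y + ω * (e.x - e.y) ∈ t.fourPts) ∧
      Tile.tri (sideVertex e.x e.y) (sideVertex e.x e.y + ω * (e.x - e.y)) (infl e.x) ∈ t.subst ∧
      (∃ t' ∈ t.subst, (sideVertex e.x e.y, √2 • (e.x - e.y), ω * (e.x - e.y)) ∈ t'.corners) ∧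
      (∃ t' ∈ t.subst, (sideVertex e.x e.y, ω * (e.x - e.y), ω ^ 4 * (e.x - e.y)) ∈ t'.corners) := by
  obtain ⟨K, p, ω, u, hf⟩ := h.exists_framed
  obtain ⟨e, he', rfl⟩ := hf.edges.1 he
  have hl : e.hyp = false := hl
  obtain ⟨h1, h2, h3, b, h4, h5, h6, h7, h8⟩ := models_leg_star K hf.mem e he' hl
  have hd : (e.toC p ω u).x - (e.toC p ω u).y = ev ω u (e.x - e.y) := by
    simp [OEdge.toC, ev_sub]
  have hm : sideVertex (e.toC p ω u).x (e.toC p ω u).y =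
      infl p + ev ω u (e.x.lam + (e.y - e.x).s2) := side_toC p ω u rfl
  have hx : infl (e.toC p ω u).x = infl p + ev ω u e.x.lam := infl_ev ω u p _
  have hy : infl (e.toC p ω u).y = infl p + ev ω u e.y.lam := infl_ev ω u p _
  rw [hd, hm, hx, hy]
  refine ⟨hf.eighth.norm_ev hf.norm_u (models_leg_norm K hf.mem e he' hl), hf.midPts_of h1,
    hf.cornerPts_of h2, hf.cornerPts_of h3, omB ω b, hf.eighth.omB b, ?_, ?_, ?_, ?_, ?_⟩
  · rw [← hf.eighth.ev_rotN, ← ev_s2, ← h4]; rfl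
  · rw [← hf.eighth.ev_rot, add_assoc, ← ev_add]
    rcases List.mem_append.1 h5 with h5 | h5
    · exact Or.inl (hf.sevenPts_of h5)
    · exact Or.inr (hf.fourPts_of h5)
  · rw [← hf.eighth.ev_rot, add_assoc, ← ev_add]
    exact (hf.subst _).2 ⟨_, h6, rfl⟩
  · exact hf.corners_of rfl (ev_s2 _ _ _).symm (hf.eighth.ev_rot _ _ _).symm h7
  · exact hf.corners_of rfl (hf.eighth.ev_rot _ _ _).symm (hf.eighth.ev_rotN _ _ _ _).symm h8

/-- One half of the stars of the vertices that divide an inflated edge of length `2 + √2`. -/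
theorem Tile.Valid.hyp_star {t : Tile} (h : t.Valid) {e : OEdge ℂ} (he : e ∈ t.edges)
    (hl : e.hyp = true) : infl e.x ∈ t.cornerPts ∧ infl e.y ∈ t.cornerPts ∧
    hypVertex e.x e.y ∈ t.sevenPts ∧ hypVertex e.y e.x ∈ t.fivePts ∧
    ∃ d, √2 • d = e.x - e.y ∧ ‖d‖ = 1 ∧ infl e.x = hypVertex e.x e.y + d ∧
      infl e.y = hypVertex e.y e.x - d ∧
    ∃ ω, Eighth ω ∧ e.n = √2 • (ω ^ 2 * d) ∧
      hypVertex e.x e.y + ω ^ 2 * d ∈ t.midPts ∧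
      hypVertex e.x e.y + ω ^ 3 * d ∈ t.fourPts ∧
      hypVertex e.y e.x + (ω ^ 7) ^ 3 * -d ∈ t.fourPts ∧
      (∃ t' ∈ t.subst, (hypVertex e.x e.y, d, ω ^ 2 * d) ∈ t'.corners) ∧
      (∃ t' ∈ t.subst, (hypVertex e.x e.y, ω ^ 2 * d, ω ^ 3 * d) ∈ t'.corners) ∧
      (∃ t' ∈ t.subst, (hypVertex e.x e.y, ω ^ 3 * d, √2 • (ω ^ 4 * d)) ∈ t'.corners) ∧
      (∃ t' ∈ t.subst, (hypVertex e.y e.x, -d, (ω ^ 7) ^ 3 * -d) ∈ t'.corners) ∧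
      (∃ t' ∈ t.subst, (hypVertex e.y e.x, (ω ^ 7) ^ 3 * -d, √2 • ((ω ^ 7) ^ 4 * -d))
        ∈ t'.corners) := by
  obtain ⟨K, p, ω, u, hf⟩ := h.exists_framed
  obtain ⟨e, he', rfl⟩ := hf.edges.1 he
  have hl : e.hyp = true := hl
  obtain ⟨h1, h2, d, hdu, hd, h3, h4, b, h5, h6, h7, h8, h9, h10, h11, h12, h13⟩ :=
    models_hyp_star K hf.mem e he' hl
  have g1 : hypVertex (e.toC p ω u).x (e.toC p ω u).y = infl p + ev ω u (e.x.lam - d) := by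
    refine hyp_toC p ω u (-d) ?_ (by rw [sub_eq_add_neg])
    rw [← neg_sub e.x, ← hd]
    simp [Pt.s2]
  have g2 : hypVertex (e.toC p ω u).y (e.toC p ω u).x = infl p + ev ω u (e.y.lam + d) :=
    hyp_toC p ω u d hd rfl
  have hx : infl (e.toC p ω u).x = infl p + ev ω u e.x.lam := infl_ev ω u p _
  have hy : infl (e.toC p ω u).y = infl p + ev ω u e.y.lam := infl_ev ω u p _
  have r : ∀ k, ev ω u (Pt.rotN b k d) = omB ω b ^ k * ev ω u d :=
    fun k => hf.eighth.ev_rotN u b k d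
  have r' : ∀ k, ev ω u (Pt.rotN (!b) k (-d)) = (omB ω b ^ 7) ^ k * -ev ω u d := fun k => by
    rw [hf.eighth.ev_rotN u, omB_not hf.eighth, ev_neg]
  rw [g1, g2, hx, hy]
  refine ⟨hf.cornerPts_of h1, hf.cornerPts_of h2, hf.sevenPts_of h3, hf.fivePts_of h4, ev ω u d,
    ?_, hf.eighth.norm_ev hf.norm_u (models_units_norm d hdu), ?_, ?_, omB ω b, hf.eighth.omB b,
    ?_, ?_, ?_, ?_, ?_, ?_, ?_, ?_, ?_⟩
  · rw [← ev_s2, hd, ev_sub]; simp [OEdge.toC]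
  · rw [ev_sub]; ring
  · rw [ev_add]; ring
  · rw [← r, ← ev_s2, ← h5]; rfl
  · rw [← r, add_assoc, ← ev_add]; exact hf.midPts_of h6
  · rw [← r, add_assoc, ← ev_add]; exact hf.fourPts_of h7
  · rw [← r', add_assoc, ← ev_add]; exact hf.fourPts_of h8
  · exact hf.corners_of rfl rfl (r 2).symm h9
  · exact hf.corners_of rfl (r 2).symm (r 3).symm h10
  · exact hf.corners_of rfl (r 3).symm (by rw [ev_s2, r]) h11
  · exact hf.corners_of rfl (ev_neg _ _ _).symm (r' 3).symm h12
  · exact hf.corners_of rfl (r' 3).symm (by rw [ev_s2, r']) h13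

/-- The star of an interior vertex of a substituted tile. -/
theorem Tile.Valid.four_star {t : Tile} (h : t.Valid) {z : ℂ} (hz : z ∈ t.fourPts) :
    ∃ ω u, Eighth ω ∧ ‖u‖ = 1 ∧ ∃ l ∈ [(1, 2, 4, 7), (2, 4, 5, 7), (0, 1, 3, 6)],
      (∀ k ∈ [l.1, l.2.1, l.2.2.1, l.2.2.2], z + ω ^ k * u ∈
        t.cornerPts ++ t.midPts ++ t.sevenPts ++ t.fivePts) ∧
      (∀ k ∈ [(l.1, l.2.1), (l.2.1, l.2.2.1), (l.2.2.1, l.2.2.2), (l.2.2.2, l.1 + 8)],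
        ∃ t' ∈ t.subst, (z, ω ^ k.1 * u, ω ^ k.2 * u) ∈ t'.corners) := by
  obtain ⟨K, p, ω, u, hf⟩ := h.exists_framed
  rw [hf.fourPts, List.mem_map] at hz
  obtain ⟨z, hz, rfl⟩ := hz
  obtain ⟨l, hl, h1, h2⟩ := models_four_star K hf.mem z hz
  have r : ∀ k, ev ω u (Pt.rotN true k (1, 0)) = ω ^ k * u := fun k => by
    rw [hf.eighth.ev_rotN, ev_one]; rfl
  refine ⟨ω, u, hf.eighth, hf.norm_u, l, hl, fun k hk => ?_, fun k hk => ?_⟩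
  · rw [hf.cornerPts, hf.midPts, hf.sevenPts, hf.fivePts, ← List.map_append, ← List.map_append,
      ← List.map_append, ← r, add_assoc, ← ev_add]
    exact List.mem_map_of_mem (h1 k hk)
  · exact hf.corners_of rfl (r _).symm (r _).symm (h2 k hk)

/-- The unit vector `d` is the direction of the edge `e`, from its endpoint `v`. -/
def OEdge.Ray (e : OEdge ℂ) (v d : ℂ) : Prop :=
  (v = e.x ∧ (bif e.hyp then √2 • d else d) = e.y - e.x) ∨
    (v = e.y ∧ (bif e.hyp then √2 • d else d) = e.x - e.y)

theorem OEdge.MRay.ray {e : OEdge Pt} {v d : Pt} (h : e.MRay v d) (p ω u : ℂ) :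
    (e.toC p ω u).Ray (p + ev ω u v) (ev ω u d) := by
  have key : ∀ z w : Pt, (bif e.hyp then d.s2 else d) = z - w →
      (bif e.hyp then √2 • ev ω u d else ev ω u d) = p + ev ω u z - (p + ev ω u w) := by
    intro z w h
    rw [add_sub_add_left_eq_sub, ← ev_sub, ← h]
    cases e.hyp <;> simp [ev_s2]
  rcases h with ⟨rfl, h⟩ | ⟨rfl, h⟩
  · exact Or.inl ⟨rfl, key _ _ h⟩
  · exact Or.inr ⟨rfl, key _ _ h⟩

theorem OEdge.Ray.unique {e : OEdge ℂ} {v d d' : ℂ} (h : e.Ray v d) (h' : e.Ray v d') : d = d' := by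
  have key : (bif e.hyp then √2 • d else d) = (bif e.hyp then √2 • d' else d') := by
    rcases h with ⟨h1, h2⟩ | ⟨h1, h2⟩ <;> rcases h' with ⟨h1', h2'⟩ | ⟨h1', h2'⟩ <;> rw [h2, h2']
    · rw [← h1, ← h1']
    · rw [← h1, ← h1']
  cases he : e.hyp <;> simp [he] at key
  · exact key
  · exact key

/-- The tiles of a substituted tile at one of its corners. -/
theorem Tile.Valid.corner_star {t : Tile} (h : t.Valid) {e : OEdge ℂ} (he : e ∈ t.edges) {v : ℂ}
    (hv : v = e.x ∨ v = e.y) : ∃ d, e.Ray v d ∧ ‖d‖ = 1 ∧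
    ∃ ω, Eighth ω ∧ e.n = √2 • (ω ^ 2 * d) ∧
    ∃ j, 0 < j ∧ (∃ e' ∈ t.edges, e'.Ray v (ω ^ j * d) ∧ e'.n = -(√2 • (ω ^ (j + 2) * d))) ∧
      ∀ i < j, ∃ t' ∈ t.subst, ∃ c c' : ℝ, (c = 1 ∨ c = √2) ∧ (c' = 1 ∨ c' = √2) ∧
        (infl v, c • (ω ^ i * d), c' • (ω ^ (i + 1) * d)) ∈ t'.corners ∧
        infl v + c • (ω ^ i * d) ∈ t.midPts ++ t.sevenPts ++ t.fivePts ++ t.fourPts ∧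
        infl v + c' • (ω ^ (i + 1) * d) ∈
          t.midPts ++ t.sevenPts ++ t.fivePts ++ t.fourPts := by
  obtain ⟨K, p, ω, u, hf⟩ := h.exists_framed
  obtain ⟨e, he', rfl⟩ := hf.edges.1 he
  obtain ⟨w, hw, rfl⟩ : ∃ w ∈ [e.x, e.y], v = p + ev ω u w := by
    rcases hv with rfl | rfl
    · exact ⟨e.x, by simp, rfl⟩
    · exact ⟨e.y, by simp, rfl⟩
  obtain ⟨d, hdu, hr, b, hn, j, hj, ⟨e', he2, hr', hn'⟩, h1⟩ :=
    models_corner_star K hf.mem e he' w hw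
  have r : ∀ k, ev ω u (Pt.rotN b k d) = omB ω b ^ k * ev ω u d :=
    fun k => hf.eighth.ev_rotN u b k d
  refine ⟨ev ω u d, hr.ray p ω u, hf.eighth.norm_ev hf.norm_u (models_units_norm d hdu), omB ω b,
    hf.eighth.omB b, ?_, j, ?_, ⟨_, hf.edges.2 ⟨e', he2, rfl⟩, r j ▸ hr'.ray p ω u, ?_⟩,
    fun i hi => ?_⟩
  · rw [← r, ← ev_s2, ← hn]; rfl
  · simp only [List.mem_cons, List.not_mem_nil, or_false] at hj
    omega
  · rw [← r, ← ev_s2, ← ev_neg, ← hn']; rfl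
  · obtain ⟨m, hm, c, hc, c', hc', h2, h3, h4⟩ := h1 i (List.mem_range.2 hi)
    have hlen : ∀ c ∈ [id, Pt.s2], ∃ x : ℝ, (x = 1 ∨ x = √2) ∧ ∀ z, ev ω u (c z) = x • ev ω u z := by
      intro c hc
      simp only [List.mem_cons, List.not_mem_nil, or_false] at hc
      rcases hc with rfl | rfl
      · exact ⟨1, Or.inl rfl, fun z => by simp⟩
      · exact ⟨√2, Or.inr rfl, fun z => ev_s2 _ _ _⟩
    obtain ⟨x, hx, hxe⟩ := hlen c hc
    obtain ⟨x', hx', hxe'⟩ := hlen c' hc'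
    obtain ⟨t', ht', hct⟩ := hf.corners_of rfl rfl rfl ⟨m, hm, h2⟩
    refine ⟨t', ht', x, x', hx, hx', ?_, ?_, ?_⟩
    · rw [infl_ev, ← r, ← r, ← hxe, ← hxe']
      exact hct
    · rw [hf.fourPts, hf.midPts, hf.sevenPts, hf.fivePts, ← List.map_append, ← List.map_append,
        ← List.map_append, infl_ev, ← r, ← hxe, add_assoc, ← ev_add]
      exact List.mem_map_of_mem h3
    · rw [hf.fourPts, hf.midPts, hf.sevenPts, hf.fivePts, ← List.map_append, ← List.map_append,
        ← List.map_append, infl_ev, ← r, ← hxe', add_assoc, ← ev_add]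
      exact List.mem_map_of_mem h4

/-! ### Matching of supertiles along their sides -/

/-- A set of valid tiles, matching along all edges, whose substitution has the tiles of `T` as its
supports. -/
structure Complete (T : Set (Set ℂ)) (Q : Set Tile) : Prop where
  valid : ∀ τ ∈ Q, τ.Valid
  tiles : ∀ S, S ∈ T ↔ ∃ τ ∈ Q, ∃ t ∈ τ.subst, t.support = S
  mate : ∀ τ ∈ Q, ∀ e ∈ τ.edges, ∃ τ' ∈ Q, e.flip ∈ τ'.edges

/-- The tiles whose substitutions form a supertile. -/
def Supertile.base : Supertile → Set Tile
  | diamond a b c => {.tri a b c, .tri a (a + c - b) c}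
  | rhombus p q r s => {.rhomb p q r s}

theorem Supertile.mem_tiles {s : Supertile} {t : Tile} :
    t ∈ s.tiles ↔ ∃ τ ∈ s.base, t ∈ τ.subst := by
  cases s <;> simp [tiles, base]

theorem mirror_valid {a b c : ℂ} (h : (Tile.tri a b c).Valid) :
    (Tile.tri a (a + c - b) c).Valid := by
  obtain ⟨h1, h2, h3⟩ := h
  refine ⟨?_, ?_, h3⟩
  · rw [dist_eq_norm, show a - (a + c - b) = b - c by ring, ← dist_eq_norm, h2]
  · rw [dist_eq_norm, show a + c - b - c = a - b by ring, ← dist_eq_norm, h1]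

theorem Supertile.Valid.base {s : Supertile} (h : s.Valid) {τ : Tile} (hτ : τ ∈ s.base) :
    τ.Valid := by
  cases s with
  | diamond a b c =>
    rcases hτ with rfl | rfl
    · exact h
    · exact mirror_valid h
  | rhombus p q r s =>
    obtain rfl := hτ
    exact h

theorem Supertile.mirror_mem_base {s : Supertile} {a b c : ℂ} (h : Tile.tri a b c ∈ s.base) :
    Tile.tri a (a + c - b) c ∈ s.base := by
  cases s with
  | diamond a' b' c' =>
    rcases h with h | h
    · simp only [Tile.tri.injEq] at h
      obtain ⟨rfl, rfl, rfl⟩ := h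
      exact Or.inr rfl
    · simp only [Set.mem_singleton_iff, Tile.tri.injEq] at h
      obtain ⟨rfl, rfl, rfl⟩ := h
      exact Or.inl (by rw [sub_sub_cancel])
  | rhombus p q r s => simp [base] at h

theorem models_tri : ∀ K ∈ models, ∀ m ∈ K.subst, ∀ a b c, m = MTile.tri a b c →
    (∃ e ∈ K.tile.edges, e.hyp = false ∧ a = e.x.lam + (e.y - e.x).s2 ∧ c = e.x.lam ∧
      ∃ v : Bool, e.n = (Pt.rotN v 2 (e.x - e.y)).s2 ∧ b = a + (e.x - e.y).rot v) ∨
    (K.sevenPts = [c] ∧ K.fivePts = [a] ∧ K.fourPts = [b]) := by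
  have key : ∀ K ∈ models, ∀ m ∈ K.subst, match m with
    | .tri a b c => (∃ e ∈ K.tile.edges, e.hyp = false ∧ a = e.x.lam + (e.y - e.x).s2 ∧
      c = e.x.lam ∧ (e.n = (Pt.rotN true 2 (e.x - e.y)).s2 ∧ b = a + (e.x - e.y).rot true ∨
        e.n = (Pt.rotN false 2 (e.x - e.y)).s2 ∧ b = a + (e.x - e.y).rot false)) ∨
      (K.sevenPts = [c] ∧ K.fivePts = [a] ∧ K.fourPts = [b])
    | .rhomb _ _ _ _ => True := by
    intro K hK m hm
    simp only [models, List.mem_cons, List.not_mem_nil, or_false] at hK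
    rcases hK with rfl | rfl
    · simp only [Model.triangle, List.mem_cons, List.not_mem_nil, or_false] at hm
      rcases hm with rfl | rfl | rfl | rfl | rfl
      iterate 3 decide +kernel
      all_goals trivial
    · simp only [Model.rhombus, List.mem_cons, List.not_mem_nil, or_false] at hm
      rcases hm with rfl | rfl | rfl | rfl | rfl | rfl | rfl
      iterate 4 decide +kernel
      all_goals trivial
  rintro K hK m hm a b c rfl
  rcases key K hK _ hm with ⟨e, he, h1, h2, h3, h4⟩ | h
  · rcases h4 with h4 | h4
    · exact Or.inl ⟨e, he, h1, h2, h3, true, h4⟩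
    · exact Or.inl ⟨e, he, h1, h2, h3, false, h4⟩
  · exact Or.inr h

/-- The triangles of a substituted tile lie along its sides, except for one in a triangle. -/
theorem Tile.Valid.tri_mem_subst {τ : Tile} (h : τ.Valid) {p q r : ℂ} (hm : Tile.tri p q r ∈ τ.subst) :
    (∃ e ∈ τ.edges, e.hyp = false ∧ p = sideVertex e.x e.y ∧ r = infl e.x ∧
      ∃ ω, Eighth ω ∧ e.n = √2 • (ω ^ 2 * (e.x - e.y)) ∧ q = p + ω * (e.x - e.y)) ∨
    (τ.sevenPts = [r] ∧ τ.fivePts = [p] ∧ τ.fourPts = [q]) := by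
  obtain ⟨K, p₀, ω, u, hf⟩ := h.exists_framed
  obtain ⟨m, hm', e⟩ := (hf.subst _).1 hm
  cases m with
  | rhomb => simp [MTile.toTile] at e
  | tri a b c =>
    simp only [MTile.toTile, Tile.tri.injEq] at e
    obtain ⟨rfl, rfl, rfl⟩ := e
    rcases models_tri K hf.mem _ hm' a b c rfl with ⟨e, he, h1, rfl, rfl, v, h4, rfl⟩ | ⟨h1, h2, h3⟩
    · left
      have hd : (e.toC p₀ ω u).x - (e.toC p₀ ω u).y = ev ω u (e.x - e.y) := by
        simp [OEdge.toC, ev_sub]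
      refine ⟨_, hf.edges.2 ⟨e, he, rfl⟩, h1, (side_toC p₀ ω u rfl).symm, (infl_ev ω u p₀ _).symm,
        omB ω v, hf.eighth.omB v, ?_, ?_⟩
      · rw [hd, ← hf.eighth.ev_rotN, ← ev_s2, ← h4]; rfl
      · rw [hd, ev_add, hf.eighth.ev_rot, add_assoc]
    · right
      rw [hf.sevenPts, hf.fivePts, hf.fourPts, h1, h2, h3]
      simp

/-- `√2 - ω` is the inverse of `ω`, and `ω ^ 4 = -1`. -/
theorem Eighth.conj_sq {ω : ℂ} (h : Eighth ω) : ((√2 : ℝ) - ω) ^ 2 = -ω ^ 2 := by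
  have h' : ω ^ 2 = (√2 : ℝ) * ω - 1 := h
  linear_combination 2 * h' + sqrt_two_sq

/-- The supertiles of a grouping match along their sides. -/
theorem IsGrouping.complete {T : Set (Set ℂ)} (hM : Mirror T) {𝒮 : Set Supertile}
    (h : IsGrouping T 𝒮) : Complete T {τ | ∃ s ∈ 𝒮, τ ∈ s.base} where
  valid := by
    rintro τ ⟨s, hs, hτ⟩
    exact (h.valid s hs).base hτ
  tiles := by
    intro S
    rw [← h.covers]
    simp only [Set.mem_iUnion, Supertile.cluster, Set.mem_image, Supertile.mem_tiles]
    constructor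
    · rintro ⟨s, hs, t, ⟨τ, hτ, ht⟩, rfl⟩
      exact ⟨τ, ⟨s, hs, hτ⟩, t, ht, rfl⟩
    · rintro ⟨τ, ⟨s, hs, hτ⟩, t, ht, rfl⟩
      exact ⟨s, hs, t, ⟨τ, hτ, ht⟩, rfl⟩
  mate := by
    rintro τ ⟨s, hs, hτ⟩ e he
    have hv := (h.valid s hs).base hτ
    cases hl : e.hyp with
    | true =>
      cases τ with
      | tri a b c =>
        refine ⟨_, ⟨s, hs, Supertile.mirror_mem_base hτ⟩, ?_⟩
        simp only [Tile.edges, triEdges, List.mem_cons, List.not_mem_nil, or_false] at he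
        rcases he with rfl | rfl | rfl
        · simp only [Tile.edges, triEdges, OEdge.flip, List.mem_cons, OEdge.mk.injEq, true_and]
          left; ring
        · simp at hl
        · simp at hl
      | rhomb p q r s =>
        simp only [Tile.edges, rhombEdges, List.mem_cons, List.not_mem_nil, or_false] at he
        rcases he with rfl | rfl | rfl | rfl <;> simp at hl
    | false =>
      obtain ⟨hd, -, -, -, ω, hω, hn, -, htri, -, -⟩ := hv.leg_star he hl
      -- The hypotenuse of this triangle is the long part of the inflated edge. The supertile
      -- holding its mirror image is the candidate for the neighbour across the edge.
      set m := sideVertex e.x e.y with hm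
      have ht : Tile.tri m (m + ω * (e.x - e.y)) (infl e.x) ∈ s.tiles :=
        Supertile.mem_tiles.2 ⟨τ, hτ, htri⟩
      have htv := hv.subst_valid htri
      have htT : (Tile.tri m (m + ω * (e.x - e.y)) (infl e.x)).support ∈ T := by
        rw [← h.covers]
        exact Set.mem_biUnion hs ⟨_, ht, rfl⟩
      have hmT := hM _ _ _ htv htT
      rw [← h.covers] at hmT
      simp only [Set.mem_iUnion] at hmT
      obtain ⟨s', hs', t', ht', e'⟩ := hmT
      obtain ⟨τ', hτ', htτ'⟩ := Supertile.mem_tiles.1 ht'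
      have hv' := (h.valid s' hs').base hτ'
      -- The reversed labelling would put opposite arrows on the common hypotenuse.
      rcases tri_unique (hv'.subst_valid htτ') (mirror_valid htv) e' with rfl | rfl
      swap
      · exact absurd ht' (h.arrows s hs s' hs' _ _ _ _ ht)
      have hx : infl e.x = m + √2 • (e.x - e.y) := by
        rw [hm, sideVertex]; module
      have hne : e.x - e.y ≠ 0 := Eighth.unit_ne_zero hd
      -- If the mirror image lies along a side, its hypotenuse fixes both ends of the matching edge
      -- and its apex fixes the side of the normal.
      rcases hv'.tri_mem_subst htτ' with ⟨e₂, he₂, hl₂, hp, hr, ω', hω', hn', hq⟩ | ⟨h7, h5, h4⟩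
      · have ex : e₂.x = e.x := (infl_injective hr).symm
        have ey : e₂.y = e.y := by
          rw [hm, sideVertex, sideVertex, ex] at hp
          have h1 := smul_right_injective ℂ (show √2 ≠ 0 by positivity) (add_left_cancel hp)
          simpa using h1.symm
        refine ⟨τ', ⟨s', hs', hτ'⟩, ?_⟩
        convert he₂ using 1
        rw [ex, ey] at hn' hq
        ext1
        · simp [OEdge.flip, hl, hl₂]
        · exact ex.symm
        · exact ey.symm
        · have hω2 : ω' = (√2 : ℝ) - ω := by
            apply mul_right_cancel₀ hne
            rw [hx, Complex.real_smul] at hq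
            linear_combination -hq
          rw [hn', hω2, hω.conj_sq, OEdge.flip, hn]
          simp
      · -- the mirror image lies inside a diamond, which then is the given supertile
        exfalso
        cases τ' with
        | rhomb => simp [Tile.sevenPts] at h7
        | tri a b c =>
          simp only [Tile.sevenPts, Tile.fivePts, Tile.fourPts, List.cons.injEq, and_true] at h7 h5 h4
          -- The two apexes of a diamond are mirror images in its diagonal, so the original triangle
          -- is the other middle triangle of this same diamond.
          have hap : apexVertex a (a + c - b) c = m + ω * (e.x - e.y) := by
            have : apexVertex a b c + apexVertex a (a + c - b) c = hypVertex a c + hypVertex c a := by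
              simp only [apexVertex, hypVertex, infl]
              module
            rw [h4, h7, h5] at this
            linear_combination this
          have hmem : Tile.tri m (m + ω * (e.x - e.y)) (infl e.x) ∈ s'.tiles := by
            refine Supertile.mem_tiles.2 ⟨_, Supertile.mirror_mem_base hτ', ?_⟩
            rw [← hap, ← h5, ← h7]
            simp [Tile.subst]
          have hss : s = s' := by
            by_contra hne
            exact Set.disjoint_left.1 (h.disjoint hs hs' hne) ⟨_, ht, rfl⟩ ⟨_, hmem, rfl⟩
          subst hss
          have hdet := tri_det_ne hv'
          -- Now `infl e.x` is the point `hypVertex a c` of the inflated diagonal, different from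
          -- its ends, although `e.x` is a vertex of a base triangle of the diamond.
          have hex : e.x = a + (1 - √2 / 2) • (c - a) := by
            apply infl_injective
            rw [← h7, hypVertex_eq]
          have hzero : det (e.x - a) (c - a) = 0 := by
            rw [hex]; simp [det]; ring
          have hcase : e.x = a ∨ e.x = b ∨ e.x = a + c - b := by
            have hb : τ = .tri a b c ∨ τ = .tri a (a + c - b) c := by
              cases s with
              | rhombus => simp [Supertile.base] at hτ'
              | diamond a' b' c' =>
                simp only [Supertile.base, Set.mem_insert_iff, Set.mem_singleton_iff] at hτ hτ'
                rcases hτ' with e | e <;> simp only [Tile.tri.injEq] at e <;>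
                  obtain ⟨rfl, rfl, rfl⟩ := e
                · exact hτ
                · rw [sub_sub_cancel]; exact hτ.symm
            rcases hb with rfl | rfl <;>
            · simp only [Tile.edges, triEdges, List.mem_cons, List.not_mem_nil, or_false] at he
              rcases he with rfl | rfl | rfl <;> simp
          rcases hcase with e | e | e
          · rw [e] at hex
            have : (1 - √2 / 2) • (c - a) = 0 := by
              rw [← add_eq_left (a := a), ← hex]
            rcases smul_eq_zero.1 this with h1 | h1
            · have := sqrt_two_bounds.2
              linarith
            · rw [h1] at hdet
              simp [det] at hdet
          · rw [e] at hzero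
            exact hdet hzero
          · rw [e] at hzero
            apply hdet
            have : det (a + c - b - a) (c - a) = -det (b - a) (c - a) := by simp [det]; ring
            linarith

/-! ### Complete stars at the five kinds of vertices -/

/-- The points that a function assigns to the tiles of a set. -/
def ptsOf (f : Tile → List ℂ) (Q : Set Tile) : Set ℂ := {z | ∃ τ ∈ Q, z ∈ f τ}

/-- The lengths `√2` and `1` of the edges in a star. -/
def len (b : ℕ → Bool) (k : ℕ) : ℝ := bif b k then √2 else 1

theorem len_eq_or (b : ℕ → Bool) (k : ℕ) : len b k = 1 ∨ len b k = √2 := by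
  unfold len
  cases b k
  · exact Or.inl rfl
  · exact Or.inr rfl

theorem one_ne_sqrt_two : (1 : ℝ) ≠ √2 := sqrt_two_bounds.1.ne

/-- The exponents of the directions in a star. -/
def exponents (P : List (ℕ × ℕ)) : Finset ℕ := (P.map fun a => a.1 % 8).toFinset

theorem ListStar.degree_sum {T : Set (Set ℂ)} {p u ω : ℂ} {P : List (ℕ × ℕ)} {b : ℕ → Bool}
    (h : ListStar T p u ω P (len b)) (hT : IsTiling T) (hs : AllStars T)
    (hp : p ∈ tilingVertices T) :
    ((tilingGraph T).neighborSet ⟨p, hp⟩).Finite ∧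
    ((tilingGraph T).neighborSet ⟨p, hp⟩).ncard = (exponents P).card ∧
    weightedDegree (tilingGraph T) (lengthWeight T) ⟨p, hp⟩ =
      ∑ k ∈ exponents P, bif b k then 2 else 1 := by
  have hK : ∀ k, k ∈ exponents P ↔ ∃ a ∈ P, a.1 % 8 = k := fun k => by
    rw [exponents, List.mem_toFinset, List.mem_map]
  have := degree_and_sum h.eighth h.norm_u h.length (K := exponents P)
    (fun k hk => by obtain ⟨a, -, rfl⟩ := (hK k).1 hk; omega) hp (fun k hk => by
      obtain ⟨a, ha, rfl⟩ := (hK k).1 hk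
      rw [h.eighth.pow_mod]
      exact (h.wedge a ha).left_mem_vertices) (fun q => by
      rw [h.adj_iff hT hs hp]
      constructor
      · rintro ⟨a, ha, e⟩
        exact ⟨_, (hK _).2 ⟨a, ha, rfl⟩, e⟩
      · rintro ⟨k, hk, e⟩
        obtain ⟨a, ha, rfl⟩ := (hK k).1 hk
        exact ⟨a, ha, e⟩)
  refine ⟨this.1, this.2.1, this.2.2.trans (Finset.sum_congr rfl fun k _ => ?_)⟩
  unfold len
  cases b k
  · simp [one_ne_sqrt_two]
  · simp

theorem ListStar.mem_vertices {T : Set (Set ℂ)} {p u ω : ℂ} {P : List (ℕ × ℕ)} {c : ℕ → ℝ}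
    (h : ListStar T p u ω P c) : p ∈ tilingVertices T := by
  obtain ⟨S, v, w, hS, -⟩ := h.exists_star
  exact mem_tilingVertices.2 ⟨S 0, hS.mem 0 (by norm_num), (hS.corner 0 (by norm_num)).extreme⟩

theorem Eighth.pow_seven_pow {ω : ℂ} (h : Eighth ω) (k : ℕ) : (ω ^ 7) ^ k = ω ^ (7 * k % 8) := by
  rw [← pow_mul, h.pow_mod]

/-- The candidates for `ω'` are `ω` and its inverse. Their squares are opposite, so the normal tells
them apart. -/
theorem Eighth.eq_of_normal {ω ω' d : ℂ} (h : Eighth ω) (h' : Eighth ω') (hd : d ≠ 0)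
    (e : √2 • (ω' ^ 2 * d) = √2 • (ω ^ 2 * d)) : ω' = ω := by
  have e1 := mul_right_cancel₀ hd (smul_right_injective ℂ (show √2 ≠ 0 by positivity) e)
  rcases h.eq_or h' with e2 | e2
  · exact e2
  · exfalso
    rw [e2, h.conj_sq] at e1
    exact pow_ne_zero 2 h.ne_zero (by linear_combination -e1 / 2)

/-- Seen from across an edge the frame is reflected, and `ω` becomes its inverse `ω ^ 7`. In this
way the stars on an edge are assembled from two halves. -/
theorem Eighth.eq_pow_seven {ω ω' d : ℂ} (h : Eighth ω) (h' : Eighth ω') (hd : d ≠ 0)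
    (e : √2 • (ω' ^ 2 * d) = -(√2 • (ω ^ 2 * d))) : ω' = ω ^ 7 := by
  refine h.pow_seven_eighth.eq_of_normal h' hd ?_
  rw [e, h.pow_seven, h.conj_sq, neg_mul, smul_neg]

namespace Complete

variable {T : Set (Set ℂ)} {Q : Set Tile}

theorem wedge (h : Complete T Q) {τ : Tile} (hτ : τ ∈ Q) {p v w : ℂ}
    (hc : ∃ t ∈ τ.subst, (p, v, w) ∈ t.corners) : Wedge T p v w := by
  obtain ⟨t, ht, hc⟩ := hc
  exact ⟨t.support, (h.tiles _).2 ⟨τ, hτ, t, ht, rfl⟩, ((h.valid τ hτ).subst_valid ht).isCorner hc⟩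

/-- The star of a vertex that divides an inflated edge of length `1 + √2`. -/
theorem mid_star (h : Complete T Q) {z : ℂ} (hz : z ∈ ptsOf Tile.midPts Q) :
    ∃ u ω, ListStar T z u ω [(0, 1), (1, 4), (4, 7), (7, 8)] (len (· == 0)) ∧
      z + √2 • u ∈ ptsOf Tile.cornerPts Q ∧ z + ω ^ 4 * u ∈ ptsOf Tile.cornerPts Q ∧
      (z + ω * u ∈ ptsOf Tile.sevenPts Q ∨ z + ω * u ∈ ptsOf Tile.fourPts Q) ∧
      (z + ω ^ 7 * u ∈ ptsOf Tile.sevenPts Q ∨ z + ω ^ 7 * u ∈ ptsOf Tile.fourPts Q) := by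
  obtain ⟨τ, hτ, hz⟩ := hz
  obtain ⟨e, he, hl, rfl⟩ : ∃ e ∈ τ.edges, e.hyp = false ∧ z = sideVertex e.x e.y := by
    cases τ with
    | tri a b c =>
      simp only [Tile.midPts, List.mem_cons, List.not_mem_nil, or_false] at hz
      rcases hz with rfl | rfl <;> simp [Tile.edges, triEdges]
    | rhomb p q r s =>
      simp only [Tile.midPts, List.mem_cons, List.not_mem_nil, or_false] at hz
      rcases hz with rfl | rfl | rfl | rfl <;> simp [Tile.edges, rhombEdges]
  obtain ⟨hd, -, hx, hy, ω, hω, hn, h1, -, h2, h3⟩ := (h.valid τ hτ).leg_star he hl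
  obtain ⟨τ', hτ', he'⟩ := h.mate τ hτ e he
  obtain ⟨-, -, -, -, ω', hω', hn', h1', -, h2', h3'⟩ := (h.valid τ' hτ').leg_star he' hl
  simp only [OEdge.flip] at hn' h1' h2' h3'
  obtain rfl : ω' = ω ^ 7 :=
    hω.eq_pow_seven hω' (Eighth.unit_ne_zero hd) (by rw [← hn', hn])
  rw [hω.pow_seven_pow] at h3'
  have w1 := h.wedge hτ h2
  have w2 := h.wedge hτ h3
  have w3 := (h.wedge hτ' h3').symm
  have w4 := (h.wedge hτ' h2').symm
  refine ⟨e.x - e.y, ω, ⟨hω, hd, by decide, len_eq_or _, ?_⟩, ⟨τ, hτ, ?_⟩, ⟨τ, hτ, ?_⟩, ?_, ?_⟩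
  · simp only [List.mem_cons, List.not_mem_nil, or_false]
    rintro a (rfl | rfl | rfl | rfl)
    · simpa [len] using w1
    · simpa [len] using w2
    · simpa [len] using w3
    · simpa [len, hω.pow_eight] using w4
  · convert hx using 1
    rw [sideVertex]; module
  · convert hy using 1
    rw [sideVertex, hω.pow_four, neg_one_mul, infl, infl]
    module
  · exact h1.imp (fun h => ⟨τ, hτ, h⟩) fun h => ⟨τ, hτ, h⟩
  · exact h1'.imp (fun h => ⟨τ', hτ', h⟩) fun h => ⟨τ', hτ', h⟩

/-- The stars of the two vertices that divide an inflated edge of length `2 + √2`. -/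
theorem hyp_star (h : Complete T Q) {τ : Tile} (hτ : τ ∈ Q) {e : OEdge ℂ} (he : e ∈ τ.edges)
    (hl : e.hyp = true) : ∃ u ω,
    (ListStar T (hypVertex e.x e.y) u ω [(0, 2), (2, 3), (3, 4), (4, 5), (5, 6), (6, 8)]
        (len (· == 4)) ∧
      hypVertex e.x e.y + u ∈ ptsOf Tile.cornerPts Q ∧
      (∀ k ∈ [2, 6], hypVertex e.x e.y + ω ^ k * u ∈ ptsOf Tile.midPts Q) ∧
      (∀ k ∈ [3, 5], hypVertex e.x e.y + ω ^ k * u ∈ ptsOf Tile.fourPts Q) ∧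
      hypVertex e.x e.y + √2 • (ω ^ 4 * u) ∈ ptsOf Tile.fivePts Q) ∧
    (ListStar T (hypVertex e.y e.x) (-u) (ω ^ 7) [(0, 3), (3, 4), (4, 5), (5, 8)]
        (len (· == 4)) ∧
      hypVertex e.y e.x + -u ∈ ptsOf Tile.cornerPts Q ∧
      (∀ k ∈ [3, 5], hypVertex e.y e.x + (ω ^ 7) ^ k * -u ∈ ptsOf Tile.fourPts Q) ∧
      hypVertex e.y e.x + √2 • ((ω ^ 7) ^ 4 * -u) ∈ ptsOf Tile.sevenPts Q) := by
  obtain ⟨hx, hy, h7, h5, d, hd, hd1, ex, ey, ω, hω, hn, m1, m2, m3, c1, c2, c3, c4, c5⟩ :=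
    (h.valid τ hτ).hyp_star he hl
  obtain ⟨τ', hτ', he'⟩ := h.mate τ hτ e he
  obtain ⟨-, -, -, -, d', hd', -, -, -, ω', hω', hn', m1', m2', m3', c1', c2', c3', c4', c5'⟩ :=
    (h.valid τ' hτ').hyp_star he' hl
  simp only [OEdge.flip] at hd' hn' m1' m2' m3' c1' c2' c3' c4' c5'
  obtain rfl : d' = d := smul_right_injective ℂ (show √2 ≠ 0 by positivity) (hd'.trans hd.symm)
  obtain rfl : ω' = ω ^ 7 :=
    hω.eq_pow_seven hω' (Eighth.unit_ne_zero hd1) (by rw [← hn', hn])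
  have hω7 := hω.pow_seven_eighth
  have s4 : √2 • (ω ^ 4 * d') = e.y - e.x := by
    rw [hω.pow_four, neg_one_mul, smul_neg, hd, neg_sub]
  -- Of the inflated length `2 + √2` the two end pieces take `1` each, which leaves exactly the
  -- vector `e.y - e.x` of length `√2`.
  have e75 : hypVertex e.x e.y + (e.y - e.x) = hypVertex e.y e.x := by
    have hx' : e.x = e.y + √2 • d' := by rw [hd, add_sub_cancel]
    have h1 : hypVertex e.x e.y = infl e.x - d' := eq_sub_of_add_eq ex.symm
    have h2 : hypVertex e.y e.x = infl e.y + d' := (sub_eq_iff_eq_add.1 ey.symm)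
    rw [h1, h2, infl, infl, hx']
    simp only [Complex.real_smul]
    push_cast
    linear_combination d' * sqrt_two_sq
  refine ⟨d', ω, ⟨⟨hω, hd1, by decide, len_eq_or _, ?_⟩, ⟨τ, hτ, ex ▸ hx⟩, ?_, ?_, ⟨τ, hτ, ?_⟩⟩,
    ⟨hω7, by rwa [norm_neg], by decide, len_eq_or _, ?_⟩, ⟨τ, hτ, ?_⟩, ?_, ⟨τ, hτ, ?_⟩⟩
  · have w1 := h.wedge hτ c1
    have w2 := h.wedge hτ c2
    have w3 := h.wedge hτ c3
    have w4 := (h.wedge hτ' c3').symm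
    have w5 := (h.wedge hτ' c2').symm
    have w6 := (h.wedge hτ' c1').symm
    rw [hω.pow_seven_pow, hω.pow_seven_pow] at w4 w5
    rw [hω.pow_seven_pow] at w6
    simp only [List.mem_cons, List.not_mem_nil, or_false]
    rintro a (rfl | rfl | rfl | rfl | rfl | rfl)
    · simpa [len] using w1
    · simpa [len] using w2
    · simpa [len] using w3
    · simpa [len] using w4
    · simpa [len] using w5
    · simpa [len, hω.pow_eight] using w6
  · simp only [List.mem_cons, List.not_mem_nil, or_false]
    rintro k (rfl | rfl)
    · exact ⟨τ, hτ, m1⟩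
    · rw [hω.pow_seven_pow] at m1'
      exact ⟨τ', hτ', m1'⟩
  · simp only [List.mem_cons, List.not_mem_nil, or_false]
    rintro k (rfl | rfl)
    · exact ⟨τ, hτ, m2⟩
    · rw [hω.pow_seven_pow] at m2'
      exact ⟨τ', hτ', m2'⟩
  · rwa [s4, e75]
  · have w1 := h.wedge hτ c4
    have w2 := h.wedge hτ c5
    have w3 := (h.wedge hτ' c5').symm
    have w4 := (h.wedge hτ' c4').symm
    rw [hω7.pow_seven_pow, hω7.pow_seven_pow] at w3
    rw [hω7.pow_seven_pow] at w4
    simp only [List.mem_cons, List.not_mem_nil, or_false]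
    rintro a (rfl | rfl | rfl | rfl)
    · simpa [len] using w1
    · simpa [len] using w2
    · simpa [len] using w3
    · simpa [len, hω7.pow_eight] using w4
  · rw [← sub_eq_add_neg, ← ey]
    exact hy
  · simp only [List.mem_cons, List.not_mem_nil, or_false]
    rintro k (rfl | rfl)
    · exact ⟨τ, hτ, m3⟩
    · rw [hω7.pow_seven_pow] at m3'
      exact ⟨τ', hτ', m3'⟩
  · rw [hω7.pow_four, neg_one_mul, neg_neg, hd, ← neg_sub e.y, ← e75, add_neg_cancel_right]
    exact h7

theorem exists_hyp_edge {τ : Tile} {z : ℂ} (hz : z ∈ τ.sevenPts ∨ z ∈ τ.fivePts) :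
    ∃ e ∈ τ.edges, e.hyp = true ∧ (z ∈ τ.sevenPts → z = hypVertex e.x e.y) ∧
      (z ∈ τ.fivePts → z = hypVertex e.y e.x) := by
  cases τ with
  | tri a b c => exact ⟨_, hypEdge_mem a b c, rfl, by simp [Tile.sevenPts, hypEdge],
      by simp [Tile.fivePts, hypEdge]⟩
  | rhomb p q r s => simp [Tile.sevenPts, Tile.fivePts] at hz

theorem seven_star (h : Complete T Q) {z : ℂ} (hz : z ∈ ptsOf Tile.sevenPts Q) : ∃ u ω,
    ListStar T z u ω [(0, 2), (2, 3), (3, 4), (4, 5), (5, 6), (6, 8)] (len (· == 4)) ∧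
      z + u ∈ ptsOf Tile.cornerPts Q ∧ (∀ k ∈ [2, 6], z + ω ^ k * u ∈ ptsOf Tile.midPts Q) ∧
      (∀ k ∈ [3, 5], z + ω ^ k * u ∈ ptsOf Tile.fourPts Q) ∧
      z + √2 • (ω ^ 4 * u) ∈ ptsOf Tile.fivePts Q := by
  obtain ⟨τ, hτ, hz⟩ := hz
  obtain ⟨e, he, hl, h1, -⟩ := exists_hyp_edge (Or.inl hz)
  obtain ⟨u, ω, h2, -⟩ := h.hyp_star hτ he hl
  exact ⟨u, ω, h1 hz ▸ h2⟩

theorem five_star (h : Complete T Q) {z : ℂ} (hz : z ∈ ptsOf Tile.fivePts Q) : ∃ u ω,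
    ListStar T z u ω [(0, 3), (3, 4), (4, 5), (5, 8)] (len (· == 4)) ∧
      z + u ∈ ptsOf Tile.cornerPts Q ∧ (∀ k ∈ [3, 5], z + ω ^ k * u ∈ ptsOf Tile.fourPts Q) ∧
      z + √2 • (ω ^ 4 * u) ∈ ptsOf Tile.sevenPts Q := by
  obtain ⟨τ, hτ, hz⟩ := hz
  obtain ⟨e, he, hl, -, h1⟩ := exists_hyp_edge (Or.inr hz)
  obtain ⟨u, ω, -, h2⟩ := h.hyp_star hτ he hl
  exact ⟨-u, ω ^ 7, h1 hz ▸ h2⟩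

theorem four_star (h : Complete T Q) {z : ℂ} (hz : z ∈ ptsOf Tile.fourPts Q) :
    ∃ u ω, ∃ l ∈ [(1, 2, 4, 7), (2, 4, 5, 7), (0, 1, 3, 6)],
      ListStar T z u ω
        [(l.1, l.2.1), (l.2.1, l.2.2.1), (l.2.2.1, l.2.2.2), (l.2.2.2, l.1 + 8)]
        (len fun _ => false) ∧
      ∀ k ∈ [l.1, l.2.1, l.2.2.1, l.2.2.2], z + ω ^ k * u ∈ ptsOf Tile.cornerPts Q ∨
        z + ω ^ k * u ∈ ptsOf Tile.midPts Q ∨ z + ω ^ k * u ∈ ptsOf Tile.sevenPts Q ∨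
        z + ω ^ k * u ∈ ptsOf Tile.fivePts Q := by
  obtain ⟨τ, hτ, hz⟩ := hz
  obtain ⟨ω, u, hω, hu, l, hl, h1, h2⟩ := (h.valid τ hτ).four_star hz
  refine ⟨u, ω, l, hl, ⟨hω, hu, ?_, len_eq_or _, fun a ha => ?_⟩, fun k hk => ?_⟩
  · simp only [List.mem_cons, List.not_mem_nil, or_false] at hl
    rcases hl with rfl | rfl | rfl <;> decide
  · simpa [len] using h.wedge hτ (h2 a ha)
  · have := h1 k hk
    simp only [List.mem_append, or_assoc] at this
    exact this.imp (fun h => ⟨τ, hτ, h⟩) (Or.imp (fun h => ⟨τ, hτ, h⟩)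
      (Or.imp (fun h => ⟨τ, hτ, h⟩) fun h => ⟨τ, hτ, h⟩))

/-- Vertices of the substituted tiles that are not at the corners. -/
def Inner (Q : Set Tile) (z : ℂ) : Prop :=
  z ∈ ptsOf Tile.midPts Q ∨ z ∈ ptsOf Tile.sevenPts Q ∨ z ∈ ptsOf Tile.fivePts Q ∨
    z ∈ ptsOf Tile.fourPts Q

/-- All sectors at a corner are filled by tiles with an angle of `π / 4`. -/
theorem corner_sectors (h : Complete T Q) {z : ℂ} (hz : z ∈ ptsOf Tile.cornerPts Q) :
    ∃ d ω, ‖d‖ = 1 ∧ Eighth ω ∧ ∀ k : ℕ, ∃ c c' : ℝ, (c = 1 ∨ c = √2) ∧ (c' = 1 ∨ c' = √2) ∧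
      Wedge T z (c • (ω ^ k * d)) (c' • (ω ^ (k + 1) * d)) ∧ Inner Q (z + c • (ω ^ k * d)) ∧
      Inner Q (z + c' • (ω ^ (k + 1) * d)) := by
  obtain ⟨τ, hτ, hz⟩ := hz
  obtain ⟨v, hv, rfl⟩ := List.mem_map.1 hz
  obtain ⟨e, he, hve⟩ : ∃ e ∈ τ.edges, v = e.x ∨ v = e.y := by
    cases τ with
    | tri a b c =>
      simp only [Tile.verts, List.mem_cons, List.not_mem_nil, or_false] at hv
      rcases hv with rfl | rfl | rfl <;> simp [Tile.edges, triEdges]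
    | rhomb p q r s =>
      simp only [Tile.verts, List.mem_cons, List.not_mem_nil, or_false] at hv
      rcases hv with rfl | rfl | rfl | rfl <;> simp [Tile.edges, rhombEdges]
  obtain ⟨d, hr, hd, ω, hω, hn, -⟩ := (h.valid τ hτ).corner_star he hve
  refine ⟨d, ω, hd, hω, ?_⟩
  -- an edge at the corner in direction `ω ^ i * d`, with a tile on its positive side
  let A : ℕ → Prop := fun i => ∃ τ ∈ Q, ∃ e ∈ τ.edges, e.Ray v (ω ^ i * d) ∧
    e.n = √2 • (ω ^ (i + 2) * d)
  let B : ℕ → Prop := fun k => ∃ c c' : ℝ, (c = 1 ∨ c = √2) ∧ (c' = 1 ∨ c' = √2) ∧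
    Wedge T (infl v) (c • (ω ^ k * d)) (c' • (ω ^ (k + 1) * d)) ∧
    Inner Q (infl v + c • (ω ^ k * d)) ∧ Inner Q (infl v + c' • (ω ^ (k + 1) * d))
  -- A base tile whose angle spans `j` sectors is cut into one tile per sector; its mate along the
  -- last side continues the walk around the corner.
  have step : ∀ i, A i → ∃ j > 0, A (i + j) ∧ ∀ k, i ≤ k → k < i + j → B k := by
    rintro i ⟨τ, hτ, e, he, hr, hn⟩
    obtain ⟨d', hr', hd', ω', hω', hn', j, hj, ⟨e', he', hr2, hn2⟩, h1⟩ :=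
      (h.valid τ hτ).corner_star he (hr.imp And.left And.left)
    obtain rfl := hr'.unique hr
    obtain rfl : ω' = ω := hω.eq_of_normal hω' (Eighth.unit_ne_zero hd') (by
      rw [← hn', hn, pow_add]; congr 1; ring)
    have hp : ∀ k, ω' ^ k * (ω' ^ i * d) = ω' ^ (i + k) * d := fun k => by rw [pow_add]; ring
    obtain ⟨τ', hτ', he2⟩ := h.mate τ hτ e' he'
    refine ⟨j, hj, ⟨τ', hτ', e'.flip, he2, hp j ▸ hr2, ?_⟩, fun k hik hkj => ?_⟩
    · rw [OEdge.flip, hn2, neg_neg, hp, add_assoc]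
    · obtain ⟨t, ht, c, c', hc, hc', hct, m1, m2⟩ := h1 (k - i) (by omega)
      rw [hp, hp, show i + (k - i) = k by omega, show i + (k - i + 1) = k + 1 by omega] at hct
      rw [hp, show i + (k - i) = k by omega] at m1
      rw [hp, show i + (k - i + 1) = k + 1 by omega] at m2
      refine ⟨c, c', hc, hc', h.wedge hτ ⟨t, ht, hct⟩, ?_, ?_⟩
      · simp only [List.mem_append, or_assoc] at m1
        exact m1.imp (fun h => ⟨τ, hτ, h⟩) (Or.imp (fun h => ⟨τ, hτ, h⟩)
          (Or.imp (fun h => ⟨τ, hτ, h⟩) fun h => ⟨τ, hτ, h⟩))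
      · simp only [List.mem_append, or_assoc] at m2
        exact m2.imp (fun h => ⟨τ, hτ, h⟩) (Or.imp (fun h => ⟨τ, hτ, h⟩)
          (Or.imp (fun h => ⟨τ, hτ, h⟩) fun h => ⟨τ, hτ, h⟩))
  -- The walk runs through all natural exponents, so it need not be shown to close up after a full
  -- turn.
  have all : ∀ N : ℕ, ∃ i ≥ N, A i ∧ ∀ k < i, B k := by
    intro N
    induction N with
    | zero =>
      refine ⟨0, le_rfl, ⟨τ, hτ, e, he, by simpa using hr, by simpa using hn⟩, fun k hk => ?_⟩
      exact absurd hk (Nat.not_lt_zero k)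
    | succ N ih =>
      obtain ⟨i, hi, hA, hB⟩ := ih
      obtain ⟨j, hj, hA', hB'⟩ := step i hA
      refine ⟨i + j, by omega, hA', fun k hk => ?_⟩
      rcases lt_or_ge k i with hki | hki
      · exact hB k hki
      · exact hB' k hki hk
  intro k
  obtain ⟨i, hi, -, hB⟩ := all (k + 1)
  exact hB k (by omega)

end Complete

/-! ### Degrees, sums and neighbours of the vertices -/

/-- The point `z` is a vertex of degree `n` and sum `s`, with neighbours in `N` at distance `1`
or `√2`. -/
structure VertexSpec (T : Set (Set ℂ)) (z : ℂ) (n s : ℕ) (N : Set ℂ) : Prop where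
  mem : z ∈ tilingVertices T
  finite : ((tilingGraph T).neighborSet ⟨z, mem⟩).Finite
  degree : ((tilingGraph T).neighborSet ⟨z, mem⟩).ncard = n
  sum : weightedDegree (tilingGraph T) (lengthWeight T) ⟨z, mem⟩ = s
  neighbor : ∀ q, (tilingGraph T).Adj ⟨z, mem⟩ q →
    (q : ℂ) ∈ N ∧ (dist z q = 1 ∨ dist z q = √2)

/-- This keeps classes of vertices with different sums disjoint. -/
theorem VertexSpec.sum_unique {T : Set (Set ℂ)} {z : ℂ} {n s n' s' : ℕ} {N N' : Set ℂ}
    (h : VertexSpec T z n s N) (h' : VertexSpec T z n' s' N') : s = s' :=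
  h.sum.symm.trans h'.sum

theorem ListStar.vertexSpec {T : Set (Set ℂ)} {p u ω : ℂ} {P : List (ℕ × ℕ)} {b : ℕ → Bool}
    (h : ListStar T p u ω P (len b)) (hT : IsTiling T) (hs : AllStars T) {N : Set ℂ}
    (hN : ∀ a ∈ P, p + len b (a.1 % 8) • (ω ^ (a.1 % 8) * u) ∈ N) :
    VertexSpec T p (exponents P).card (∑ k ∈ exponents P, bif b k then 2 else 1) N where
  mem := h.mem_vertices
  finite := (h.degree_sum hT hs _).1
  degree := (h.degree_sum hT hs _).2.1
  sum := (h.degree_sum hT hs _).2.2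
  neighbor q hq := by
    obtain ⟨a, ha, e⟩ := (h.adj_iff hT hs _ q).1 hq
    rw [e, dist_dir h.eighth h.norm_u (h.length_pos _)]
    exact ⟨hN a ha, len_eq_or _ _⟩

namespace Complete

variable {T : Set (Set ℂ)} {Q : Set Tile}

theorem exists_corner_star (h : Complete T Q) {z : ℂ} (hz : z ∈ ptsOf Tile.cornerPts Q) :
    ∃ d ω, ∃ c : ℕ → ℝ, ‖d‖ = 1 ∧ Eighth ω ∧ (∀ k, c k = 1 ∨ c k = √2) ∧
      (∀ k, ∃ w, Wedge T z (c k • (ω ^ k * d)) w) ∧ ∃ S v w, Star T z S v w ∧ ∀ k < 8,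
        v k ∈ {w | ∃ k, ∃ r : ℝ, 0 < r ∧ w = r • (ω ^ k * d) ∧ Inner Q (z + w)} ∧
        w k ∈ {w | ∃ k, ∃ r : ℝ, 0 < r ∧ w = r • (ω ^ k * d) ∧ Inner Q (z + w)} := by
  obtain ⟨d, ω, hd, hω, H⟩ := h.corner_sectors hz
  choose c c' hc hc' hw hi hi' using H
  have pos : ∀ {r : ℝ}, r = 1 ∨ r = √2 → 0 < r := by
    rintro r (rfl | rfl) <;> positivity
  refine ⟨d, ω, c, hd, hω, hc, fun k => ⟨_, hw k⟩,
    hω.exists_star (Eighth.unit_ne_zero hd) fun k _ =>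
      ⟨_, ⟨k, c k, pos (hc k), rfl, hi k⟩, _, ⟨k + 1, c' k, pos (hc' k), rfl, hi' k⟩, hw k, ?_⟩⟩
  exact ⟨hω.dir_mem_cone d le_rfl k.le_succ k.lt_succ_self (by omega) (pos (hc k)) (pos (hc' k)),
    hω.dir_mem_cone d k.le_succ le_rfl k.lt_succ_self (by omega) (pos (hc k)) (pos (hc' k))⟩

theorem mem_or_inner (h : Complete T Q) {p : ℂ} (hp : p ∈ tilingVertices T) :
    p ∈ ptsOf Tile.cornerPts Q ∨ Inner Q p := by
  obtain ⟨S, hS, hp⟩ := mem_tilingVertices.1 hp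
  obtain ⟨τ, hτ, t, ht, rfl⟩ := (h.tiles S).1 hS
  rw [((h.valid τ hτ).subst_valid ht).extremePoints] at hp
  have := (h.valid τ hτ).subst_verts ht hp
  simp only [Tile.allPts, List.mem_append, or_assoc] at this
  exact this.imp (fun h => ⟨τ, hτ, h⟩) (Or.imp (fun h => ⟨τ, hτ, h⟩)
    (Or.imp (fun h => ⟨τ, hτ, h⟩) (Or.imp (fun h => ⟨τ, hτ, h⟩) fun h => ⟨τ, hτ, h⟩)))

/-- Stars at all vertices are needed before any neighbourhood can be computed: they exclude
intermediate vertices on the sides of tiles in `Wedge.adj`. -/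
theorem allStars (h : Complete T Q) : AllStars T := by
  intro p hp
  rcases h.mem_or_inner hp with hp | hp | hp | hp | hp
  · obtain ⟨d, ω, c, -, -, -, -, S, v, w, hS, -⟩ := h.exists_corner_star hp
    exact ⟨S, v, w, hS⟩
  · obtain ⟨u, ω, hS, -⟩ := h.mid_star hp
    obtain ⟨S, v, w, hS, -⟩ := hS.exists_star
    exact ⟨S, v, w, hS⟩
  · obtain ⟨u, ω, hS, -⟩ := h.seven_star hp
    obtain ⟨S, v, w, hS, -⟩ := hS.exists_star
    exact ⟨S, v, w, hS⟩
  · obtain ⟨u, ω, hS, -⟩ := h.five_star hp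
    obtain ⟨S, v, w, hS, -⟩ := hS.exists_star
    exact ⟨S, v, w, hS⟩
  · obtain ⟨u, ω, l, -, hS, -⟩ := h.four_star hp
    obtain ⟨S, v, w, hS, -⟩ := hS.exists_star
    exact ⟨S, v, w, hS⟩

/-- Each of the eight directions carries exactly one edge. No pattern of lengths is fixed, hence
only a lower bound on the sum. -/
theorem corner_spec (h : Complete T Q) (hT : IsTiling T) {z : ℂ}
    (hz : z ∈ ptsOf Tile.cornerPts Q) : ∃ s ≥ 8, VertexSpec T z 8 s {z | Inner Q z} := by
  have hs := h.allStars
  obtain ⟨d, ω, c, hd, hω, hc, hw, S, v, w, hS, hN⟩ := h.exists_corner_star hz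
  have pos : ∀ k, 0 < c k := fun k => by rcases hc k with e | e <;> rw [e] <;> positivity
  obtain ⟨w₀, hw₀⟩ := hw 0
  have hp := hw₀.mem_vertices
  have hadj : ∀ k, (tilingGraph T).Adj ⟨z, hp⟩ ⟨_, (hw k).choose_spec.left_mem_vertices⟩ :=
    fun k => (hw k).choose_spec.adj hT hs
  have hnb : ∀ q, (tilingGraph T).Adj ⟨z, hp⟩ q →
      Inner Q q ∧ ∃ k ∈ Finset.range 8, (q : ℂ) = z + c k • (ω ^ k * d) := by
    intro q hq
    obtain ⟨i, hi, hqi⟩ := hS.neighbor hT hs hq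
    obtain ⟨x, ⟨k, r, hr, hx, hin⟩, hqx⟩ :
        ∃ x ∈ {w | ∃ k, ∃ r : ℝ, 0 < r ∧ w = r • (ω ^ k * d) ∧ Inner Q (z + w)}, (q : ℂ) = z + x := by
      rcases hqi with e | e
      · exact ⟨_, (hN i hi).1, e⟩
      · exact ⟨_, (hN i hi).2, e⟩
    refine ⟨hqx ▸ hin, k % 8, Finset.mem_range.2 (Nat.mod_lt _ (by norm_num)), ?_⟩
    -- The sides of consecutive tiles in a common direction were obtained separately and could
    -- differ in length; as edges of the graph they coincide.
    have := adj_unique (hadj (k % 8)) hq (div_pos hr (pos (k % 8))) (by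
      rw [hqx, hx, add_sub_cancel_left, add_sub_cancel_left, smul_smul,
        div_mul_cancel₀ _ (pos _).ne', hω.pow_mod])
    rw [this]
  have H := degree_and_sum hω hd hc (K := Finset.range 8) (fun k hk => Finset.mem_range.1 hk) hp
    (fun k _ => (hw k).choose_spec.left_mem_vertices) fun q =>
      ⟨fun hq => (hnb q hq).2, fun ⟨k, _, e⟩ => by
        have := hadj k
        convert this⟩
  refine ⟨_, ?_, hp, H.1, H.2.1.trans (Finset.card_range 8), H.2.2, fun q hq => ?_⟩
  · calc 8 = ∑ k ∈ Finset.range 8, 1 := by simp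
      _ ≤ _ := Finset.sum_le_sum fun k _ => by split_ifs <;> norm_num
  · obtain ⟨hin, k, -, e⟩ := hnb q hq
    rw [e] at hin ⊢
    rw [dist_dir hω hd (pos k)]
    exact ⟨hin, hc k⟩

theorem mid_spec (h : Complete T Q) (hT : IsTiling T) {z : ℂ} (hz : z ∈ ptsOf Tile.midPts Q) :
    VertexSpec T z 4 5
      (ptsOf Tile.cornerPts Q ∪ ptsOf Tile.sevenPts Q ∪ ptsOf Tile.fourPts Q) := by
  obtain ⟨u, ω, hS, h0, h4, h1, h7⟩ := h.mid_star hz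
  refine hS.vertexSpec hT h.allStars fun a ha => ?_
  simp only [List.mem_cons, List.not_mem_nil, or_false] at ha
  rcases ha with rfl | rfl | rfl | rfl
  · exact Or.inl (Or.inl (by simpa [len] using h0))
  · rw [Set.union_assoc]; exact Or.inr (by simpa [len] using h1)
  · exact Or.inl (Or.inl (by simpa [len] using h4))
  · rw [Set.union_assoc]; exact Or.inr (by simpa [len] using h7)

theorem seven_spec (h : Complete T Q) (hT : IsTiling T) {z : ℂ}
    (hz : z ∈ ptsOf Tile.sevenPts Q) :
    VertexSpec T z 6 7 (ptsOf Tile.cornerPts Q ∪ (ptsOf Tile.midPts Q ∪ ptsOf Tile.fivePts Q ∪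
      ptsOf Tile.fourPts Q)) := by
  obtain ⟨u, ω, hS, h0, h2, h3, h4⟩ := h.seven_star hz
  refine hS.vertexSpec hT h.allStars fun a ha => ?_
  simp only [List.mem_cons, List.not_mem_nil, or_false] at ha
  rcases ha with rfl | rfl | rfl | rfl | rfl | rfl
  · exact Or.inl (by simpa [len] using h0)
  · exact Or.inr (Or.inl (Or.inl (by simpa [len] using h2 2 (by simp))))
  · exact Or.inr (Or.inr (by simpa [len] using h3 3 (by simp)))
  · exact Or.inr (Or.inl (Or.inr (by simpa [len] using h4)))
  · exact Or.inr (Or.inr (by simpa [len] using h3 5 (by simp)))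
  · exact Or.inr (Or.inl (Or.inl (by simpa [len] using h2 6 (by simp))))

theorem five_spec (h : Complete T Q) (hT : IsTiling T) {z : ℂ} (hz : z ∈ ptsOf Tile.fivePts Q) :
    VertexSpec T z 4 5
      (ptsOf Tile.cornerPts Q ∪ ptsOf Tile.sevenPts Q ∪ ptsOf Tile.fourPts Q) := by
  obtain ⟨u, ω, hS, h0, h3, h4⟩ := h.five_star hz
  refine hS.vertexSpec hT h.allStars fun a ha => ?_
  simp only [List.mem_cons, List.not_mem_nil, or_false] at ha
  rcases ha with rfl | rfl | rfl | rfl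
  · exact Or.inl (Or.inl (by simpa [len] using h0))
  · exact Or.inr (by simpa [len] using h3 3 (by simp))
  · exact Or.inl (Or.inr (by simpa [len] using h4))
  · exact Or.inr (by simpa [len] using h3 5 (by simp))

theorem four_spec (h : Complete T Q) (hT : IsTiling T) {z : ℂ} (hz : z ∈ ptsOf Tile.fourPts Q) :
    VertexSpec T z 4 4 (ptsOf Tile.cornerPts Q ∪ (ptsOf Tile.midPts Q ∪ ptsOf Tile.sevenPts Q ∪
      ptsOf Tile.fivePts Q)) := by
  obtain ⟨u, ω, l, hl, hS, hn⟩ := h.four_star hz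
  have := hS.vertexSpec hT h.allStars (N := ptsOf Tile.cornerPts Q ∪ (ptsOf Tile.midPts Q ∪
    ptsOf Tile.sevenPts Q ∪ ptsOf Tile.fivePts Q)) fun a ha => by
      rw [Set.union_assoc]
      have : a.1 ∈ [l.1, l.2.1, l.2.2.1, l.2.2.2] := by
        simp only [List.mem_cons, List.not_mem_nil, or_false] at ha ⊢
        rcases ha with rfl | rfl | rfl | rfl <;> simp
      simpa [len, hS.eighth.pow_mod] using hn a.1 this
  simp only [List.mem_cons, List.not_mem_nil, or_false] at hl
  rcases hl with rfl | rfl | rfl <;> exact this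

theorem inner_sum_lt (h : Complete T Q) (hT : IsTiling T) {z : ℂ} (hz : Inner Q z) :
    ∃ n, ∃ s < 8, ∃ N, VertexSpec T z n s N := by
  rcases hz with hz | hz | hz | hz
  · exact ⟨_, 5, by norm_num, _, h.mid_spec hT hz⟩
  · exact ⟨_, 7, by norm_num, _, h.seven_spec hT hz⟩
  · exact ⟨_, 5, by norm_num, _, h.five_spec hT hz⟩
  · exact ⟨_, 4, by norm_num, _, h.four_spec hT hz⟩

theorem exists_spec (h : Complete T Q) (hT : IsTiling T) {z : ℂ} (hz : z ∈ tilingVertices T) :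
    ∃ n s N, VertexSpec T z n s N := by
  rcases h.mem_or_inner hz with hz | hz
  · obtain ⟨s, -, hs⟩ := h.corner_spec hT hz
    exact ⟨_, s, _, hs⟩
  · obtain ⟨n, s, -, N, hs⟩ := h.inner_sum_lt hT hz
    exact ⟨n, s, N, hs⟩

/-- Corners have sum at least `8`, all other vertices at most `7`. -/
theorem corner_ne_inner (h : Complete T Q) (hT : IsTiling T) {z : ℂ}
    (hz : z ∈ ptsOf Tile.cornerPts Q) : ¬Inner Q z := by
  intro hz'
  obtain ⟨s, hs, h1⟩ := h.corner_spec hT hz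
  obtain ⟨_, s', hs', _, h2⟩ := h.inner_sum_lt hT hz'
  have := h1.sum_unique h2
  omega

/-- Neighbours of a vertex are distinguished from it by their sums. -/
theorem sum_ne (h : Complete T Q) (hT : IsTiling T) {u v : tilingVertices T}
    (huv : (tilingGraph T).Adj u v) :
    weightedDegree (tilingGraph T) (lengthWeight T) u ≠
      weightedDegree (tilingGraph T) (lengthWeight T) v := by
  have key : ∀ {n s n' s' : ℕ} {N N' : Set ℂ}, VertexSpec T u n s N → VertexSpec T v n' s' N' →
      s ≠ s' → weightedDegree (tilingGraph T) (lengthWeight T) u ≠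
      weightedDegree (tilingGraph T) (lengthWeight T) v := fun h1 h2 hs => by
    rw [show weightedDegree (tilingGraph T) (lengthWeight T) u = _ from h1.sum,
      show weightedDegree (tilingGraph T) (lengthWeight T) v = _ from h2.sum]
    exact hs
  -- a corner and an inner vertex
  have hC : ∀ {n s : ℕ} {N : Set ℂ}, s < 8 → VertexSpec T u n s N →
      (v : ℂ) ∈ ptsOf Tile.cornerPts Q → weightedDegree (tilingGraph T) (lengthWeight T) u ≠
      weightedDegree (tilingGraph T) (lengthWeight T) v := fun hs h1 hv => by
    obtain ⟨s', hs', h2⟩ := h.corner_spec hT hv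
    exact key h1 h2 (by omega)
  rcases h.mem_or_inner u.2 with hu | hu | hu | hu | hu
  · obtain ⟨s, hs, h1⟩ := h.corner_spec hT hu
    obtain ⟨n', s', hs', N', h2⟩ := h.inner_sum_lt hT (h1.neighbor v huv).1
    exact key h1 h2 (by omega)
  -- Mid-side vertices and the points of `fivePts` share the sum `5`, but the neighbours listed for
  -- either kind contain neither kind.
  · have h1 := h.mid_spec hT hu
    rcases (h1.neighbor v huv).1 with (hv | hv) | hv
    · exact hC (by norm_num) h1 hv
    · exact key h1 (h.seven_spec hT hv) (by norm_num)
    · exact key h1 (h.four_spec hT hv) (by norm_num)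
  · have h1 := h.seven_spec hT hu
    rcases (h1.neighbor v huv).1 with hv | (hv | hv) | hv
    · exact hC (by norm_num) h1 hv
    · exact key h1 (h.mid_spec hT hv) (by norm_num)
    · exact key h1 (h.five_spec hT hv) (by norm_num)
    · exact key h1 (h.four_spec hT hv) (by norm_num)
  · have h1 := h.five_spec hT hu
    rcases (h1.neighbor v huv).1 with (hv | hv) | hv
    · exact hC (by norm_num) h1 hv
    · exact key h1 (h.seven_spec hT hv) (by norm_num)
    · exact key h1 (h.four_spec hT hv) (by norm_num)
  · have h1 := h.four_spec hT hu
    rcases (h1.neighbor v huv).1 with hv | (hv | hv) | hv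
    · exact hC (by norm_num) h1 hv
    · exact key h1 (h.mid_spec hT hv) (by norm_num)
    · exact key h1 (h.seven_spec hT hv) (by norm_num)
    · exact key h1 (h.five_spec hT hv) (by norm_num)

theorem dist_eq (h : Complete T Q) (hT : IsTiling T) {u v : tilingVertices T}
    (huv : (tilingGraph T).Adj u v) : dist (u : ℂ) v = 1 ∨ dist (u : ℂ) v = √2 := by
  obtain ⟨n, s, N, hu⟩ := h.exists_spec hT u.2
  exact (hu.neighbor v huv).2

theorem isSolution123 (h : Complete T Q) (hT : IsTiling T) :
    IsSolution123 (tilingGraph T) (lengthWeight T) where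
  locallyFinite v := by
    obtain ⟨n, s, N, hv⟩ := h.exists_spec hT v.2
    exact hv.finite
  label_mem e _ := by
    induction e with
    | h x y =>
      simp only [lengthWeight, Sym2.lift_mk]
      split_ifs <;> norm_num
  colouring u v huv := h.sum_ne hT huv

/-- Corners are joined to external vertices by edges only if these are mid-side vertices. -/
theorem external (h : Complete T Q) (hT : IsTiling T) {u v : tilingVertices T}
    (huv : (tilingGraph T).Adj u v)
    (hu : (u : ℂ) ∈ ptsOf Tile.cornerPts Q ∪ ptsOf Tile.midPts Q)
    (hv : (v : ℂ) ∈ ptsOf Tile.cornerPts Q ∪ ptsOf Tile.midPts Q) :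
    ((u : ℂ) ∈ ptsOf Tile.cornerPts Q ∧ (v : ℂ) ∈ ptsOf Tile.midPts Q) ∨
      ((u : ℂ) ∈ ptsOf Tile.midPts Q ∧ (v : ℂ) ∈ ptsOf Tile.cornerPts Q) := by
  have mid : ∀ {n s : ℕ} {N : Set ℂ}, s ≠ 5 → VertexSpec T v n s N →
      (v : ℂ) ∉ ptsOf Tile.midPts Q := fun hs h1 hv =>
    hs (h1.sum_unique (h.mid_spec hT hv))
  rcases hu with hu | hu
  · obtain ⟨s, -, h1⟩ := h.corner_spec hT hu
    have hi := (h1.neighbor v huv).1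
    exact Or.inl ⟨hu, hv.resolve_left fun hv => h.corner_ne_inner hT hv hi⟩
  · refine Or.inr ⟨hu, ?_⟩
    rcases ((h.mid_spec hT hu).neighbor v huv).1 with (h1 | h1) | h1
    · exact h1
    · exact hv.resolve_right (mid (by norm_num) (h.seven_spec hT h1))
    · exact hv.resolve_right (mid (by norm_num) (h.four_spec hT h1))

end Complete

/-! ### From base tiles back to the vertices of supertiles -/

theorem cornerSet_eq (𝒮 : Set Supertile) :
    cornerSet 𝒮 = ptsOf Tile.cornerPts {τ | ∃ s ∈ 𝒮, τ ∈ s.base} := by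
  ext z
  simp only [cornerSet, ptsOf, Set.mem_iUnion, exists_prop, Set.mem_ofPred_eq]
  have : ∀ s : Supertile, z ∈ s.corners ↔ ∃ τ ∈ s.base, z ∈ τ.cornerPts := by
    rintro (⟨a, b, c⟩ | ⟨p, q, r, s⟩)
    · simp [Supertile.corners, Supertile.base, Tile.cornerPts, Tile.verts]
      tauto
    · simp [Supertile.corners, Supertile.base, Tile.cornerPts, Tile.verts, eq_comm]
  simp only [this]
  exact ⟨fun ⟨s, hs, τ, hτ, hz⟩ => ⟨τ, ⟨s, hs, hτ⟩, hz⟩,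
    fun ⟨τ, ⟨s, hs, hτ⟩, hz⟩ => ⟨s, hs, τ, hτ, hz⟩⟩

theorem midSideSet_eq (𝒮 : Set Supertile) :
    midSideSet 𝒮 = ptsOf Tile.midPts {τ | ∃ s ∈ 𝒮, τ ∈ s.base} := by
  ext z
  simp only [midSideSet, ptsOf, Set.mem_iUnion, exists_prop, Set.mem_ofPred_eq]
  have : ∀ s : Supertile, z ∈ s.midSides ↔ ∃ τ ∈ s.base, z ∈ τ.midPts := by
    rintro (⟨a, b, c⟩ | ⟨p, q, r, s⟩)
    · simp [Supertile.midSides, Supertile.base, Tile.midPts]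
      tauto
    · simp [Supertile.midSides, Supertile.base, Tile.midPts]
  simp only [this]
  exact ⟨fun ⟨s, hs, τ, hτ, hz⟩ => ⟨τ, ⟨s, hs, hτ⟩, hz⟩,
    fun ⟨τ, ⟨s, hs, hτ⟩, hz⟩ => ⟨s, hs, τ, hτ, hz⟩⟩

theorem mem_internalSumSet {𝒮 : Set Supertile} {z : ℂ} {k : ℕ} :
    (z, k) ∈ internalSumSet 𝒮 ↔
      (z ∈ ptsOf Tile.sevenPts {τ | ∃ s ∈ 𝒮, τ ∈ s.base} ∧ k = 7) ∨
      (z ∈ ptsOf Tile.fivePts {τ | ∃ s ∈ 𝒮, τ ∈ s.base} ∧ k = 5) ∨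
      (z ∈ ptsOf Tile.fourPts {τ | ∃ s ∈ 𝒮, τ ∈ s.base} ∧ k = 4) := by
  simp only [internalSumSet, ptsOf, Set.mem_iUnion, exists_prop, Set.mem_ofPred_eq]
  have : ∀ s : Supertile, (z, k) ∈ s.internalSums ↔ ∃ τ ∈ s.base, (z ∈ τ.sevenPts ∧ k = 7) ∨
      (z ∈ τ.fivePts ∧ k = 5) ∨ (z ∈ τ.fourPts ∧ k = 4) := by
    rintro (⟨a, b, c⟩ | ⟨p, q, r, s⟩)
    · simp [Supertile.internalSums, Supertile.base, Tile.sevenPts, Tile.fivePts, Tile.fourPts]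
      tauto
    · simp [Supertile.internalSums, Supertile.base, Tile.sevenPts, Tile.fivePts, Tile.fourPts]
      tauto
  simp only [this]
  constructor
  · rintro ⟨s, hs, τ, hτ, hz⟩
    exact hz.imp (fun hz => ⟨⟨τ, ⟨s, hs, hτ⟩, hz.1⟩, hz.2⟩) (Or.imp
      (fun hz => ⟨⟨τ, ⟨s, hs, hτ⟩, hz.1⟩, hz.2⟩) fun hz => ⟨⟨τ, ⟨s, hs, hτ⟩, hz.1⟩, hz.2⟩)
  · rintro (⟨⟨τ, ⟨s, hs, hτ⟩, hz⟩, hk⟩ | ⟨⟨τ, ⟨s, hs, hτ⟩, hz⟩, hk⟩ | ⟨⟨τ, ⟨s, hs, hτ⟩, hz⟩, hk⟩)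
    · exact ⟨s, hs, τ, hτ, Or.inl ⟨hz, hk⟩⟩
    · exact ⟨s, hs, τ, hτ, Or.inr (Or.inl ⟨hz, hk⟩)⟩
    · exact ⟨s, hs, τ, hτ, Or.inr (Or.inr ⟨hz, hk⟩)⟩

end AmmannBeenker
end

theorem mainTheorem4 (T : Set (Set ℂ)) (hT : AmmannBeenker.IsRhombTriangleTiling T) :
    -- all edges have length `1` or `√2`, and the weighting by length solves the 1-2-3 problem
    (∀ u v, (tilingGraph T).Adj u v → dist (u : ℂ) v = 1 ∨ dist (u : ℂ) v = √2) ∧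
    IsSolution123 (tilingGraph T) (lengthWeight T) ∧
    -- the tiling can be grouped into supertiles
    (∃ 𝒮, AmmannBeenker.IsGrouping T 𝒮) ∧
    ∀ 𝒮, AmmannBeenker.IsGrouping T 𝒮 →
      -- the corners have degree `8`, hence sum at least `8`
      (∀ p ∈ AmmannBeenker.cornerSet 𝒮, ∃ hp : p ∈ tilingVertices T,
        ((tilingGraph T).neighborSet ⟨p, hp⟩).ncard = 8 ∧
        8 ≤ weightedDegree (tilingGraph T) (lengthWeight T) ⟨p, hp⟩) ∧
      -- the mid-side vertices have degree `4` and sum `5`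
      (∀ p ∈ AmmannBeenker.midSideSet 𝒮, ∃ hp : p ∈ tilingVertices T,
        ((tilingGraph T).neighborSet ⟨p, hp⟩).ncard = 4 ∧
        weightedDegree (tilingGraph T) (lengthWeight T) ⟨p, hp⟩ = 5) ∧
      -- the internal vertices have sums `7, 5, 4, 4` (diamond) and `4, 4` (rhombus)
      (∀ pk ∈ AmmannBeenker.internalSumSet 𝒮, ∃ hp : pk.1 ∈ tilingVertices T,
        weightedDegree (tilingGraph T) (lengthWeight T) ⟨pk.1, hp⟩ = pk.2) ∧
      -- there are no other vertices
      (∀ p ∈ tilingVertices T, p ∈ AmmannBeenker.cornerSet 𝒮 ∨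
        p ∈ AmmannBeenker.midSideSet 𝒮 ∨ ∃ k, (p, k) ∈ AmmannBeenker.internalSumSet 𝒮) ∧
      -- the external vertices are 2-coloured by the classes of corners and mid-side vertices
      Disjoint (AmmannBeenker.cornerSet 𝒮) (AmmannBeenker.midSideSet 𝒮) ∧
      (∀ u v, (tilingGraph T).Adj u v →
        (u : ℂ) ∈ AmmannBeenker.cornerSet 𝒮 ∪ AmmannBeenker.midSideSet 𝒮 →
        (v : ℂ) ∈ AmmannBeenker.cornerSet 𝒮 ∪ AmmannBeenker.midSideSet 𝒮 →
        ((u : ℂ) ∈ AmmannBeenker.cornerSet 𝒮 ∧ (v : ℂ) ∈ AmmannBeenker.midSideSet 𝒮) ∨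
        ((u : ℂ) ∈ AmmannBeenker.midSideSet 𝒮 ∧ (v : ℂ) ∈ AmmannBeenker.cornerSet 𝒮)) := by
  obtain ⟨hM, Q, hQ⟩ := hT.exists_composition
  obtain ⟨𝒮₀, h₀⟩ := hQ.exists_grouping
  -- Edge lengths and weights concern `T` alone, so the constructed grouping suffices for them. The
  -- remaining claims apply the same lemmas to an arbitrary grouping, which `hM` makes complete as
  -- well.
  have hc₀ := h₀.complete hM
  refine ⟨fun u v => hc₀.dist_eq hT.isTiling, hc₀.isSolution123 hT.isTiling, ⟨𝒮₀, h₀⟩,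
    fun 𝒮 h𝒮 => ?_⟩
  have hc := h𝒮.complete hM
  have hT' := hT.isTiling
  rw [AmmannBeenker.cornerSet_eq, AmmannBeenker.midSideSet_eq]
  refine ⟨fun p hp => ?_, fun p hp => ?_, ?_, fun p hp => ?_, ?_, fun u v => hc.external hT'⟩
  · obtain ⟨s, hs, h⟩ := hc.corner_spec hT' hp
    exact ⟨h.mem, h.degree, hs.trans h.sum.ge⟩
  · have h := hc.mid_spec hT' hp
    exact ⟨h.mem, h.degree, h.sum⟩
  · rintro ⟨z, k⟩ hk
    rcases AmmannBeenker.mem_internalSumSet.1 hk with ⟨hz, rfl⟩ | ⟨hz, rfl⟩ | ⟨hz, rfl⟩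
    · exact ⟨_, (hc.seven_spec hT' hz).sum⟩
    · exact ⟨_, (hc.five_spec hT' hz).sum⟩
    · exact ⟨_, (hc.four_spec hT' hz).sum⟩
  · simp only [AmmannBeenker.mem_internalSumSet]
    rcases hc.mem_or_inner hp with hp | hp | hp | hp | hp
    · exact Or.inl hp
    · exact Or.inr (Or.inl hp)
    · exact Or.inr (Or.inr ⟨7, Or.inl ⟨hp, rfl⟩⟩)
    · exact Or.inr (Or.inr ⟨5, Or.inr (Or.inl ⟨hp, rfl⟩)⟩)
    · exact Or.inr (Or.inr ⟨4, Or.inr (Or.inr ⟨hp, rfl⟩)⟩)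
  · exact Set.disjoint_left.2 fun z hz hz' => hc.corner_ne_inner hT' hz (Or.inl hz')
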